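/- Let $0<\mu<3/2$, $Q(s)=s^{1+1/\mu}$ for $s\ge 0$, and $p:=\mu+\tfrac32$ (so $p-1=\mu+\tfrac12$). For a phase-space density $f=f(x,v)$ on $\mathbb R^3\times\mathbb R^3$ put $$\rho_f(x)=\int f(x,v)\,dv,\qquad U_f=-\frac1{|\cdot|}*\rho_f,\qquad J(f)=\iint Q(f)\,dv\,dx+\frac12\iint|v|^2f\,dv\,dx,$$ $$\mathcal D(f)=J(f)-\frac1{8\pi}\int|\nabla U_f|^2\,dx .$$ For $M>0$ let $\mathcal F_M$ be the set of all $f\in L^1(\mathbb R^6)$ with $f\ge0$, $\iint f\,dv\,dx=M$, $J(f)<\infty$ which are spherically symmetric, i.e. $f(Ax,Av)=f(x,v)$ for all $A\in \mathrm{SO}(3)$. For a minimizer $f$ of $\mathcal D$ in $\mathcal F_M$ put $$E_f:=\frac1M\iint\Bigl(Q'(f)+\tfrac12|v|^2+U_f\Bigr)f\,dv\,dx .$$ For $c>0$, an E-solution of the Emden–Fowler equation $$\frac1{r^2}(r^2\phi')'=-c\,(\phi)_+^{\,p},\qquad r>0, \qquad (\ast)$$ is a solution $\phi$, continuous on $[0,\infty[$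 and differentiable on $]0,\infty[$, which is regular at the centre: $\phi(0)>0$ and $\phi'(r)\to0$ as $r\to0$. On the set of $t$ with $\phi(e^t)>0$ let, with $r=e^t$, $$u(t)=-\frac{r\,\phi(r)^{p}}{\phi'(r)},\qquad v(t)=-\frac{r\,\phi'(r)}{\phi(r)} .$$ (i) For every $c>0$ and every E-solution $\phi$ of $(\ast)$, $(u,v)$ solves the autonomous system $\dot u=u(3-pv-cu)$, $\dot v=v(-1+cu+v)$. Any two E-solutions $\phi_1,\phi_2$ of $(\ast)$ trace out the same orbit in the $(u,v)$-plane, and there is $\gamma>0$ with $\phi_1(r)=\gamma^{2/(\mu+1/2)}\phi_2(\gamma r)$ for all $r>0$. (ii) There is a constant $c>0$, depending only on $\mu$, such that for every $M>0$ the following holds. The functional $\mathcal D$ has a minimizer in $\mathcal F_M$. There is $R_0>0$ such that for every minimizer $f$ of $\mathcal D$ in $\mathcal F_M$ the potential $U_f$ is a function of $r=|x|$ only, $\phi:=E_f-U_f$ as a function of $r$ is an E-solution of $(\ast)$, and $U_f(r)=-M/r$ for $r\ge R_0$. If $f_1,f_2$ are two minimizers of $\mathcal D$ in $\mathcal F_M$,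 then the E-solutions $E_{f_i}-U_{f_i}$, $i=1,2$, trace out the same orbit in the $(u,v)$-plane; there is $\gamma>0$ such that $$E_{f_1}-U_{f_1}(r)=\gamma^{2/(\mu+1/2)}\bigl(E_{f_2}-U_{f_2}(\gamma r)\bigr),\qquad r>0;$$ every such $\gamma$ equals $1$; and $E_{f_1}=E_{f_2}$, $U_{f_1}=U_{f_2}$ and $f_1=f_2$ almost everywhere. Thus the minimizer of $\mathcal D$ in $\mathcal F_M$ exists and is unique. -/

import Mathlib

open MeasureTheory Filter Topology Set

/-- Physical space `ℝ³` (positions and velocities), with the Euclidean norm. -/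
abbrev R3 : Type := EuclideanSpace ℝ (Fin 3)

/-- The spatial density `ρ_f(x) = ∫ f(x,v) dv` of a phase space density `f`. -/
noncomputable def density (f : R3 × R3 → ℝ) (x : R3) : ℝ := ∫ v, f (x, v)

/-- The potential `U_f = - (1/|·|) * ρ_f`, which vanishes at infinity. -/
noncomputable def potential (f : R3 × R3 → ℝ) (x : R3) : ℝ :=
  -∫ y, density f y / ‖x - y‖

/-- `J(f) = ∬ Q(f) dv dx + ½ ∬ |v|² f dv dx`. -/
noncomputable def functionalJ (Q : ℝ → ℝ) (f : R3 × R3 → ℝ) : ℝ :=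
  (∫ z, Q (f z)) + 1 / 2 * ∫ z : R3 × R3, ‖z.2‖ ^ 2 * f z

/-- The energy-Casimir functional `D(f) = J(f) - (1/8π) ∫ |∇U_f|² dx`.
For spherically symmetric integrable `f`, the potential `U_f` is continuously differentiable
away from the origin, so that the classical gradient is meant. -/
noncomputable def functionalD (Q : ℝ → ℝ) (f : R3 × R3 → ℝ) : ℝ :=
  functionalJ Q f - 1 / (8 * Real.pi) * ∫ x, ‖gradient (potential f) x‖ ^ 2

/-- Spherical symmetry `f(Ax,Av) = f(x,v)` for all rotations `A ∈ SO(3)`; elements of `L¹` are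
represented by functions, so the identity is required almost everywhere. -/
def SphericallySymmetric (f : R3 × R3 → ℝ) : Prop :=
  ∀ A : R3 ≃ₗᵢ[ℝ] R3, LinearMap.det (A.toLinearEquiv : R3 →ₗ[ℝ] R3) = 1 →
    ∀ᵐ z : R3 × R3, f (A z.1, A z.2) = f z

/-- Membership in the set `F_M` (for `Q ≥ 0`): `f ∈ L¹(ℝ⁶)`, `f ≥ 0`, `∬ f = M`, `J(f) < ∞`
(both nonnegative terms of `J` are finite), and `f` is spherically symmetric. -/
structure MemF (Q : ℝ → ℝ) (M : ℝ) (f : R3 × R3 → ℝ) : Prop where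
  integrable : Integrable f
  nonneg : ∀ᵐ z, 0 ≤ f z
  mass : ∫ z, f z = M
  casimir_finite : Integrable (fun z => Q (f z))
  kinetic_finite : Integrable (fun z : R3 × R3 => ‖z.2‖ ^ 2 * f z)
  symmetric : SphericallySymmetric f

/-- `f` is a minimizer of `D` in `F_M`. -/
def IsMinimizer (Q : ℝ → ℝ) (M : ℝ) (f : R3 × R3 → ℝ) : Prop :=
  MemF Q M f ∧ ∀ g, MemF Q M g → functionalD Q f ≤ functionalD Q g

/-- The polytropic Casimir function `Q(s) = s^{1+1/μ}`, `s ≥ 0`. -/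
noncomputable def polytrope (μ : ℝ) (s : ℝ) : ℝ := s ^ (1 + 1 / μ)

/-- The cut-off energy `E₀ = (1/M) ∬ (Q'(f) + E) f dv dx`, where `E = ½|v|² + U_f(x)`. -/
noncomputable def cutoffEnergy (Q : ℝ → ℝ) (M : ℝ) (f : R3 × R3 → ℝ) : ℝ :=
  1 / M * ∫ z : R3 × R3,
    (deriv Q (f z) + (1 / 2 * ‖z.2‖ ^ 2 + potential f z.1)) * f z

/-- The function `φ(r) = E₀ - U_f(r)` of the radius, read off along the first coordinate axis. -/
noncomputable def profile (Q : ℝ → ℝ) (M : ℝ) (f : R3 × R3 → ℝ) (r : ℝ) : ℝ :=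
  cutoffEnergy Q M f - potential f (r • EuclideanSpace.single 0 1)

/-- `φ` is an E-solution of the Emden-Fowler equation `r⁻² (r² φ')' = -c (φ)₊^p` on `]0,∞[`:
a solution that is regular at the centre, with `φ(0) > 0` and `φ'(r) → 0` as `r → 0`. -/
structure IsESolution (p c : ℝ) (φ : ℝ → ℝ) : Prop where
  continuousOn : ContinuousOn φ (Ici 0)
  center_pos : 0 < φ 0
  center_deriv : Tendsto (deriv φ) (𝓝[>] 0) (𝓝 0)
  differentiableAt : ∀ r, 0 < r → DifferentiableAt ℝ φ r
  equation : ∀ r, 0 < r →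
    HasDerivAt (fun s => s ^ 2 * deriv φ s) (r ^ 2 * (-c * (max (φ r) 0) ^ p)) r

/-- The change of variables `u(t) = - r φ(r)^p / φ'(r)`, `v(t) = - r φ'(r) / φ(r)`, `t = ln r`. -/
noncomputable def phaseCurve (p : ℝ) (φ : ℝ → ℝ) (t : ℝ) : ℝ × ℝ :=
  (-(Real.exp t * φ (Real.exp t) ^ p / deriv φ (Real.exp t)),
    -(Real.exp t * deriv φ (Real.exp t) / φ (Real.exp t)))

/-- The vector field of the autonomous planar system
`u' = u (3 - p v - c u)`, `v' = v (-1 + c u + v)`. -/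
def phaseField (p c : ℝ) (w : ℝ × ℝ) : ℝ × ℝ :=
  (w.1 * (3 - p * w.2 - c * w.1), w.2 * (-1 + c * w.1 + w.2))

/-- The curve traced out in the `(u,v)`-plane by `φ` over the radii at which `φ > 0`. -/
def phaseOrbit (p : ℝ) (φ : ℝ → ℝ) : Set (ℝ × ℝ) :=
  phaseCurve p φ '' {t | 0 < φ (Real.exp t)}

/-- `φ₁` arises from `φ₂` by the scaling `φ₁(r) = γ^{2/(p-1)} φ₂(γ r)`, `r > 0`. -/
def ScaledBy (p γ : ℝ) (φ₁ φ₂ : ℝ → ℝ) : Prop :=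
  ∀ r, 0 < r → φ₁ r = γ ^ (2 / (p - 1)) * φ₂ (γ * r)

/-! Write p = μ + 3/2. For (i), integrating the equation from the centre gives r²φ' = -m(r), with m
the `emdenMass`. In this form φ is determined by φ(0) (`emden_unique`). The scaling φ ↦ γ^{2/(p-1)}
φ(γ·) preserves the equation, reaches every central value, and is a time shift of the autonomous
planar system.

For (ii), minimality and uniqueness both come from a calibration; no minimizing sequences are
needed. Since p < 3, solutions reach zero and scaling changes their mass with a nonzero exponent, so
there is a profile φ with first zero R and mass M (`exists_isStellarProfile`). Let σ invert its mass
function.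

Let f be a competitor with enclosed mass m(r). Young's inequality for Q with multiplier l - v²/2,
integrated over v, bounds its Casimir and kinetic energy at radius r below by l m' - 4πr² C
(l₊)^{p+1}. Take l = ∂W/∂m for W(m,r) = ∫₀^m A + (1/r) ∫₀^m B. Then l m' = d/dr W(m(r),r) + r⁻² ∫₀^m
B. The slope B is chosen so that ∫₀^m B = N(m) + m²/2 (`integral_calibB`), and m²/(2r²) is exactly
the gravitational energy density. Hence `functionalD` equals the boundary terms of W plus two
deficits: the Young deficit and the integral of N(m)/r² - 4πr² C (l₊)^{p+1} (`shell_identity`,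
`tendsto_deficit`).

The slope A makes l = φ(σ)(1 + q(σ/r - 1)) with q = 4/(p+1), while N(m)/r² = 4πr² C
(φ(σ)(σ/r)^q)^{p+1}. Bernoulli's inequality with q > 1, that is μ < 3/2, shows that the second
deficit is nonnegative. The boundary terms reduce to ∫₀^M A, which does not depend on f.

Both deficits vanish for the polytrope built from φ, so it is a minimizer. Conversely, vanishing
deficits force σ(m(r)) = r wherever 0 < m < M, hence m is the mass function of φ, and equality in
Young's inequality then determines f almost everywhere. The potential, the cut-off energy and the
scaling statements are read off from this one explicit density. -/

/-! ### The Emden-Fowler equation -/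

/-- The integral `∫₀^r c s² (φ₊)^p ds`. -/
noncomputable def emdenMass (p c : ℝ) (φ : ℝ → ℝ) (r : ℝ) : ℝ :=
  ∫ s in (0 : ℝ)..r, s ^ 2 * (c * (max (φ s) 0) ^ p)

lemma continuous_max_rpow {p : ℝ} (hp : 0 ≤ p) : Continuous fun x : ℝ => (max x 0) ^ p :=
  (continuous_id.max continuous_const).rpow_const fun _ => Or.inr hp

/-- Mean value inequality for x^p on [0, K₊], composed with the 1-Lipschitz positive part. For p ≥ 1
the derivative increases, so its value at K₊ bounds it. -/
lemma abs_max_rpow_sub_le {p K : ℝ} (hp : 1 ≤ p) {x y : ℝ} (hx : x ≤ K) (hy : y ≤ K) :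
    |(max x 0) ^ p - (max y 0) ^ p| ≤ p * (max K 0) ^ (p - 1) * |x - y| := by
  have hp0 : 0 ≤ p := by linarith
  have h := Convex.norm_image_sub_le_of_norm_hasDerivWithin_le (f := fun x : ℝ => x ^ p)
    (f' := fun x : ℝ => p * x ^ (p - 1)) (s := Icc 0 (max K 0)) (C := p * (max K 0) ^ (p - 1))
    (x := max y 0) (y := max x 0)
    (fun z _ => (Real.hasDerivAt_rpow_const (Or.inr hp)).hasDerivWithinAt)
    (fun z hz => by
      rw [Real.norm_eq_abs, abs_of_nonneg (mul_nonneg hp0 (Real.rpow_nonneg hz.1 _))]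
      exact mul_le_mul_of_nonneg_left (Real.rpow_le_rpow hz.1 hz.2 (by linarith)) hp0)
    (convex_Icc _ _) ⟨le_max_right _ _, max_le_max_right 0 hy⟩
    ⟨le_max_right _ _, max_le_max_right 0 hx⟩
  refine h.trans (mul_le_mul_of_nonneg_left ?_
    (mul_nonneg hp0 (Real.rpow_nonneg (le_max_right _ _) _)))
  exact abs_max_sub_max_le_abs x y 0

lemma continuousOn_emdenIntegrand {p c : ℝ} (hp : 0 ≤ p) {φ : ℝ → ℝ} {s : Set ℝ}
    (hφ : ContinuousOn φ s) : ContinuousOn (fun s => s ^ 2 * (c * (max (φ s) 0) ^ p)) s :=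
  (continuousOn_id.pow 2).mul
    (continuousOn_const.mul ((continuous_max_rpow hp).comp_continuousOn hφ))

lemma intervalIntegrable_emdenIntegrand {p c : ℝ} (hp : 0 ≤ p) {φ : ℝ → ℝ}
    (hφ : ContinuousOn φ (Ici 0)) {a b : ℝ} (ha : 0 ≤ a) (hb : 0 ≤ b) :
    IntervalIntegrable (fun s => s ^ 2 * (c * (max (φ s) 0) ^ p)) volume a b :=
  ((continuousOn_emdenIntegrand hp hφ).mono
    fun _ hx => le_trans (le_min ha hb) hx.1).intervalIntegrable

lemma hasDerivAt_emdenMass {p c : ℝ} (hp : 0 ≤ p) {φ : ℝ → ℝ}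
    (hφ : ContinuousOn φ (Ici 0)) {r : ℝ} (hr : 0 < r) :
    HasDerivAt (emdenMass p c φ) (r ^ 2 * (c * (max (φ r) 0) ^ p)) r := by
  have hc := continuousOn_emdenIntegrand (c := c) hp hφ
  refine intervalIntegral.integral_hasDerivAt_right
    (intervalIntegrable_emdenIntegrand hp hφ le_rfl hr.le) ?_
    (hc.continuousAt (Ici_mem_nhds hr))
  exact (hc.mono Ioi_subset_Ici_self).stronglyMeasurableAtFilter isOpen_Ioi r hr

lemma emdenMass_pos {p c : ℝ} (hp : 0 ≤ p) (hc : 0 < c) {φ : ℝ → ℝ}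
    (hφ : ContinuousOn φ (Ici 0)) (h0 : 0 < φ 0) {r : ℝ} (hr : 0 < r) :
    0 < emdenMass p c φ r := by
  have hev : ∀ᶠ s in 𝓝[>] (0 : ℝ), 0 < φ s :=
    ((hφ 0 self_mem_Ici).mono Ioi_subset_Ici_self).eventually (lt_mem_nhds h0)
  obtain ⟨s, hs, hsr⟩ := (hev.and (Ioc_mem_nhdsGT hr)).exists
  refine intervalIntegral.integral_pos hr
    ((continuousOn_emdenIntegrand hp hφ).mono fun x hx => hx.1) (fun x _ => ?_)
    ⟨s, ⟨hsr.1.le, hsr.2⟩, ?_⟩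
  · exact mul_nonneg (sq_nonneg _)
      (mul_nonneg hc.le (Real.rpow_nonneg (le_max_right _ _) _))
  · exact mul_pos (pow_pos hsr.1 2)
      (mul_pos hc (Real.rpow_pos_of_pos (lt_max_of_lt_left hs) _))

/-- Integrate the equation from 0; regularity at the centre makes the boundary term r²φ' vanish
there. This first-order nonlocal form is the one used from here on. -/
lemma IsESolution.hasDerivAt {p c : ℝ} (hp : 0 ≤ p) {φ : ℝ → ℝ} (h : IsESolution p c φ)
    {r : ℝ} (hr : 0 < r) : HasDerivAt φ (-(emdenMass p c φ r / r ^ 2)) r := by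
  have key : ∫ s in (0 : ℝ)..r, s ^ 2 * (-c * (max (φ s) 0) ^ p) = r ^ 2 * deriv φ r - 0 := by
    refine intervalIntegral.integral_eq_sub_of_hasDerivAt_of_tendsto hr
      (f := fun s => s ^ 2 * deriv φ s) (fun x hx => h.equation x hx.1)
      (intervalIntegrable_emdenIntegrand hp h.continuousOn le_rfl hr.le) ?_
      ((h.equation r hr).continuousAt.tendsto.mono_left nhdsWithin_le_nhds)
    have h1 : Tendsto (fun s : ℝ => s ^ 2) (𝓝[>] 0) (𝓝 0) := by
      have : Tendsto (fun s : ℝ => s ^ 2) (𝓝 0) (𝓝 (0 ^ 2)) := (continuous_pow 2).tendsto 0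
      simpa using this.mono_left nhdsWithin_le_nhds
    simpa using h1.mul h.center_deriv
  have h2 : emdenMass p c φ r = -(r ^ 2 * deriv φ r) := by
    rw [sub_zero] at key
    rw [← key, emdenMass, ← intervalIntegral.integral_neg]
    congr 1; ext s; ring
  have h3 : -(emdenMass p c φ r / r ^ 2) = deriv φ r := by
    rw [h2]; field_simp
  rw [h3]
  exact (h.differentiableAt r hr).hasDerivAt

lemma IsESolution.deriv_neg {p c : ℝ} (hp : 0 ≤ p) (hc : 0 < c) {φ : ℝ → ℝ}
    (h : IsESolution p c φ) {r : ℝ} (hr : 0 < r) : deriv φ r < 0 := by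
  rw [(h.hasDerivAt hp hr).deriv]
  have := emdenMass_pos hp hc h.continuousOn h.center_pos hr
  exact neg_neg_of_pos (by positivity)

lemma isESolution_of_hasDerivAt {p c : ℝ} (hp : 0 ≤ p) {φ : ℝ → ℝ}
    (hφ : ContinuousOn φ (Ici 0)) (h0 : 0 < φ 0)
    (h : ∀ r, 0 < r → HasDerivAt φ (-(emdenMass p c φ r / r ^ 2)) r) : IsESolution p c φ where
  continuousOn := hφ
  center_pos := h0
  differentiableAt r hr := (h r hr).differentiableAt
  equation r hr := by
    have h1 := (hasDerivAt_emdenMass (c := c) hp hφ hr).neg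
    have h2 : (fun s => s ^ 2 * deriv φ s) =ᶠ[𝓝 r] fun s => -emdenMass p c φ s := by
      filter_upwards [Ioi_mem_nhds hr] with s hs
      have hs0 : s ≠ 0 := ne_of_gt hs
      rw [(h s hs).deriv]; field_simp
    refine (h1.congr_of_eventuallyEq h2).congr_deriv ?_
    ring
  center_deriv := by
    obtain ⟨K, hK⟩ := isCompact_Icc.exists_bound_of_continuousOn
      (f := fun s => c * (max (φ s) 0) ^ p) (s := Icc (0 : ℝ) 1)
      (continuousOn_const.mul ((continuous_max_rpow hp).comp_continuousOn
        (hφ.mono fun x hx => hx.1)))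
    -- On [0,r] with r ≤ 1 the integrand is at most r²K, so the mass is at most K r³ and |φ'(r)| ≤ K
    -- r.
    have hK0 : 0 ≤ K := (norm_nonneg _).trans (hK 0 (by simp))
    refine squeeze_zero_norm' (a := fun r => K * r) ?_ ?_
    · filter_upwards [Ioc_mem_nhdsGT (zero_lt_one' ℝ)] with r hr
      have hr0 : 0 < r := hr.1
      rw [(h r hr.1).deriv, norm_neg, norm_div, norm_pow, Real.norm_of_nonneg hr.1.le,
        div_le_iff₀ (by positivity)]
      have := intervalIntegral.norm_integral_le_of_norm_le_const (a := 0) (b := r)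
        (C := r ^ 2 * K) (f := fun s => s ^ 2 * (c * (max (φ s) 0) ^ p)) (fun x hx => by
          rw [uIoc_of_le hr.1.le] at hx
          rw [norm_mul, norm_pow, Real.norm_of_nonneg hx.1.le]
          exact mul_le_mul (pow_le_pow_left₀ hx.1.le hx.2 2)
            (hK x ⟨hx.1.le, hx.2.trans hr.2⟩) (norm_nonneg _) (by positivity))
      rw [sub_zero, abs_of_pos hr0] at this
      exact this.trans (le_of_eq (by ring))
    · have : Tendsto (fun r : ℝ => K * r) (𝓝 0) (𝓝 (K * 0)) :=
        (continuous_const.mul continuous_id).tendsto 0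
      simpa using this.mono_left nhdsWithin_le_nhds

/-- Solutions of the integrated equation are determined by their central value. -/
lemma emden_unique {p c : ℝ} (hp : 1 ≤ p) (hc : 0 < c) {φ ψ : ℝ → ℝ}
    (hφ : ContinuousOn φ (Ici 0)) (hψ : ContinuousOn ψ (Ici 0)) (h0 : φ 0 = ψ 0)
    (h1 : ∀ r, 0 < r → HasDerivAt φ (-(emdenMass p c φ r / r ^ 2)) r)
    (h2 : ∀ r, 0 < r → HasDerivAt ψ (-(emdenMass p c ψ r / r ^ 2)) r) :
    ∀ r, 0 ≤ r → φ r = ψ r := by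
  intro R hR
  have hp0 : 0 ≤ p := by linarith
  have hcφ : ContinuousOn φ (Icc 0 R) := hφ.mono fun x hx => hx.1
  have hcψ : ContinuousOn ψ (Icc 0 R) := hψ.mono fun x hx => hx.1
  obtain ⟨K₁, hK₁⟩ := isCompact_Icc.exists_bound_of_continuousOn hcφ
  obtain ⟨K₂, hK₂⟩ := isCompact_Icc.exists_bound_of_continuousOn hcψ
  set L : ℝ := c * (p * (max (max K₁ K₂) 0) ^ (p - 1)) with hL
  have hL0 : 0 ≤ L := mul_nonneg hc.le (mul_nonneg hp0 (Real.rpow_nonneg (le_max_right _ _) _))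
  have hLip : ∀ s ∈ Icc 0 R, |c * (max (φ s) 0) ^ p - c * (max (ψ s) 0) ^ p|
      ≤ L * |φ s - ψ s| := by
    intro s hs
    rw [← mul_sub, abs_mul, abs_of_pos hc, hL, mul_assoc c]
    refine mul_le_mul_of_nonneg_left (abs_max_rpow_sub_le hp ?_ ?_) hc.le
    · exact (le_abs_self _).trans ((hK₁ s hs).trans (le_max_left _ _))
    · exact (le_abs_self _).trans ((hK₂ s hs).trans (le_max_right _ _))
  -- The differences are measured with the weight exp(-k s²). The factor s in the bound on the
  -- derivative integrates exp(k s²) exactly and produces L/(2k) < 1, which forces the weighted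
  -- supremum to vanish.
  set k : ℝ := L + 1 with hk
  have hk0 : 0 < k := by linarith
  -- the weighted supremum of the difference
  obtain ⟨r₀, hr₀, hmax⟩ := isCompact_Icc.exists_isMaxOn (nonempty_Icc.2 hR)
    (f := fun s => |φ s - ψ s| * Real.exp (-(k * s ^ 2)))
    ((hcφ.sub hcψ).abs.mul (Continuous.continuousOn (by fun_prop)))
  set D : ℝ := |φ r₀ - ψ r₀| * Real.exp (-(k * r₀ ^ 2)) with hD
  have hD0 : 0 ≤ D := by positivity
  have hbd : ∀ s ∈ Icc 0 R, |φ s - ψ s| ≤ D * Real.exp (k * s ^ 2) := by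
    intro s hs
    have h : |φ s - ψ s| * Real.exp (-(k * s ^ 2)) ≤ D := hmax hs
    rwa [Real.exp_neg, ← div_eq_mul_inv, div_le_iff₀ (Real.exp_pos _)] at h
  have hmass : ∀ r ∈ Ioc 0 R, |emdenMass p c φ r - emdenMass p c ψ r| / r ^ 2
      ≤ L * D * r * Real.exp (k * r ^ 2) := by
    intro r hr
    have hr0 : 0 < r := hr.1
    rw [div_le_iff₀ (by positivity), emdenMass, emdenMass, ← intervalIntegral.integral_sub
      (intervalIntegrable_emdenIntegrand hp0 hφ le_rfl hr.1.le)
      (intervalIntegrable_emdenIntegrand hp0 hψ le_rfl hr.1.le)]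
    have := intervalIntegral.norm_integral_le_of_norm_le_const (a := 0) (b := r)
      (C := r ^ 2 * (L * (D * Real.exp (k * r ^ 2))))
      (f := fun s => s ^ 2 * (c * (max (φ s) 0) ^ p) - s ^ 2 * (c * (max (ψ s) 0) ^ p))
      (fun x hx => by
        rw [uIoc_of_le hr.1.le] at hx
        have hxR : x ∈ Icc 0 R := ⟨hx.1.le, hx.2.trans hr.2⟩
        rw [← mul_sub, norm_mul, norm_pow, Real.norm_of_nonneg hx.1.le]
        refine mul_le_mul (pow_le_pow_left₀ hx.1.le hx.2 2) ((hLip x hxR).trans ?_)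
          (norm_nonneg _) (by positivity)
        refine mul_le_mul_of_nonneg_left ((hbd x hxR).trans ?_) hL0
        refine mul_le_mul_of_nonneg_left (Real.exp_le_exp.2 ?_) hD0
        exact mul_le_mul_of_nonneg_left (pow_le_pow_left₀ hx.1.le hx.2 2) hk0.le)
    rw [sub_zero, abs_of_pos hr0] at this
    exact this.trans (le_of_eq (by ring))
  have hexp : ∀ r : ℝ, HasDerivAt (fun r => L * D / (2 * k) * Real.exp (k * r ^ 2))
      (L * D * r * Real.exp (k * r ^ 2)) r := by
    intro r
    have := (((hasDerivAt_pow 2 r).const_mul k).exp).const_mul (L * D / (2 * k))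
    refine this.congr_deriv ?_
    field_simp
    norm_num
  -- The signs ε = ±1 give the two one-sided bounds on φ - ψ, starting from equality at 0.
  have hmono : ∀ (ε : ℝ), |ε| = 1 → MonotoneOn
      (fun r => L * D / (2 * k) * Real.exp (k * r ^ 2) - ε * (φ r - ψ r)) (Icc 0 R) := by
    intro ε hε
    have hder : ∀ x ∈ Ioo 0 R, HasDerivAt
        (fun r => L * D / (2 * k) * Real.exp (k * r ^ 2) - ε * (φ r - ψ r))
        (L * D * x * Real.exp (k * x ^ 2) - ε * (-(emdenMass p c φ x / x ^ 2)
          - -(emdenMass p c ψ x / x ^ 2))) x := fun x hx =>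
      (hexp x).sub (((h1 x hx.1).sub (h2 x hx.1)).const_mul ε)
    refine monotoneOn_of_deriv_nonneg (convex_Icc _ _) ?_ ?_ ?_
    · exact (Continuous.continuousOn (by fun_prop)).sub (continuousOn_const.mul (hcφ.sub hcψ))
    · rw [interior_Icc]
      exact fun x hx => (hder x hx).differentiableAt.differentiableWithinAt
    · rw [interior_Icc]
      intro x hx
      rw [(hder x hx).deriv, sub_nonneg]
      refine (le_abs_self _).trans ?_
      rw [abs_mul, hε, one_mul]
      refine le_trans (le_of_eq ?_) (hmass x ⟨hx.1, hx.2.le⟩)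
      rw [← abs_neg, show -(-(emdenMass p c φ x / x ^ 2) - -(emdenMass p c ψ x / x ^ 2))
        = (emdenMass p c φ x - emdenMass p c ψ x) / x ^ 2 by ring, abs_div,
        abs_of_nonneg (sq_nonneg x)]
  have hfin : |φ r₀ - ψ r₀| ≤ L * D / (2 * k) * Real.exp (k * r₀ ^ 2) := by
    have e1 := hmono 1 (by simp) ⟨le_rfl, hR⟩ hr₀ hr₀.1
    have e2 := hmono (-1) (by simp) ⟨le_rfl, hR⟩ hr₀ hr₀.1
    simp only [h0, sub_self, mul_zero, sub_zero] at e1 e2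
    have e3 : 0 ≤ L * D / (2 * k) * Real.exp (k * 0 ^ 2) := by positivity
    rw [abs_le]; constructor <;> linarith
  have hD2 : D ≤ L * D / (2 * k) := by
    have h : D = |φ r₀ - ψ r₀| / Real.exp (k * r₀ ^ 2) := by
      rw [hD, Real.exp_neg, div_eq_mul_inv]
    rw [← div_le_iff₀ (Real.exp_pos _), ← h] at hfin
    exact hfin
  have hD3 : D = 0 := by
    rw [le_div_iff₀ (by positivity)] at hD2
    nlinarith
  have := hbd R ⟨hR, le_rfl⟩
  rw [hD3, zero_mul] at this
  exact sub_eq_zero.1 (abs_eq_zero.1 (le_antisymm this (abs_nonneg _)))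

/-! ### Phase plane and scaling -/

lemma IsESolution.hasDerivAt_deriv {p c : ℝ} {φ : ℝ → ℝ} (h : IsESolution p c φ)
    {r : ℝ} (hr : 0 < r) :
    HasDerivAt (deriv φ) (-c * (max (φ r) 0) ^ p - 2 * deriv φ r / r) r := by
  have h1 := (h.equation r hr).div (hasDerivAt_pow 2 r) (by positivity)
  have h2 : deriv φ =ᶠ[𝓝 r] fun s => s ^ 2 * deriv φ s / s ^ 2 := by
    filter_upwards [Ioi_mem_nhds hr] with s hs
    have hs0 : s ≠ 0 := ne_of_gt hs
    field_simp
  refine (h1.congr_of_eventuallyEq h2).congr_deriv ?_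
  norm_num
  field_simp

lemma IsESolution.hasDerivAt_phaseCurve {p c : ℝ} (hp : 0 ≤ p) (hc : 0 < c) {φ : ℝ → ℝ}
    (h : IsESolution p c φ) {t : ℝ} (ht : 0 < φ (Real.exp t)) :
    HasDerivAt (phaseCurve p φ) (phaseField p c (phaseCurve p φ t)) t := by
  have hr : 0 < Real.exp t := Real.exp_pos t
  have hd : deriv φ (Real.exp t) ≠ 0 := (h.deriv_neg hp hc hr).ne
  have h0 := (h.differentiableAt _ hr).hasDerivAt
  have h1 := h.hasDerivAt_deriv hr
  have he := Real.hasDerivAt_exp t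
  have hφ := h0.comp t he
  have hφp := hφ.rpow_const (p := p) (Or.inl ht.ne')
  have hdφ := h1.comp t he
  have hu := ((he.mul hφp).div hdφ hd).neg
  have hv := ((he.mul hdφ).div hφ ht.ne').neg
  refine (hu.prodMk hv).congr_deriv ?_
  have e1 : φ (Real.exp t) ^ (p - 1) = φ (Real.exp t) ^ p / φ (Real.exp t) := by
    rw [Real.rpow_sub ht, Real.rpow_one]
  simp only [phaseField, phaseCurve, Function.comp, Pi.mul_apply, max_eq_left ht.le, e1]
  -- With φ^{p-1} written as φ^p/φ, the claim is a rational identity in r, φ, φ^p and φ'.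
  generalize deriv φ (Real.exp t) = d at *
  have hF := ht.ne'
  generalize φ (Real.exp t) ^ p = P at *
  generalize φ (Real.exp t) = F at *
  have hr' := hr.ne'
  generalize Real.exp t = r at *
  refine Prod.ext ?_ ?_
  · simp only
    field_simp
    ring
  · simp only
    field_simp
    ring

/-- The exponent a = 2/(p-1) is the solution of a p = a + 2: the nonlinearity then scales like a
second derivative. -/
lemma rpow_scaling_exponent {p γ : ℝ} (hp : 1 < p) (hγ : 0 < γ) :
    (γ ^ (2 / (p - 1))) ^ p = γ ^ 2 * γ ^ (2 / (p - 1)) := by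
  have : p - 1 ≠ 0 := by linarith
  rw [← Real.rpow_mul hγ.le, ← Real.rpow_natCast γ 2, ← Real.rpow_add hγ]
  congr 1
  push_cast
  field_simp
  ring

lemma emdenMass_scaling {p c γ : ℝ} (hp : 1 < p) (hγ : 0 < γ) (φ : ℝ → ℝ) (r : ℝ) :
    emdenMass p c (fun s => γ ^ (2 / (p - 1)) * φ (γ * s)) r
      = γ ^ (2 / (p - 1)) / γ * emdenMass p c φ (γ * r) := by
  have ha : 0 < γ ^ (2 / (p - 1)) := Real.rpow_pos_of_pos hγ _
  have h1 : ∀ s, s ^ 2 * (c * (max (γ ^ (2 / (p - 1)) * φ (γ * s)) 0) ^ p)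
      = γ ^ (2 / (p - 1)) * ((γ * s) ^ 2 * (c * (max (φ (γ * s)) 0) ^ p)) := by
    intro s
    rw [show max (γ ^ (2 / (p - 1)) * φ (γ * s)) 0 = γ ^ (2 / (p - 1)) * max (φ (γ * s)) 0 by
      rw [mul_max_of_nonneg _ _ ha.le, mul_zero],
      Real.mul_rpow ha.le (le_max_right _ _), rpow_scaling_exponent hp hγ]
    ring
  simp only [emdenMass, h1, intervalIntegral.integral_const_mul]
  rw [intervalIntegral.integral_comp_mul_left (fun s => s ^ 2 * (c * (max (φ s) 0) ^ p)) hγ.ne',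
    mul_zero, smul_eq_mul]
  ring

lemma hasDerivAt_scaling {p c γ : ℝ} (hp : 1 < p) (hγ : 0 < γ) {φ : ℝ → ℝ}
    (h : ∀ r, 0 < r → HasDerivAt φ (-(emdenMass p c φ r / r ^ 2)) r) {r : ℝ} (hr : 0 < r) :
    HasDerivAt (fun s => γ ^ (2 / (p - 1)) * φ (γ * s))
      (-(emdenMass p c (fun s => γ ^ (2 / (p - 1)) * φ (γ * s)) r / r ^ 2)) r := by
  have h1 := ((h (γ * r) (mul_pos hγ hr)).comp r ((hasDerivAt_id r).const_mul γ)).const_mul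
    (γ ^ (2 / (p - 1)))
  refine h1.congr_deriv ?_
  rw [emdenMass_scaling hp hγ]
  field_simp

lemma continuousOn_scaling {a γ : ℝ} (hγ : 0 < γ) {φ : ℝ → ℝ} (h : ContinuousOn φ (Ici 0)) :
    ContinuousOn (fun s => a * φ (γ * s)) (Ici 0) :=
  continuousOn_const.mul (h.comp (continuous_const.mul continuous_id).continuousOn
    fun _ hx => mul_nonneg hγ.le hx)

/-- Any two E-solutions differ by a scaling. -/
lemma IsESolution.exists_scaledBy {p c : ℝ} (hp : 1 < p) (hc : 0 < c) {φ₁ φ₂ : ℝ → ℝ}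
    (h₁ : IsESolution p c φ₁) (h₂ : IsESolution p c φ₂) :
    ∃ γ : ℝ, 0 < γ ∧ ScaledBy p γ φ₁ φ₂ := by
  have hp0 : 0 ≤ p := by linarith
  have hq : 0 < φ₁ 0 / φ₂ 0 := div_pos h₁.center_pos h₂.center_pos
  have hp1 : p - 1 ≠ 0 := by linarith
  -- This γ matches the central values, γ^{2/(p-1)} φ₂(0) = φ₁(0); uniqueness then does the rest.
  refine ⟨(φ₁ 0 / φ₂ 0) ^ ((p - 1) / 2), Real.rpow_pos_of_pos hq _, fun r hr => ?_⟩
  have hγ := Real.rpow_pos_of_pos hq ((p - 1) / 2)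
  have ha : ((φ₁ 0 / φ₂ 0) ^ ((p - 1) / 2)) ^ (2 / (p - 1)) = φ₁ 0 / φ₂ 0 := by
    rw [← Real.rpow_mul hq.le, show (p - 1) / 2 * (2 / (p - 1)) = 1 by field_simp, Real.rpow_one]
  refine emden_unique hp.le hc h₁.continuousOn (continuousOn_scaling hγ h₂.continuousOn)
    ?_ (fun r hr => h₁.hasDerivAt hp0 hr)
    (fun r hr => hasDerivAt_scaling hp hγ (fun r hr => h₂.hasDerivAt hp0 hr) hr) r hr.le
  have := h₂.center_pos.ne'
  rw [ha, mul_zero]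
  field_simp

/-- The coordinates u and v are invariant under the scaling, which acts on t = ln r only as
translation by ln γ. The sign condition on φ₂ permits splitting the real power of the product. -/
lemma ScaledBy.phaseCurve_eq {p γ : ℝ} (hp : 1 < p) (hγ : 0 < γ) {φ₁ φ₂ : ℝ → ℝ}
    (h : ScaledBy p γ φ₁ φ₂) {t : ℝ} (ht : 0 ≤ φ₂ (Real.exp (t + Real.log γ))) :
    phaseCurve p φ₁ t = phaseCurve p φ₂ (t + Real.log γ) := by
  have ha : 0 < γ ^ (2 / (p - 1)) := Real.rpow_pos_of_pos hγ _
  have he : Real.exp (t + Real.log γ) = γ * Real.exp t := by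
    rw [Real.exp_add, Real.exp_log hγ, mul_comm]
  have hd : deriv φ₁ (Real.exp t) = γ ^ (2 / (p - 1)) * (γ * deriv φ₂ (γ * Real.exp t)) := by
    have : φ₁ =ᶠ[𝓝 (Real.exp t)] fun s => γ ^ (2 / (p - 1)) * φ₂ (γ * s) := by
      filter_upwards [Ioi_mem_nhds (Real.exp_pos t)] with s hs using h s hs
    rw [this.deriv_eq, deriv_const_mul_field]
    congr 1
    rw [deriv_comp_mul_left]
    simp
  rw [he] at ht
  simp only [phaseCurve, he, hd, h _ (Real.exp_pos t)]
  rw [Real.mul_rpow ha.le ht, rpow_scaling_exponent hp hγ]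
  generalize φ₂ (γ * Real.exp t) ^ p = P
  generalize φ₂ (γ * Real.exp t) = F
  generalize deriv φ₂ (γ * Real.exp t) = d
  refine Prod.ext ?_ ?_
  · simp only
    rw [show Real.exp t * (γ ^ 2 * γ ^ (2 / (p - 1)) * P)
      = (γ ^ (2 / (p - 1)) * γ) * (γ * Real.exp t * P) by ring, ← mul_assoc _ γ d,
      mul_div_mul_left _ _ (by positivity)]
  · simp only
    rw [show Real.exp t * (γ ^ (2 / (p - 1)) * (γ * d))
      = γ ^ (2 / (p - 1)) * (γ * Real.exp t * d) by ring, mul_div_mul_left _ _ ha.ne']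

lemma ScaledBy.phaseOrbit_eq {p γ : ℝ} (hp : 1 < p) (hγ : 0 < γ) {φ₁ φ₂ : ℝ → ℝ}
    (h : ScaledBy p γ φ₁ φ₂) : phaseOrbit p φ₁ = phaseOrbit p φ₂ := by
  have ha : 0 < γ ^ (2 / (p - 1)) := Real.rpow_pos_of_pos hγ _
  have he : ∀ t, Real.exp (t + Real.log γ) = γ * Real.exp t := fun t => by
    rw [Real.exp_add, Real.exp_log hγ, mul_comm]
  have hiff : ∀ t, 0 < φ₁ (Real.exp t) ↔ 0 < φ₂ (Real.exp (t + Real.log γ)) := fun t => by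
    rw [h _ (Real.exp_pos t), he, mul_pos_iff_of_pos_left ha]
  ext w
  constructor
  · rintro ⟨t, ht, rfl⟩
    have ht' := (hiff t).1 ht
    exact ⟨t + Real.log γ, ht', (h.phaseCurve_eq hp hγ ht'.le).symm⟩
  · rintro ⟨t, ht, rfl⟩
    have ht' : 0 < φ₂ (Real.exp (t - Real.log γ + Real.log γ)) := by simpa using ht
    refine ⟨t - Real.log γ, (hiff _).2 ht', ?_⟩
    rw [h.phaseCurve_eq hp hγ ht'.le, sub_add_cancel]

/-! ### Existence of profiles of prescribed mass -/

open BoundedContinuousFunction in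
/-- A bounded Lipschitz nonlinearity: the integrated radial equation has a global solution. -/
lemma exists_radial_integral_solution {F : ℝ → ℝ} {L c : ℝ} (hL : 0 ≤ L)
    (hLip : ∀ x y, |F x - F y| ≤ L * |x - y|) (hF : ∀ x, |F x| ≤ c) :
    ∃ φ : ℝ → ℝ, Continuous φ ∧
      ∀ r, φ r = 1 - r ^ 2 * ∫ t in (0 : ℝ)..1, t * (1 - t) * F (φ (r * t)) := by
  have hFc : Continuous F :=
    (LipschitzWith.of_dist_le_mul (K := ⟨L, hL⟩) fun x y => hLip x y).continuous
  have hc0 : 0 ≤ c := (abs_nonneg _).trans (hF 0)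
  -- The fixed point is sought for ψ = exp(-k r²) φ. Boundedness of F keeps the image bounded, and k
  -- > L makes the map a contraction with factor 1/2 on all of ℝ at once. The substitution s = rt
  -- removes the singularity at r = 0.
  set k : ℝ := L + 1 with hk
  have hk0 : 0 < k := by linarith
  let I : (ℝ →ᵇ ℝ) → ℝ → ℝ := fun ψ r =>
    ∫ t in (0 : ℝ)..1, t * (1 - t) * F (Real.exp (k * (r * t) ^ 2) * ψ (r * t))
  have hIc : ∀ ψ, Continuous (I ψ) := fun ψ =>
    intervalIntegral.continuous_parametric_intervalIntegral_of_continuous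
      (f := fun r t => t * (1 - t) * F (Real.exp (k * (r * t) ^ 2) * ψ (r * t)))
      (by have := ψ.continuous; unfold Function.uncurry; fun_prop) continuous_const
  have hIb : ∀ ψ r, |I ψ r| ≤ c := fun ψ r => by
    have := intervalIntegral.norm_integral_le_of_norm_le_const (a := 0) (b := 1) (C := c)
      (f := fun t => t * (1 - t) * F (Real.exp (k * (r * t) ^ 2) * ψ (r * t))) (fun t ht => by
        rw [uIoc_of_le zero_le_one] at ht
        rw [norm_mul, Real.norm_eq_abs, Real.norm_eq_abs]
        have h1 : |t * (1 - t)| ≤ 1 := by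
          rw [abs_le]; constructor <;> nlinarith [ht.1, ht.2]
        calc _ ≤ 1 * c := mul_le_mul h1 (hF _) (abs_nonneg _) zero_le_one
          _ = c := one_mul c)
    simpa using this
  let T : (ℝ →ᵇ ℝ) → (ℝ →ᵇ ℝ) := fun ψ =>
    BoundedContinuousFunction.ofNormedAddCommGroup
      (fun r => Real.exp (-(k * r ^ 2)) * (1 - r ^ 2 * I ψ r))
      (by have := hIc ψ; fun_prop) (1 + c / k) (fun r => by
        have e1 : Real.exp (-(k * r ^ 2)) ≤ 1 := Real.exp_le_one_iff.2 (by
          have := mul_nonneg hk0.le (sq_nonneg r); linarith)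
        have e2 : k * r ^ 2 * Real.exp (-(k * r ^ 2)) ≤ 1 := by
          rw [Real.exp_neg, ← div_eq_mul_inv, div_le_one (Real.exp_pos _)]
          linarith [Real.add_one_le_exp (k * r ^ 2)]
        have e3 : |1 - r ^ 2 * I ψ r| ≤ 1 + r ^ 2 * c := by
          calc _ ≤ |1| + |r ^ 2 * I ψ r| := abs_sub _ _
            _ ≤ _ := by
              rw [abs_one, abs_mul, abs_of_nonneg (sq_nonneg r)]
              gcongr
              exact hIb ψ r
        rw [norm_mul, Real.norm_of_nonneg (Real.exp_pos _).le, Real.norm_eq_abs]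
        calc _ ≤ Real.exp (-(k * r ^ 2)) * (1 + r ^ 2 * c) := by gcongr
          _ = Real.exp (-(k * r ^ 2)) + (k * r ^ 2 * Real.exp (-(k * r ^ 2))) * (c / k) := by
            field_simp
          _ ≤ 1 + 1 * (c / k) := by gcongr
          _ = _ := by ring)
  have hT : ContractingWith (1 / 2) T := by
    refine ⟨by rw [← NNReal.coe_lt_coe]; norm_num, LipschitzWith.of_dist_le_mul fun ψ₁ ψ₂ => ?_⟩
    rw [BoundedContinuousFunction.dist_le (by positivity)]
    intro r
    set D := dist ψ₁ ψ₂
    have hD0 : 0 ≤ D := dist_nonneg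
    have hTr : T ψ₁ r - T ψ₂ r = Real.exp (-(k * r ^ 2)) * (r ^ 2 * (I ψ₂ r - I ψ₁ r)) := by
      simp only [T, BoundedContinuousFunction.coe_ofNormedAddCommGroup]; ring
    have hint : ∀ ψ : ℝ →ᵇ ℝ, IntervalIntegrable
        (fun t => t * (1 - t) * F (Real.exp (k * (r * t) ^ 2) * ψ (r * t))) volume 0 1 :=
      fun ψ => Continuous.intervalIntegrable (by have := ψ.continuous; fun_prop) _ _
    have hexp : ∫ t in (0 : ℝ)..1, L * D / 2 / k * (2 * k * r ^ 2 * t * Real.exp (k * (r * t) ^ 2))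
        = L * D / 2 / k * (Real.exp (k * r ^ 2) - 1) := by
      rw [intervalIntegral.integral_const_mul]
      congr 1
      have := intervalIntegral.integral_eq_sub_of_hasDerivAt (a := 0) (b := 1)
        (f := fun t => Real.exp (k * (r * t) ^ 2))
        (f' := fun t => 2 * k * r ^ 2 * t * Real.exp (k * (r * t) ^ 2)) (fun t _ => by
          have := (((((hasDerivAt_id t).const_mul r).pow 2).const_mul k).exp)
          refine this.congr_deriv ?_
          simp only [id]
          norm_num
          ring) (Continuous.intervalIntegrable (by fun_prop) _ _)
      rw [this]; simp
    have hdiff : r ^ 2 * |I ψ₂ r - I ψ₁ r| ≤ L * D / 2 / k * (Real.exp (k * r ^ 2) - 1) := by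
      rw [← hexp, ← abs_of_nonneg (sq_nonneg r), ← abs_mul, abs_of_nonneg (sq_nonneg r)]
      simp only [I]
      rw [← intervalIntegral.integral_sub (hint ψ₂) (hint ψ₁),
        ← intervalIntegral.integral_const_mul, ← Real.norm_eq_abs]
      refine intervalIntegral.norm_integral_le_of_norm_le zero_le_one ?_
        (Continuous.intervalIntegrable (by fun_prop) _ _)
      refine Eventually.of_forall fun t ht => ?_
      have ht0 : 0 ≤ t := ht.1.le
      have ht1 : 0 ≤ 1 - t := by linarith [ht.2]
      rw [← mul_sub, norm_mul, norm_mul, norm_mul,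
        Real.norm_of_nonneg (sq_nonneg r), Real.norm_of_nonneg ht0,
        Real.norm_of_nonneg ht1, Real.norm_eq_abs]
      have h1 : |F (Real.exp (k * (r * t) ^ 2) * ψ₂ (r * t))
          - F (Real.exp (k * (r * t) ^ 2) * ψ₁ (r * t))|
          ≤ L * (Real.exp (k * (r * t) ^ 2) * D) := by
        refine (hLip _ _).trans ?_
        rw [← mul_sub, abs_mul, abs_of_pos (Real.exp_pos _)]
        gcongr
        rw [← Real.dist_eq, dist_comm]
        exact BoundedContinuousFunction.dist_coe_le_dist _
      calc r ^ 2 * (t * (1 - t) * _) ≤ r ^ 2 * (t * 1 * (L * (Real.exp (k * (r * t) ^ 2) * D))) := by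
            gcongr
            linarith
        _ = _ := by field_simp
    rw [Real.dist_eq, hTr, abs_mul, abs_mul, abs_of_pos (Real.exp_pos _),
      abs_of_nonneg (sq_nonneg r)]
    have hLk : L / k ≤ 1 := by rw [div_le_one hk0]; linarith
    calc _ ≤ Real.exp (-(k * r ^ 2)) * (L * D / 2 / k * (Real.exp (k * r ^ 2) - 1)) := by gcongr
      _ ≤ Real.exp (-(k * r ^ 2)) * (L * D / 2 / k * Real.exp (k * r ^ 2)) := by
        gcongr; linarith
      _ = L / k * (1 / 2 * D) := by
        rw [Real.exp_neg]; field_simp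
      _ ≤ 1 * (1 / 2 * D) := by gcongr
      _ = _ := by norm_num
  set ψ := ContractingWith.fixedPoint T hT
  have hψ : T ψ = ψ := hT.fixedPoint_isFixedPt
  refine ⟨fun r => Real.exp (k * r ^ 2) * ψ r, by have := ψ.continuous; fun_prop, fun r => ?_⟩
  have : ψ r = Real.exp (-(k * r ^ 2)) * (1 - r ^ 2 * I ψ r) := by
    conv_lhs => rw [← hψ]
    rfl
  simp only
  rw [this, ← mul_assoc, ← Real.exp_add, add_neg_cancel, Real.exp_zero, one_mul]

/-- Undoing s = rt turns the kernel into ∫₀^r s F - r⁻¹ ∫₀^r s² F. On differentiation the two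
boundary contributions cancel, leaving only r⁻² ∫₀^r s² F. -/
lemma hasDerivAt_of_radial_integral {F : ℝ → ℝ} (hF : Continuous F) {φ : ℝ → ℝ}
    (hφ : Continuous φ)
    (h : ∀ r, φ r = 1 - r ^ 2 * ∫ t in (0 : ℝ)..1, t * (1 - t) * F (φ (r * t)))
    {r : ℝ} (hr : 0 < r) :
    HasDerivAt φ (-((∫ s in (0 : ℝ)..r, s ^ 2 * F (φ s)) / r ^ 2)) r := by
  have hc1 : Continuous fun s => s * F (φ s) := by fun_prop
  have hc2 : Continuous fun s => s ^ 2 * F (φ s) := by fun_prop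
  have heq : φ =ᶠ[𝓝 r] fun r => 1 - ((∫ s in (0 : ℝ)..r, s * F (φ s))
      - r⁻¹ * ∫ s in (0 : ℝ)..r, s ^ 2 * F (φ s)) := by
    filter_upwards [Ioi_mem_nhds hr] with x hx
    have hx0 : x ≠ 0 := ne_of_gt hx
    rw [h x]
    congr 1
    rw [← intervalIntegral.integral_const_mul x⁻¹, ← intervalIntegral.integral_sub
      (hc1.intervalIntegrable _ _) ((hc2.intervalIntegrable _ _).const_mul _)]
    have e := intervalIntegral.integral_comp_mul_left (a := 0) (b := 1)
      (fun s => s * F (φ s) - x⁻¹ * (s ^ 2 * F (φ s))) hx0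
    rw [mul_zero, mul_one, smul_eq_mul] at e
    rw [eq_comm, ← mul_right_inj' (inv_ne_zero hx0), ← e, ← intervalIntegral.integral_const_mul,
      ← intervalIntegral.integral_const_mul]
    congr 1; ext t
    field_simp
  have d1 := intervalIntegral.integral_hasDerivAt_right (hc1.intervalIntegrable 0 r)
    (hc1.stronglyMeasurableAtFilter _ _) hc1.continuousAt
  have d2 := intervalIntegral.integral_hasDerivAt_right (hc2.intervalIntegrable 0 r)
    (hc2.stronglyMeasurableAtFilter _ _) hc2.continuousAt
  have := ((d1.sub ((hasDerivAt_inv hr.ne').mul d2)).const_sub 1).congr_of_eventuallyEq heq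
  refine this.congr_deriv ?_
  field_simp
  ring

/-- The Emden-Fowler equation has a global solution with central value `1`. -/
lemma exists_emden_solution {p c : ℝ} (hp : 1 ≤ p) (hc : 0 < c) :
    ∃ φ : ℝ → ℝ, Continuous φ ∧ φ 0 = 1 ∧
      ∀ r, 0 < r → HasDerivAt φ (-(emdenMass p c φ r / r ^ 2)) r := by
  have hp0 : 0 ≤ p := by linarith
  -- Truncation at 1 makes the nonlinearity bounded and globally Lipschitz. The solution never
  -- exceeds its central value 1, so the truncation is inactive.
  set F : ℝ → ℝ := fun x => c * (max (min x 1) 0) ^ p with hFdef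
  have hF0 : ∀ x, 0 ≤ F x := fun x => mul_nonneg hc.le (Real.rpow_nonneg (le_max_right _ _) _)
  have hFc : ∀ x, |F x| ≤ c := fun x => by
    rw [abs_of_nonneg (hF0 x)]
    exact mul_le_of_le_one_right hc.le (Real.rpow_le_one (le_max_right _ _)
      (max_le (min_le_right _ _) zero_le_one) hp0)
  have hLip : ∀ x y, |F x - F y| ≤ c * p * |x - y| := fun x y => by
    have h := abs_max_rpow_sub_le hp (min_le_right x 1) (min_le_right y 1)
    rw [max_eq_left zero_le_one, Real.one_rpow, mul_one] at h
    rw [hFdef, ← mul_sub, abs_mul, abs_of_pos hc, mul_assoc]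
    gcongr
    exact h.trans (mul_le_mul_of_nonneg_left
      ((abs_min_sub_min_le_max x 1 y 1).trans_eq (by simp)) hp0)
  obtain ⟨φ, hφ, h⟩ := exists_radial_integral_solution (by positivity) hLip hFc
  have hle : ∀ r, φ r ≤ 1 := fun r => by
    rw [h r, sub_le_self_iff]
    refine mul_nonneg (sq_nonneg r) (intervalIntegral.integral_nonneg zero_le_one fun t ht => ?_)
    exact mul_nonneg (mul_nonneg ht.1 (by linarith [ht.2])) (hF0 _)
  have hFcont : Continuous F := continuous_const.mul
    ((continuous_max_rpow hp0).comp (continuous_id.min continuous_const))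
  refine ⟨φ, hφ, by simpa using h 0, fun r hr => ?_⟩
  have := hasDerivAt_of_radial_integral hFcont hφ h hr
  simpa only [hFdef, min_eq_left (hle _), emdenMass] using this

/-- A solution of the Emden-Fowler equation with positive central value, first zero `R` and
total mass `M`. -/
structure IsStellarProfile (p c M R : ℝ) (φ : ℝ → ℝ) : Prop where
  continuous : Continuous φ
  center_pos : 0 < φ 0
  hasDerivAt : ∀ r, 0 < r → HasDerivAt φ (-(emdenMass p c φ r / r ^ 2)) r
  radius_pos : 0 < R
  radius : φ R = 0
  mass : emdenMass p c φ R = M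

lemma strictAntiOn_of_emden {p c : ℝ} (hp : 0 ≤ p) (hc : 0 < c) {φ : ℝ → ℝ} (hφ : Continuous φ)
    (h0 : 0 < φ 0) (h : ∀ r, 0 < r → HasDerivAt φ (-(emdenMass p c φ r / r ^ 2)) r) :
    StrictAntiOn φ (Ici 0) := by
  refine strictAntiOn_of_deriv_neg (convex_Ici 0) hφ.continuousOn fun r hr => ?_
  rw [interior_Ici] at hr
  have hr' : 0 < r := hr
  rw [(h r hr).deriv, neg_lt_zero]
  have := emdenMass_pos hp hc hφ.continuousOn h0 hr'
  positivity

lemma monotoneOn_emdenMass {p c : ℝ} (hp : 0 ≤ p) (hc : 0 < c) {φ : ℝ → ℝ} (hφ : Continuous φ) :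
    MonotoneOn (emdenMass p c φ) (Ici 0) := by
  intro a ha b hb hab
  have hi := fun x y (hx : (0 : ℝ) ≤ x) (hy : (0 : ℝ) ≤ y) =>
    intervalIntegrable_emdenIntegrand (c := c) hp hφ.continuousOn hx hy
  have := intervalIntegral.integral_interval_sub_left (hi 0 b le_rfl hb) (hi 0 a le_rfl ha)
  rw [← sub_nonneg, emdenMass, emdenMass, this]
  exact intervalIntegral.integral_nonneg hab fun s _ => mul_nonneg (sq_nonneg _)
    (mul_nonneg hc.le (Real.rpow_nonneg (le_max_right _ _) _))

/-- Since φ decreases, the integrand on [0,r] is bounded below by replacing φ with its value at s ≥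
r. -/
lemma le_emdenMass {p c : ℝ} (hp : 0 ≤ p) (hc : 0 < c) {φ : ℝ → ℝ} (hφ : Continuous φ)
    (hanti : StrictAntiOn φ (Ici 0)) {r s : ℝ} (hr : 0 ≤ r) (hrs : r ≤ s) :
    c * (max (φ s) 0) ^ p * (r ^ 3 / 3) ≤ emdenMass p c φ r := by
  have h1 : ∫ s' in (0 : ℝ)..r, s' ^ 2 * (c * (max (φ s) 0) ^ p)
      = c * (max (φ s) 0) ^ p * (r ^ 3 / 3) := by
    rw [intervalIntegral.integral_mul_const, integral_pow]; norm_num; ring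
  rw [← h1]
  refine intervalIntegral.integral_mono_on hr (Continuous.intervalIntegrable (by fun_prop) _ _)
    (intervalIntegrable_emdenIntegrand hp hφ.continuousOn le_rfl hr) fun x hx => ?_
  gcongr
  exact hanti.antitoneOn hx.1 (hr.trans hrs : (0 : ℝ) ≤ s) (hx.2.trans hrs)

/-- A solution positive forever would satisfy φ' ≤ -(c/3) r φ^p, hence decay at least like
r^{-2/(p-1)}. The mass inside radius 1 alone forces φ ≥ m(1)/(2r). For p < 3 the two rates are
incompatible. -/
lemma exists_emden_zero {p c : ℝ} (hp : 1 < p) (hp3 : p < 3) (hc : 0 < c) {φ : ℝ → ℝ}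
    (hφ : Continuous φ) (h0 : 0 < φ 0)
    (h : ∀ r, 0 < r → HasDerivAt φ (-(emdenMass p c φ r / r ^ 2)) r) : ∃ R, 0 < R ∧ φ R = 0 := by
  by_contra! hne
  have hp0 : 0 ≤ p := by linarith
  have hpos : ∀ r, 0 ≤ r → 0 < φ r := by
    intro r hr
    by_contra! hneg
    obtain ⟨x, hx, hx0⟩ := intermediate_value_Icc' hr hφ.continuousOn ⟨hneg, h0.le⟩
    rcases hx.1.eq_or_lt with rfl | hx1
    · exact h0.ne' hx0
    · exact hne x hx1 hx0
  have hanti := strictAntiOn_of_emden hp0 hc hφ h0 h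
  set m := emdenMass p c φ with hm
  have hm1 : 0 < m 1 := emdenMass_pos hp0 hc hφ.continuousOn h0 one_pos
  -- upper bound
  have hup : ∀ r, 0 < r → (p - 1) * c / 6 * r ^ 2 ≤ φ r ^ (1 - p) := by
    have hmono : MonotoneOn (fun r => φ r ^ (1 - p) - (p - 1) * c / 6 * r ^ 2) (Ici 0) := by
      have hd : ∀ r, 0 < r → HasDerivAt (fun r => φ r ^ (1 - p) - (p - 1) * c / 6 * r ^ 2)
          (-(m r / r ^ 2) * (1 - p) * φ r ^ (1 - p - 1) - (p - 1) * c / 6 * (2 * r)) r := by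
        intro r hr
        have := ((h r hr).rpow_const (p := 1 - p) (Or.inl (hpos r hr.le).ne')).sub
          ((hasDerivAt_pow 2 r).const_mul ((p - 1) * c / 6))
        exact this.congr_deriv (by norm_num)
      refine monotoneOn_of_deriv_nonneg (convex_Ici 0) (ContinuousOn.sub
        (hφ.continuousOn.rpow_const fun r hr => Or.inl (hpos r hr).ne')
        (Continuous.continuousOn (by fun_prop))) ?_ ?_
      · rw [interior_Ici]
        exact fun r hr => (hd r hr).differentiableAt.differentiableWithinAt
      · rw [interior_Ici]
        intro r hr
        have hr0 : 0 < r := hr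
        have hφr := hpos r hr0.le
        have h1 := le_emdenMass hp0 hc hφ hanti hr0.le le_rfl
        rw [max_eq_left hφr.le] at h1
        rw [(hd r hr).deriv, show 1 - p - 1 = -p by ring, Real.rpow_neg hφr.le]
        have h2 : c * (r / 3) ≤ m r / r ^ 2 * (φ r ^ p)⁻¹ := by
          rw [← div_eq_mul_inv, le_div_iff₀ (Real.rpow_pos_of_pos hφr _), le_div_iff₀ (by positivity)]
          exact le_trans (le_of_eq (by ring)) h1
        nlinarith
    intro r hr
    have := hmono self_mem_Ici hr.le hr.le
    have h1 := Real.rpow_pos_of_pos h0 (1 - p)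
    simp only at this
    nlinarith
  -- lower bound
  have hlow : ∀ r, 1 ≤ r → m 1 / (2 * r) ≤ φ r := by
    have hmono : AntitoneOn (fun r => φ r - m 1 * r⁻¹) (Ici 1) := by
      have hd : ∀ r, 1 < r → HasDerivAt (fun r => φ r - m 1 * r⁻¹)
          (-(m r / r ^ 2) - m 1 * (-(r ^ 2)⁻¹)) r := fun r hr =>
        (h r (by linarith)).sub ((hasDerivAt_inv (by linarith)).const_mul _)
      refine antitoneOn_of_deriv_nonpos (convex_Ici 1) (hφ.continuousOn.sub
        (continuousOn_const.mul (continuousOn_inv₀.mono fun r hr =>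
          (lt_of_lt_of_le one_pos hr).ne'))) ?_ ?_
      · rw [interior_Ici]
        exact fun r hr => (hd r hr).differentiableAt.differentiableWithinAt
      · rw [interior_Ici]
        intro r hr
        have hr1 : 1 < r := hr
        rw [(hd r hr).deriv]
        have := monotoneOn_emdenMass hp0 hc hφ (zero_le_one : (0 : ℝ) ≤ 1)
          (by linarith : (0 : ℝ) ≤ r) hr1.le
        rw [show -(m r / r ^ 2) - m 1 * (-(r ^ 2)⁻¹) = -((m r - m 1) / r ^ 2) by ring, neg_nonpos]
        exact div_nonneg (sub_nonneg.2 this) (sq_nonneg r)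
    intro r hr
    have := hmono hr (by linarith : (1 : ℝ) ≤ 2 * r) (by linarith)
    have h2 := hpos (2 * r) (by linarith)
    simp only at this
    have hr0 : r ≠ 0 := by linarith
    have e : m 1 / (2 * r) = m 1 * r⁻¹ - m 1 * (2 * r)⁻¹ := by field_simp; norm_num
    rw [e]; linarith
  have hbd : ∀ r, 1 ≤ r → r ^ (3 - p) ≤ 6 / ((p - 1) * c) * (m 1 / 2) ^ (1 - p) := by
    intro r hr
    have hr0 : 0 < r := by linarith
    have h1 := hup r hr0
    have h2 : φ r ^ (1 - p) ≤ (m 1 / (2 * r)) ^ (1 - p) :=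
      Real.rpow_le_rpow_of_nonpos (by positivity) (hlow r hr) (by linarith)
    have h3 : (m 1 / (2 * r)) ^ (1 - p) = (m 1 / 2) ^ (1 - p) * r ^ (p - 1) := by
      rw [show m 1 / (2 * r) = m 1 / 2 * r⁻¹ by field_simp,
        Real.mul_rpow (by positivity) (by positivity), Real.inv_rpow hr0.le, ← Real.rpow_neg hr0.le,
        neg_sub]
    have h4 : r ^ 2 = r ^ (3 - p) * r ^ (p - 1) := by
      rw [← Real.rpow_add hr0, ← Real.rpow_natCast]; norm_num
    have h5 := h1.trans (h2.trans_eq h3)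
    rw [h4, ← mul_assoc] at h5
    have h6 := le_of_mul_le_mul_right h5 (Real.rpow_pos_of_pos hr0 _)
    have hpc : 0 < (p - 1) * c := mul_pos (by linarith) hc
    have hp1 : p - 1 ≠ 0 := by linarith
    calc r ^ (3 - p) = 6 / ((p - 1) * c) * ((p - 1) * c / 6 * r ^ (3 - p)) := by field_simp
      _ ≤ _ := by gcongr
  obtain ⟨r, hr, hr1⟩ := (((tendsto_rpow_atTop (by linarith : 0 < 3 - p)).eventually_gt_atTop
    (6 / ((p - 1) * c) * (m 1 / 2) ^ (1 - p))).and (eventually_ge_atTop 1)).exists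
  exact absurd (hbd r hr1) (not_le.2 hr)

/-- For `1 < p < 3` there is a profile of any given mass. -/
lemma exists_isStellarProfile {p c M : ℝ} (hp : 1 < p) (hp3 : p < 3) (hc : 0 < c) (hM : 0 < M) :
    ∃ (R : ℝ) (φ : ℝ → ℝ), IsStellarProfile p c M R φ := by
  have hp0 : 0 ≤ p := by linarith
  obtain ⟨φ, hφ, h0, h⟩ := exists_emden_solution hp.le hc
  have h0' : 0 < φ 0 := by rw [h0]; exact one_pos
  obtain ⟨R, hR, hφR⟩ := exists_emden_zero hp hp3 hc hφ h0' h
  have hm : 0 < emdenMass p c φ R := emdenMass_pos hp0 hc hφ.continuousOn h0' hR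
  set q := M / emdenMass p c φ R with hq
  have hq0 : 0 < q := by positivity
  -- Scaling multiplies the mass by γ^{(3-p)/(p-1)}; this γ makes that factor equal to q. The radius
  -- becomes R/γ.
  set γ := q ^ ((p - 1) / (3 - p)) with hγ
  have hγ0 : 0 < γ := Real.rpow_pos_of_pos hq0 _
  have hγq : γ ^ (2 / (p - 1)) / γ = q := by
    nth_rw 2 [← Real.rpow_one γ]
    rw [← Real.rpow_sub hγ0, hγ, ← Real.rpow_mul hq0.le]
    have h1 : p - 1 ≠ 0 := by linarith
    have h2 : 3 - p ≠ 0 := by linarith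
    rw [show (p - 1) / (3 - p) * (2 / (p - 1) - 1) = 1 by field_simp; ring, Real.rpow_one]
  refine ⟨R / γ, fun s => γ ^ (2 / (p - 1)) * φ (γ * s), by fun_prop, ?_,
    fun r hr => hasDerivAt_scaling hp hγ0 h hr, by positivity, ?_, ?_⟩
  · simp only [mul_zero]; positivity
  · rw [mul_div_cancel₀ _ hγ0.ne', hφR, mul_zero]
  · rw [emdenMass_scaling hp hγ0, mul_div_cancel₀ _ hγ0.ne', hγq, hq, div_mul_cancel₀ _ hm.ne']

/-! ### Radial functions on `ℝ³` -/

lemma det_reflection_orthogonal_span_singleton {v : R3} (hv : v ≠ 0) :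
    LinearMap.det ((Submodule.reflection (ℝ ∙ v)ᗮ).toLinearEquiv : R3 →ₗ[ℝ] R3) = -1 := by
  have := Submodule.det_reflection (𝕜 := ℝ) (ℝ ∙ v)ᗮ
  rw [Submodule.orthogonal_orthogonal, finrank_span_singleton hv, pow_one] at this
  exact this

/-- The reflection exchanging x with its image has determinant -1; composing it with a reflection
that fixes the axis restores determinant 1. -/
lemma exists_rotation_to_axis (x : R3) :
    ∃ A : R3 ≃ₗᵢ[ℝ] R3, LinearMap.det (A.toLinearEquiv : R3 →ₗ[ℝ] R3) = 1 ∧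
      A x = ‖x‖ • EuclideanSpace.single 0 1 := by
  set w : R3 := ‖x‖ • EuclideanSpace.single 0 1 with hw
  by_cases hx : x = w
  · exact ⟨LinearIsometryEquiv.refl ℝ R3, by
      rw [show ((LinearIsometryEquiv.refl ℝ R3).toLinearEquiv : R3 →ₗ[ℝ] R3) = LinearMap.id from rfl,
        LinearMap.det_id], hx⟩
  set e : R3 := EuclideanSpace.single 1 1 with he
  have he0 : e ≠ 0 := by
    intro h
    have := congrArg (fun v : R3 => v 1) h
    simp [he] at this
  have hnorm : ‖x‖ = ‖w‖ := by simp [hw, norm_smul]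
  refine ⟨(Submodule.reflection (ℝ ∙ (x - w))ᗮ).trans (Submodule.reflection (ℝ ∙ e)ᗮ), ?_, ?_⟩
  · have : (((Submodule.reflection (ℝ ∙ (x - w))ᗮ).trans
        (Submodule.reflection (ℝ ∙ e)ᗮ)).toLinearEquiv : R3 →ₗ[ℝ] R3)
        = ((Submodule.reflection (ℝ ∙ e)ᗮ).toLinearEquiv : R3 →ₗ[ℝ] R3).comp
          ((Submodule.reflection (ℝ ∙ (x - w))ᗮ).toLinearEquiv : R3 →ₗ[ℝ] R3) := rfl
    rw [this, LinearMap.det_comp, det_reflection_orthogonal_span_singleton he0,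
      det_reflection_orthogonal_span_singleton (sub_ne_zero.2 hx)]
    norm_num
  · rw [LinearIsometryEquiv.trans_apply, Submodule.reflection_sub hnorm]
    refine Submodule.reflection_mem_subspace_eq_self ?_
    rw [Submodule.mem_orthogonal_singleton_iff_inner_right, hw, he, inner_smul_right]
    simp [EuclideanSpace.inner_single_left]

/-- An integrable function which is invariant under all rotations is a function of the radius. -/
lemma exists_radial_of_rotation_invariant {ρ : R3 → ℝ} (hρ : Integrable ρ)
    (hinv : ∀ A : R3 ≃ₗᵢ[ℝ] R3, LinearMap.det (A.toLinearEquiv : R3 →ₗ[ℝ] R3) = 1 →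
      ∀ᵐ x, ρ (A x) = ρ x) :
    ∃ h : ℝ → ℝ, Measurable h ∧ ρ =ᵐ[volume] fun x => h ‖x‖ := by
  -- The null set in the invariance depends on the rotation. Ball averages are invariant at every
  -- centre, so they are honest functions of ‖x‖, and Lebesgue differentiation recovers ρ.
  let a : ℕ → R3 → ℝ := fun k x => ⨍ y in Metric.closedBall x (1 / ((k : ℝ) + 1)), ρ y
  let e : R3 := EuclideanSpace.single 0 1
  have hrot : ∀ k x, a k x = a k (‖x‖ • e) := by
    intro k x
    obtain ⟨A, hA, hAx⟩ := exists_rotation_to_axis x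
    have hpre : A ⁻¹' Metric.closedBall (A x) (1 / ((k : ℝ) + 1))
        = Metric.closedBall x (1 / ((k : ℝ) + 1)) := A.isometry.preimage_closedBall _ _
    simp only [a, setAverage_eq, e]
    rw [← hAx]
    congr 1
    · rw [← hpre, measureReal_def, measureReal_def,
        A.measurePreserving.measure_preimage Metric.isClosed_closedBall.measurableSet.nullMeasurableSet]
    · rw [← A.measurePreserving.setIntegral_preimage_emb
        A.toHomeomorph.measurableEmbedding ρ (Metric.closedBall (A x) (1 / ((k : ℝ) + 1))), hpre]
      refine setIntegral_congr_ae Metric.isClosed_closedBall.measurableSet ?_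
      filter_upwards [hinv A hA] with y hy _ using hy.symm
  have hlim : ∀ᵐ x, Tendsto (fun k => a k x) atTop (𝓝 (ρ x)) := by
    filter_upwards [IsUnifLocDoublingMeasure.ae_tendsto_average volume hρ.locallyIntegrable 1]
      with x hx
    refine hx (fun _ => x) (fun k : ℕ => 1 / ((k : ℝ) + 1)) ?_ ?_
    · refine tendsto_nhdsWithin_iff.2 ⟨tendsto_one_div_add_atTop_nhds_zero_nat, ?_⟩
      exact Eventually.of_forall fun k => by
        show (0 : ℝ) < 1 / ((k : ℝ) + 1)
        positivity
    · exact Eventually.of_forall fun k => Metric.mem_closedBall_self (by positivity)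
  have hmeas : ∀ k, Measurable fun r : ℝ => a k (r • e) := by
    intro k
    obtain ⟨ρ', hρ', hρρ'⟩ := hρ.1
    have h1 : ∀ r : ℝ, a k (r • e) = (volume.real (Metric.closedBall (0 : R3) (1 / ((k : ℝ) + 1))))⁻¹ *
        ∫ y, {q : ℝ × R3 | ‖q.2 - q.1 • e‖ ≤ 1 / ((k : ℝ) + 1)}.indicator (fun q => ρ' q.2) (r, y) := by
      intro r
      simp only [a, setAverage_eq, smul_eq_mul]
      congr 1
      · rw [measureReal_def, measureReal_def, Measure.addHaar_closedBall_center]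
      · rw [← integral_indicator Metric.isClosed_closedBall.measurableSet]
        refine integral_congr_ae ?_
        filter_upwards [hρρ'] with y hy
        simp only [indicator, Metric.mem_closedBall, dist_eq_norm, Set.mem_ofPred_eq, hy]
    simp only [h1]
    refine Measurable.const_mul (StronglyMeasurable.measurable ?_) _
    refine StronglyMeasurable.integral_prod_right ?_
    refine (hρ'.comp_measurable measurable_snd).indicator ?_
    exact measurableSet_le (by fun_prop) measurable_const
  -- The limsup is defined and measurable at every radius and agrees with the limit wherever that
  -- exists.
  refine ⟨fun r => limsup (fun k => a k (r • e)) atTop, Measurable.limsup hmeas, ?_⟩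
  filter_upwards [hlim] with x hx
  simp only [← hrot]
  exact hx.limsup_eq.symm

/-! ### Spherical integration and Newton's theorem -/

lemma integral_radial (h : ℝ → ℝ) :
    ∫ x : R3, h ‖x‖ = ∫ r in Ioi (0 : ℝ), 4 * Real.pi * r ^ 2 * h r := by
  have h1 := integral_fun_norm_addHaar (volume : Measure R3) h
  have h2 : (volume : Measure R3).real (Metric.ball 0 1) = Real.pi * 4 / 3 := by
    rw [measureReal_def, EuclideanSpace.volume_ball_fin_three]
    simp [Real.pi_pos.le, div_nonneg]
  have h3 : Module.finrank ℝ R3 = 3 := by simp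
  rw [h1, h2, h3, nsmul_eq_mul, smul_eq_mul, ← integral_const_mul, ← integral_const_mul]
  congr 1; ext r
  norm_num
  ring

lemma integrable_radial_iff {h : ℝ → ℝ} :
    Integrable (fun x : R3 => h ‖x‖) ↔
      IntegrableOn (fun r : ℝ => 4 * Real.pi * r ^ 2 * h r) (Ioi 0) := by
  rw [integrable_fun_norm_addHaar (volume : Measure R3) (f := h)]
  have h3 : Module.finrank ℝ R3 = 3 := by simp
  rw [h3, IntegrableOn, IntegrableOn, ← integrable_const_mul_iff (c := 4 * Real.pi)
    (IsUnit.mk0 _ (by positivity))]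
  simp only [smul_eq_mul, mul_assoc]

open ENNReal in
lemma lintegral_plane_radial {K : ℝ → ℝ≥0∞} (hK : Measurable K) :
    ∫⁻ q : ℝ × ℝ, K (√(q.1 ^ 2 + q.2 ^ 2))
      = ENNReal.ofReal (2 * Real.pi) * ∫⁻ t in Ioi (0 : ℝ), ENNReal.ofReal t * K t := by
  rw [← lintegral_comp_polarCoord_symm]
  have h1 : ∫⁻ p in polarCoord.target, ENNReal.ofReal p.1 •
        K (√((polarCoord.symm p).1 ^ 2 + (polarCoord.symm p).2 ^ 2))
      = ∫⁻ p in Ioi (0 : ℝ) ×ˢ Ioo (-Real.pi) Real.pi, ENNReal.ofReal p.1 * K p.1 := by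
    refine setLIntegral_congr_fun (measurableSet_Ioi.prod measurableSet_Ioo) fun p hp => ?_
    have hp0 : 0 < p.1 := hp.1
    have : (p.1 * Real.cos p.2) ^ 2 + (p.1 * Real.sin p.2) ^ 2 = p.1 ^ 2 := by
      rw [mul_pow, mul_pow, ← mul_add, Real.cos_sq_add_sin_sq, mul_one]
    simp only [polarCoord_symm_apply, this, Real.sqrt_sq hp0.le, smul_eq_mul]
  have h2 := lintegral_prod_mul (μ := volume.restrict (Ioi (0 : ℝ)))
    (ν := volume.restrict (Ioo (-Real.pi) Real.pi)) (f := fun t => ENNReal.ofReal t * K t)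
    (g := fun _ => 1) (by fun_prop) (by fun_prop)
  simp only [mul_one] at h2
  rw [h1, Measure.volume_eq_prod, ← Measure.prod_restrict, h2, mul_comm, lintegral_one,
    Measure.restrict_apply_univ, Real.volume_Ioo]
  congr 2
  ring

-- Substitution s = √(τ² + t²), for which s ds = t dt.
open ENNReal in
lemma lintegral_radial_shift {G : ℝ → ℝ≥0∞} (τ : ℝ) :
    ∫⁻ t in Ioi (0 : ℝ), ENNReal.ofReal t * G (√(τ ^ 2 + t ^ 2))
      = ∫⁻ s in Ioi |τ|, ENNReal.ofReal s * G s := by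
  set f : ℝ → ℝ := fun t => √(τ ^ 2 + t ^ 2)
  have himg : f '' Ioi 0 = Ioi |τ| := by
    ext s
    constructor
    · rintro ⟨t, ht, rfl⟩
      have ht0 : 0 < t := ht
      exact Real.lt_sqrt_of_sq_lt (by rw [sq_abs]; have := pow_pos ht0 2; linarith)
    · intro hs
      have hs' : |τ| < s := hs
      have h2 : 0 < s ^ 2 - τ ^ 2 := by
        rw [← sq_abs τ]; nlinarith [abs_nonneg τ]
      refine ⟨√(s ^ 2 - τ ^ 2), Real.sqrt_pos.2 h2, ?_⟩
      simp only [f]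
      rw [Real.sq_sqrt h2.le, add_sub_cancel, Real.sqrt_sq ((abs_nonneg τ).trans hs'.le)]
  have hpos : ∀ t ∈ Ioi (0 : ℝ), 0 < τ ^ 2 + t ^ 2 := fun t ht => by
    have ht0 : 0 < t := ht
    positivity
  have hder : ∀ t ∈ Ioi (0 : ℝ), HasDerivWithinAt f (t / f t) (Ioi 0) t := fun t ht => by
    have := (((hasDerivAt_pow 2 t).const_add (τ ^ 2)).sqrt (hpos t ht).ne').hasDerivWithinAt
      (s := Ioi 0)
    refine this.congr_deriv ?_
    simp only [f]
    norm_num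
    rw [mul_div_mul_left _ _ two_ne_zero]
  have hinj : InjOn f (Ioi 0) := by
    intro a ha b hb hab
    have ha0 : 0 < a := ha
    have hb0 : 0 < b := hb
    have := (Real.sqrt_inj (hpos a ha).le (hpos b hb).le).1 hab
    nlinarith
  rw [← himg, lintegral_image_eq_lintegral_abs_deriv_mul measurableSet_Ioi hder hinj]
  refine setLIntegral_congr_fun measurableSet_Ioi fun t ht => ?_
  have ht0 : 0 < t := ht
  have hf : 0 < f t := Real.sqrt_pos.2 (hpos t ht)
  rw [← mul_assoc, ← ENNReal.ofReal_mul (abs_nonneg _), abs_of_nonneg (by positivity),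
    div_mul_cancel₀ _ hf.ne']

open ENNReal in
/-- Lebesgue measure on `ℝ³` in terms of the radius and one Cartesian coordinate. -/
lemma lintegral_norm_coord {H : ℝ → ℝ → ℝ≥0∞} (hH : Measurable (Function.uncurry H)) :
    ∫⁻ y : R3, H ‖y‖ (y 0)
      = ∫⁻ s in Ioi (0 : ℝ), ENNReal.ofReal (2 * Real.pi * s) * ∫⁻ τ in Ioo (-s) s, H s τ := by
  have e1 := EuclideanSpace.volume_preserving_symm_measurableEquiv_toLp (Fin 3)
  have e2 := volume_preserving_piFinSuccAbove (fun _ : Fin 3 => ℝ) 0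
  have e3 := (MeasurePreserving.id (volume : Measure ℝ)).prod (volume_preserving_finTwoArrow ℝ)
  have hG : Measurable fun q : ℝ × ℝ × ℝ => H (√(q.1 ^ 2 + (√(q.2.1 ^ 2 + q.2.2 ^ 2)) ^ 2)) q.1 :=
    hH.comp (g := Function.uncurry H) (f := fun q : ℝ × ℝ × ℝ =>
      (√(q.1 ^ 2 + (√(q.2.1 ^ 2 + q.2.2 ^ 2)) ^ 2), q.1)) (by fun_prop)
  have h1 : ∫⁻ y : R3, H ‖y‖ (y 0)
      = ∫⁻ q : ℝ × ℝ × ℝ, H (√(q.1 ^ 2 + (√(q.2.1 ^ 2 + q.2.2 ^ 2)) ^ 2)) q.1 := by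
    have := ((e3.comp e2).comp e1).lintegral_comp hG
    rw [Measure.volume_eq_prod, ← this]
    refine lintegral_congr fun y => ?_
    have hn : ‖y‖ = √((y 0) ^ 2 + (√((y 1) ^ 2 + (y 2) ^ 2)) ^ 2) := by
      rw [Real.sq_sqrt (by positivity), EuclideanSpace.norm_eq, Fin.sum_univ_three]
      simp [add_assoc]
    rw [hn]
    rfl
  have hind : Measurable fun q : ℝ × ℝ => (Ioi |q.1|).indicator
      (fun s => ENNReal.ofReal (2 * Real.pi) * (ENNReal.ofReal s * H s q.1)) q.2 := by
    have : (fun q : ℝ × ℝ => (Ioi |q.1|).indicator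
        (fun s => ENNReal.ofReal (2 * Real.pi) * (ENNReal.ofReal s * H s q.1)) q.2)
        = {q : ℝ × ℝ | |q.1| < q.2}.indicator
          (fun q => ENNReal.ofReal (2 * Real.pi) * (ENNReal.ofReal q.2 * H q.2 q.1)) := by
      ext q; simp [indicator]
    rw [this]
    refine Measurable.indicator ?_ (measurableSet_lt (by fun_prop) (by fun_prop))
    have : Measurable fun q : ℝ × ℝ => H q.2 q.1 := hH.comp measurable_swap
    fun_prop
  rw [h1, Measure.volume_eq_prod, lintegral_prod _ hG.aemeasurable]
  -- For a fixed first coordinate τ, polar coordinates in the remaining plane are followed by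
  -- passing from the planar radius to the spatial one. Exchanging the order on |τ| < s then puts
  -- the radius outside.
  have h2 : ∀ τ, ∫⁻ q : ℝ × ℝ, H (√(τ ^ 2 + (√(q.1 ^ 2 + q.2 ^ 2)) ^ 2)) τ
      = ∫⁻ s, (Ioi |τ|).indicator
          (fun s => ENNReal.ofReal (2 * Real.pi) * (ENNReal.ofReal s * H s τ)) s := by
    intro τ
    have hm : Measurable fun s => H s τ := hH.comp (by fun_prop : Measurable fun s : ℝ => (s, τ))
    rw [lintegral_plane_radial (K := fun t => H (√(τ ^ 2 + t ^ 2)) τ) (hm.comp (by fun_prop)),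
      lintegral_radial_shift (G := fun s => H s τ), lintegral_indicator measurableSet_Ioi,
      lintegral_const_mul _ (by fun_prop)]
  simp only [h2]
  rw [lintegral_lintegral_swap hind.aemeasurable, ← lintegral_indicator measurableSet_Ioi]
  refine lintegral_congr fun s => ?_
  by_cases hs : 0 < s
  · rw [indicator_of_mem (show s ∈ Ioi 0 from hs), ← lintegral_indicator measurableSet_Ioo]
    have hm : Measurable fun τ => (Ioo (-s) s).indicator (fun τ => H s τ) τ :=
      (hH.comp (by fun_prop : Measurable fun τ : ℝ => (s, τ))).indicator measurableSet_Ioo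
    rw [← lintegral_const_mul _ hm]
    refine lintegral_congr fun τ => ?_
    by_cases hτ : |τ| < s
    · rw [indicator_of_mem (show s ∈ Ioi |τ| from hτ),
        indicator_of_mem (show τ ∈ Ioo (-s) s from abs_lt.1 hτ),
        ← mul_assoc, ← ENNReal.ofReal_mul (by positivity)]
    · rw [indicator_of_notMem (show s ∉ Ioi |τ| from hτ),
        indicator_of_notMem (show τ ∉ Ioo (-s) s from fun h => hτ (abs_lt.2 h)), mul_zero]
  · rw [indicator_of_notMem (show s ∉ Ioi 0 from hs)]
    refine lintegral_eq_zero_of_ae_eq_zero (Eventually.of_forall fun τ => ?_)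
    exact indicator_of_notMem (fun h => hs ((abs_nonneg τ).trans_lt h)) _

/-- The mean of `1 / |x - y|` over a sphere, in the coordinate along the axis of `x`. -/
lemma lintegral_inv_sqrt_axis {r s : ℝ} (hr : 0 < r) (hs : 0 < s) :
    ∫⁻ τ in Ioo (-s) s, ENNReal.ofReal (1 / √(r ^ 2 - 2 * r * τ + s ^ 2))
      = ∫⁻ _ in Ioo (-s) s, ENNReal.ofReal (1 / max r s) := by
  have hpos : ∀ τ ∈ Ioo (-s) s, 0 < r ^ 2 - 2 * r * τ + s ^ 2 := fun τ hτ => by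
    nlinarith [sq_nonneg (r - s), hτ.2]
  have hder : ∀ τ ∈ Ioo (-s) s, HasDerivAt (fun τ => -(1 / r) * √(r ^ 2 - 2 * r * τ + s ^ 2))
      (1 / √(r ^ 2 - 2 * r * τ + s ^ 2)) τ := fun τ hτ => by
    have := (((((hasDerivAt_id τ).const_mul (2 * r)).const_sub (r ^ 2)).add_const (s ^ 2)).sqrt
      (hpos τ hτ).ne').const_mul (-(1 / r))
    refine this.congr_deriv ?_
    simp only [id]
    field_simp
  have hcont : ContinuousOn (fun τ => -(1 / r) * √(r ^ 2 - 2 * r * τ + s ^ 2)) (Icc (-s) s) := by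
    fun_prop
  have hle : -s ≤ s := by linarith
  have hint : IntegrableOn (fun τ => 1 / √(r ^ 2 - 2 * r * τ + s ^ 2)) (Ioc (-s) s) :=
    intervalIntegral.integrableOn_deriv_of_nonneg hcont hder fun τ _ => by positivity
  have hI := intervalIntegral.integral_eq_sub_of_hasDerivAt_of_le hle hcont hder
    ((intervalIntegrable_iff_integrableOn_Ioc_of_le hle).2 hint)
  -- At τ = ±s the root is |r - s| and r + s; their difference is 2 min(r,s), and min·max = rs.
  have hval : ∫ τ in Ioo (-s) s, 1 / √(r ^ 2 - 2 * r * τ + s ^ 2) = 2 * s * (1 / max r s) := by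
    rw [← integral_Ioc_eq_integral_Ioo, ← intervalIntegral.integral_of_le hle, hI,
      show r ^ 2 - 2 * r * s + s ^ 2 = (r - s) ^ 2 by ring,
      show r ^ 2 - 2 * r * -s + s ^ 2 = (r + s) ^ 2 by ring, Real.sqrt_sq_eq_abs,
      Real.sqrt_sq (by positivity)]
    rcases le_total r s with h | h
    · rw [max_eq_right h, abs_of_nonpos (by linarith)]; field_simp; ring
    · rw [max_eq_left h, abs_of_nonneg (by linarith)]; field_simp; ring
  rw [← ofReal_integral_eq_lintegral_ofReal (hint.mono_set Ioo_subset_Ioc_self)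
    (Eventually.of_forall fun τ => by positivity), hval, lintegral_const,
    Measure.restrict_apply_univ, Real.volume_Ioo, ← ENNReal.ofReal_mul (by positivity)]
  congr 1; ring

/-- Newton's theorem for radial densities. -/
lemma integral_newton {h : ℝ → ℝ} (hm : Measurable h) (h0 : ∀ r, 0 ≤ h r) (x : R3) :
    ∫ y : R3, h ‖y‖ / ‖x - y‖ = ∫ y : R3, h ‖y‖ / max ‖x‖ ‖y‖ := by
  rcases eq_or_ne x 0 with rfl | hx
  · simp
  obtain ⟨A, -, hA⟩ := exists_rotation_to_axis x
  have hr : 0 < ‖x‖ := norm_pos_iff.2 hx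
  set r := ‖x‖ with hrdef
  have h1 : ∫ y : R3, h ‖y‖ / ‖x - y‖
      = ∫ y : R3, h ‖y‖ / ‖r • EuclideanSpace.single 0 1 - y‖ := by
    rw [← A.measurePreserving.integral_comp A.toHomeomorph.measurableEmbedding
      (fun y => h ‖y‖ / ‖r • EuclideanSpace.single 0 1 - y‖)]
    refine integral_congr_ae (Eventually.of_forall fun y => ?_)
    simp only
    rw [← hA, ← map_sub, A.norm_map, A.norm_map]
  have h2 : ∀ y : R3, ‖r • EuclideanSpace.single 0 1 - y‖
      = √(r ^ 2 - 2 * r * y 0 + ‖y‖ ^ 2) := by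
    intro y
    rw [← Real.sqrt_sq (norm_nonneg (r • EuclideanSpace.single 0 1 - y)), norm_sub_sq_real,
      inner_smul_left, EuclideanSpace.inner_single_left, norm_smul]
    congr 1
    simp [mul_assoc]
  simp only [h1, h2]
  -- Lower Lebesgue integrals make the comparison free of any integrability assumption.
  rw [integral_eq_lintegral_of_nonneg_ae (Eventually.of_forall fun y =>
      div_nonneg (h0 _) (Real.sqrt_nonneg _))
      (Measurable.div (by fun_prop) (by fun_prop)).aestronglyMeasurable,
    integral_eq_lintegral_of_nonneg_ae (Eventually.of_forall fun y =>
      div_nonneg (h0 _) (le_max_of_le_left hr.le))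
      (Measurable.div (by fun_prop) (by fun_prop)).aestronglyMeasurable]
  congr 1
  rw [lintegral_norm_coord
      (H := fun s τ => ENNReal.ofReal (h s / √(r ^ 2 - 2 * r * τ + s ^ 2)))
      (Measurable.ennreal_ofReal (Measurable.div (by fun_prop) (by fun_prop))),
    lintegral_norm_coord (H := fun s _ => ENNReal.ofReal (h s / max r s))
      (Measurable.ennreal_ofReal (Measurable.div (by fun_prop) (by fun_prop)))]
  refine setLIntegral_congr_fun measurableSet_Ioi fun s hs => ?_
  simp only [div_eq_mul_one_div (h s), ENNReal.ofReal_mul (h0 s)]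
  rw [lintegral_const_mul _ (by fun_prop), lintegral_const_mul _ (by fun_prop),
    lintegral_inv_sqrt_axis hr hs]

/-! ### Enclosed mass and potential -/

/-- The mass inside the ball of radius `r` for the radial density `h`. -/
noncomputable def radialMass (h : ℝ → ℝ) (r : ℝ) : ℝ :=
  ∫ s in (0 : ℝ)..r, 4 * Real.pi * s ^ 2 * h s

/-- Minus the potential of the radial density `h`, as a function of the radius. -/
noncomputable def radialPotential (h : ℝ → ℝ) (r : ℝ) : ℝ :=
  ∫ y : R3, h ‖y‖ / max r ‖y‖

lemma setIntegral_radial {S : Set ℝ} (hS : MeasurableSet S) (h : ℝ → ℝ) :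
    ∫ x in (fun x : R3 => ‖x‖) ⁻¹' S, h ‖x‖
      = ∫ r in Ioi (0 : ℝ) ∩ S, 4 * Real.pi * r ^ 2 * h r := by
  rw [← integral_indicator (measurable_norm hS), ← setIntegral_indicator hS]
  have := integral_radial (S.indicator h)
  calc _ = ∫ x : R3, S.indicator h ‖x‖ := by
        congr 1
    _ = _ := by
        rw [this]
        congr 1; ext r
        by_cases hr : r ∈ S <;> simp [hr]

lemma setIntegral_radial_Ioc {a b : ℝ} (ha : 0 ≤ a) (hab : a ≤ b) (h : ℝ → ℝ) :
    ∫ x in (fun x : R3 => ‖x‖) ⁻¹' Ioc a b, h ‖x‖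
      = ∫ r in a..b, 4 * Real.pi * r ^ 2 * h r := by
  rw [setIntegral_radial measurableSet_Ioc, intervalIntegral.integral_of_le hab,
    inter_eq_right.2 (show Ioc a b ⊆ Ioi 0 from fun x hx => lt_of_le_of_lt ha hx.1)]

lemma setIntegral_radial_Iic {r : ℝ} (hr : 0 ≤ r) (h : ℝ → ℝ) :
    ∫ x in (fun x : R3 => ‖x‖) ⁻¹' Iic r, h ‖x‖ = radialMass h r := by
  rw [setIntegral_radial measurableSet_Iic, radialMass, intervalIntegral.integral_of_le hr]
  rfl

/-- Differentiation under the integral works at every r > 0 although h is merely integrable: the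
kernel is Lipschitz in r with constant 4/r² near r, its kink sits on the null sphere ‖y‖ = r, and
only the mass inside contributes. -/
lemma hasDerivAt_radialPotential {h : ℝ → ℝ} (hm : Measurable h) (h0 : ∀ r, 0 ≤ h r)
    (hi : Integrable fun x : R3 => h ‖x‖) {r : ℝ} (hr : 0 < r) :
    HasDerivAt (radialPotential h) (-(radialMass h r / r ^ 2)) r := by
  have hmeas : ∀ x, AEStronglyMeasurable (fun y : R3 => h ‖y‖ / max x ‖y‖) volume := fun x =>
    (Measurable.div (by fun_prop) (by fun_prop)).aestronglyMeasurable
  have hS : MeasurableSet ((fun x : R3 => ‖x‖) ⁻¹' Iic r) := measurable_norm measurableSet_Iic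
  have key := hasDerivAt_integral_of_dominated_loc_of_lip (μ := (volume : Measure R3))
    (F := fun x y => h ‖y‖ / max x ‖y‖) (x₀ := r) (s := Ioi (r / 2))
    (bound := fun y => h ‖y‖ * (4 / r ^ 2))
    (F' := ((fun x : R3 => ‖x‖) ⁻¹' Iic r).indicator fun y => -(h ‖y‖ / r ^ 2))
    (Ioi_mem_nhds (by linarith)) (Eventually.of_forall hmeas) ?_ ?_ ?_ (hi.mul_const _) ?_
  · have hF : ∫ y, ((fun x : R3 => ‖x‖) ⁻¹' Iic r).indicator (fun y => -(h ‖y‖ / r ^ 2)) y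
        = -(radialMass h r / r ^ 2) := by
      rw [integral_indicator hS, integral_neg, integral_div, setIntegral_radial_Iic hr.le]
    rw [← hF]
    exact key.2
  · refine (hi.mul_const r⁻¹).mono' (hmeas r) (Eventually.of_forall fun y => ?_)
    rw [Real.norm_of_nonneg (div_nonneg (h0 _) (le_max_of_le_left hr.le)), div_eq_mul_inv]
    gcongr
    · exact h0 _
    · exact le_max_left _ _
  · exact ((hi.div_const (r ^ 2)).1.neg).indicator hS
  · refine Eventually.of_forall fun y => LipschitzOnWith.of_dist_le_mul fun a ha b hb => ?_
    have ha' : r / 2 < a := ha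
    have hb' : r / 2 < b := hb
    have hA : r / 2 ≤ max a ‖y‖ := ha'.le.trans (le_max_left _ _)
    have hB : r / 2 ≤ max b ‖y‖ := hb'.le.trans (le_max_left _ _)
    have hA0 : 0 < max a ‖y‖ := by linarith
    have hB0 : 0 < max b ‖y‖ := by linarith
    rw [Real.dist_eq, Real.dist_eq, Real.coe_nnabs,
      abs_of_nonneg (mul_nonneg (h0 _) (by positivity))]
    have e : h ‖y‖ / max a ‖y‖ - h ‖y‖ / max b ‖y‖
        = h ‖y‖ * ((max b ‖y‖ - max a ‖y‖) / (max a ‖y‖ * max b ‖y‖)) := by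
      field_simp
    rw [e, abs_mul, abs_of_nonneg (h0 _), mul_assoc]
    refine mul_le_mul_of_nonneg_left ?_ (h0 _)
    rw [abs_div, abs_of_pos (mul_pos hA0 hB0), div_le_iff₀ (mul_pos hA0 hB0)]
    have h1 : |max b ‖y‖ - max a ‖y‖| ≤ |a - b| := by
      rw [abs_sub_comm a b]
      exact (abs_max_sub_max_le_abs b a ‖y‖)
    have h2 : 1 ≤ 4 / r ^ 2 * (max a ‖y‖ * max b ‖y‖) := by
      have : r / 2 * (r / 2) ≤ max a ‖y‖ * max b ‖y‖ := mul_le_mul hA hB (by positivity) hA0.le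
      calc (1 : ℝ) = 4 / r ^ 2 * (r / 2 * (r / 2)) := by field_simp; norm_num
        _ ≤ _ := by gcongr
    calc _ ≤ |a - b| * 1 := by rw [mul_one]; exact h1
      _ ≤ |a - b| * (4 / r ^ 2 * (max a ‖y‖ * max b ‖y‖)) := by gcongr
      _ = _ := by ring
  · have hsph : ∀ᵐ y : R3, ‖y‖ ≠ r := by
      have := Measure.addHaar_sphere (volume : Measure R3) 0 r
      rw [measure_eq_zero_iff_ae_notMem] at this
      filter_upwards [this] with y hy h
      exact hy (by simpa using h)
    filter_upwards [hsph] with y hy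
    rcases lt_or_gt_of_ne hy with hlt | hgt
    · rw [indicator_of_mem (show y ∈ (fun x : R3 => ‖x‖) ⁻¹' Iic r from hlt.le)]
      have h1 : (fun x => h ‖y‖ / max x ‖y‖) =ᶠ[𝓝 r] fun x => h ‖y‖ * x⁻¹ := by
        filter_upwards [Ioi_mem_nhds hlt] with x hx
        rw [max_eq_left (le_of_lt hx), div_eq_mul_inv]
      refine (((hasDerivAt_inv hr.ne').const_mul (h ‖y‖)).congr_of_eventuallyEq h1).congr_deriv ?_
      ring
    · rw [indicator_of_notMem (show y ∉ (fun x : R3 => ‖x‖) ⁻¹' Iic r from not_le.2 hgt)]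
      have h1 : (fun x => h ‖y‖ / max x ‖y‖) =ᶠ[𝓝 r] fun _ => h ‖y‖ / ‖y‖ := by
        filter_upwards [Iio_mem_nhds hgt] with x hx
        rw [max_eq_right (le_of_lt hx)]
      exact (hasDerivAt_const r _).congr_of_eventuallyEq h1

lemma norm_gradient_radial {U : R3 → ℝ} {W : ℝ → ℝ} (hU : ∀ x, U x = -W ‖x‖) {d : ℝ} {x : R3}
    (hx : x ≠ 0) (hW : HasDerivAt W d ‖x‖) : ‖gradient U x‖ = |d| := by
  have hn : DifferentiableAt ℝ (fun x : R3 => ‖x‖) x :=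
    (contDiffAt_norm ℝ hx (n := 1)).differentiableAt one_ne_zero
  have h1 : HasFDerivAt U (-(d • fderiv ℝ (fun x : R3 => ‖x‖) x)) x := by
    have := (hW.comp_hasFDerivAt x hn.hasFDerivAt).neg
    refine this.congr_of_eventuallyEq (Eventually.of_forall fun y => ?_)
    simp [hU]
  rw [gradient, LinearIsometryEquiv.norm_map, h1.fderiv, norm_neg, norm_smul,
    norm_fderiv_norm hn, mul_one, Real.norm_eq_abs]

lemma integral_norm_gradient_sq {U : R3 → ℝ} {h : ℝ → ℝ} (hm : Measurable h) (h0 : ∀ r, 0 ≤ h r)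
    (hi : Integrable fun x : R3 => h ‖x‖) (hU : ∀ x, U x = -radialPotential h ‖x‖) :
    1 / (8 * Real.pi) * ∫ x, ‖gradient U x‖ ^ 2
      = 1 / 2 * ∫ r in Ioi (0 : ℝ), radialMass h r ^ 2 / r ^ 2 := by
  have h1 : ∫ x, ‖gradient U x‖ ^ 2 = ∫ x : R3, (radialMass h ‖x‖ / ‖x‖ ^ 2) ^ 2 := by
    refine integral_congr_ae ?_
    filter_upwards [compl_mem_ae_iff.2 (measure_singleton (0 : R3))] with x hx
    have hx0 : x ≠ 0 := hx
    rw [norm_gradient_radial hU hx0 (hasDerivAt_radialPotential hm h0 hi (norm_pos_iff.2 hx0)),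
      sq_abs, neg_sq]
  rw [h1, integral_radial (fun r => (radialMass h r / r ^ 2) ^ 2), ← integral_const_mul,
    ← integral_const_mul]
  refine setIntegral_congr_fun measurableSet_Ioi fun r hr => ?_
  have hr0 : r ≠ 0 := ne_of_gt hr
  have := Real.pi_pos.ne'
  field_simp
  ring

/-! ### The polytropic Casimir function and its velocity averages -/

/-- The constant `(μ/(μ+1))^μ` of the polytropic distribution `κ (s₊)^μ`. -/
noncomputable def polytropeCoeff (μ : ℝ) : ℝ := (μ / (μ + 1)) ^ μ

/-- The inverse of `Q'`, extended by zero. -/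
noncomputable def polytropeInv (μ s : ℝ) : ℝ := polytropeCoeff μ * (max s 0) ^ μ

/-- The convex conjugate of the polytropic Casimir function. -/
noncomputable def polytropeConj (μ s : ℝ) : ℝ :=
  polytropeCoeff μ / (μ + 1) * (max s 0) ^ (μ + 1)

lemma polytropeCoeff_pos {μ : ℝ} (hμ : 0 < μ) : 0 < polytropeCoeff μ :=
  Real.rpow_pos_of_pos (by positivity) _

lemma polytropeInv_nonneg {μ : ℝ} (hμ : 0 < μ) (s : ℝ) : 0 ≤ polytropeInv μ s :=
  mul_nonneg (polytropeCoeff_pos hμ).le (Real.rpow_nonneg (le_max_right _ _) _)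

lemma polytropeConj_nonneg {μ : ℝ} (hμ : 0 < μ) (s : ℝ) : 0 ≤ polytropeConj μ s :=
  mul_nonneg (div_nonneg (polytropeCoeff_pos hμ).le (by linarith))
    (Real.rpow_nonneg (le_max_right _ _) _)

lemma polytropeInv_of_nonpos {μ s : ℝ} (hμ : 0 < μ) (hs : s ≤ 0) : polytropeInv μ s = 0 := by
  rw [polytropeInv, max_eq_right hs, Real.zero_rpow hμ.ne', mul_zero]

lemma polytropeConj_of_nonpos {μ s : ℝ} (hμ : 0 < μ) (hs : s ≤ 0) : polytropeConj μ s = 0 := by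
  rw [polytropeConj, max_eq_right hs, Real.zero_rpow (by linarith), mul_zero]

lemma polytropeInv_pos {μ s : ℝ} (hμ : 0 < μ) (hs : 0 < s) : 0 < polytropeInv μ s :=
  mul_pos (polytropeCoeff_pos hμ) (Real.rpow_pos_of_pos (lt_max_of_lt_left hs) _)

lemma continuous_polytropeInv {μ : ℝ} (hμ : 0 < μ) : Continuous (polytropeInv μ) :=
  continuous_const.mul (continuous_max_rpow hμ.le)

lemma continuous_polytropeConj {μ : ℝ} (hμ : 0 < μ) : Continuous (polytropeConj μ) :=
  continuous_const.mul (continuous_max_rpow (by linarith))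

lemma polytropeInv_rpow_inv {μ s : ℝ} (hμ : 0 < μ) (hs : 0 < s) :
    polytropeInv μ s ^ (1 / μ) = μ / (μ + 1) * s := by
  rw [polytropeInv, max_eq_left hs.le, Real.mul_rpow (polytropeCoeff_pos hμ).le
    (Real.rpow_nonneg hs.le _), polytropeCoeff, ← Real.rpow_mul (by positivity),
    ← Real.rpow_mul hs.le, mul_one_div_cancel hμ.ne', Real.rpow_one, Real.rpow_one]

lemma deriv_polytrope {μ s : ℝ} (hμ : 0 < μ) (hs : 0 < s) :
    deriv (polytrope μ) (polytropeInv μ s) = s := by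
  have h := Real.hasDerivAt_rpow_const (p := 1 + 1 / μ) (x := polytropeInv μ s)
    (Or.inl (polytropeInv_pos hμ hs).ne')
  have h' : HasDerivAt (polytrope μ) _ (polytropeInv μ s) := h
  rw [h'.deriv, add_sub_cancel_left, polytropeInv_rpow_inv hμ hs]
  field_simp

lemma polytrope_polytropeInv {μ : ℝ} (hμ : 0 < μ) (s : ℝ) :
    polytrope μ (polytropeInv μ s) = s * polytropeInv μ s - polytropeConj μ s := by
  rcases le_or_gt s 0 with hs | hs
  · rw [polytropeInv_of_nonpos hμ hs, polytropeConj_of_nonpos hμ hs, polytrope,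
      Real.zero_rpow (by positivity)]
    ring
  · have h0 := polytropeInv_pos hμ hs
    rw [polytrope, Real.rpow_add h0, Real.rpow_one, polytropeInv_rpow_inv hμ hs, polytropeConj,
      polytropeInv, max_eq_left hs.le, Real.rpow_add hs, Real.rpow_one]
    field_simp
    ring

/-- Strict Bernoulli with exponent 1 + 1/μ at the ratio f/g, where g is the value giving equality.
For s ≤ 0 that value is 0 and positivity of the power suffices. -/
lemma polytrope_young_lt {μ : ℝ} (hμ : 0 < μ) {f : ℝ} (hf : 0 ≤ f) {s : ℝ}
    (hne : f ≠ polytropeInv μ s) : 0 < polytrope μ f - s * f + polytropeConj μ s := by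
  rcases le_or_gt s 0 with hs | hs
  · rw [polytropeInv_of_nonpos hμ hs] at hne
    have hf0 : 0 < f := lt_of_le_of_ne hf hne.symm
    rw [polytropeConj_of_nonpos hμ hs, polytrope]
    have := Real.rpow_pos_of_pos hf0 (1 + 1 / μ)
    nlinarith
  · set g := polytropeInv μ s with hg
    have hg0 : 0 < g := polytropeInv_pos hμ hs
    have hconj := polytrope_polytropeInv hμ s
    rw [← hg] at hconj
    have hx : f / g - 1 ≠ 0 := fun h => hne ((div_eq_one_iff_eq hg0.ne').1 (by linarith))
    have hb := one_add_mul_self_lt_rpow_one_add (s := f / g - 1)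
      (by have := div_nonneg hf hg0.le; linarith) hx (p := 1 + 1 / μ)
      (by have : 0 < 1 / μ := by positivity
          linarith)
    rw [add_sub_cancel, Real.div_rpow hf hg0.le, lt_div_iff₀ (Real.rpow_pos_of_pos hg0 _)] at hb
    have hgq : g ^ (1 + 1 / μ) = g * (μ / (μ + 1) * s) := by
      rw [Real.rpow_add hg0, Real.rpow_one, hg, polytropeInv_rpow_inv hμ hs]
    have e : (1 + (1 + 1 / μ) * (f / g - 1)) * g ^ (1 + 1 / μ) = polytrope μ g + s * (f - g) := by
      rw [polytrope, hgq]
      field_simp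
    rw [e, hconj] at hb
    rw [show polytrope μ f = f ^ (1 + 1 / μ) from rfl]
    linarith

lemma polytrope_young {μ : ℝ} (hμ : 0 < μ) {f : ℝ} (hf : 0 ≤ f) (s : ℝ) :
    0 ≤ polytrope μ f - s * f + polytropeConj μ s := by
  by_cases h : f = polytropeInv μ s
  · rw [h, polytrope_polytropeInv hμ]; linarith
  · exact (polytrope_young_lt hμ hf h).le

/-- Young's inequality at t, tested with the value that is optimal for s: the conjugate lies above
its tangents. -/
lemma polytropeConj_tangent {μ : ℝ} (hμ : 0 < μ) (s t : ℝ) :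
    polytropeConj μ s + polytropeInv μ s * (t - s) ≤ polytropeConj μ t := by
  have h := polytrope_young hμ (polytropeInv_nonneg hμ s) t
  rw [polytrope_polytropeInv hμ] at h
  linarith

lemma hasCompactSupport_velocity {g : ℝ → ℝ} (hg : ∀ s, s ≤ 0 → g s = 0) (l : ℝ) :
    HasCompactSupport fun v : R3 => g (l - 1 / 2 * ‖v‖ ^ 2) := by
  refine HasCompactSupport.intro (isCompact_closedBall (0 : R3) (|2 * l| + 1)) fun v hv => hg _ ?_
  rw [mem_closedBall_zero_iff, not_le] at hv
  have := le_abs_self (2 * l)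
  nlinarith [abs_nonneg (2 * l)]

lemma integrable_velocity {g : ℝ → ℝ} (hc : Continuous g) (hg : ∀ s, s ≤ 0 → g s = 0) (l : ℝ) :
    Integrable fun v : R3 => g (l - 1 / 2 * ‖v‖ ^ 2) :=
  (by fun_prop : Continuous fun v : R3 => g (l - 1 / 2 * ‖v‖ ^ 2)).integrable_of_hasCompactSupport
    (hasCompactSupport_velocity hg l)

/-- The dilation v ↦ √l v contributes l^a from the integrand and l^{3/2} from the volume. -/
lemma integral_velocity_rpow {a : ℝ} (ha : 0 < a) (l : ℝ) :
    ∫ v : R3, (max (l - 1 / 2 * ‖v‖ ^ 2) 0) ^ a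
      = (max l 0) ^ (a + 3 / 2) * ∫ v : R3, (max (1 - 1 / 2 * ‖v‖ ^ 2) 0) ^ a := by
  rcases le_or_gt l 0 with hl | hl
  · rw [max_eq_right hl, Real.zero_rpow (by linarith), zero_mul]
    refine integral_eq_zero_of_ae (Eventually.of_forall fun v => ?_)
    have : l - 1 / 2 * ‖v‖ ^ 2 ≤ 0 := by nlinarith [sq_nonneg ‖v‖]
    simp only [max_eq_right this, Real.zero_rpow ha.ne', Pi.zero_apply]
  · have h := Measure.integral_comp_smul (volume : Measure R3)
      (fun v : R3 => (max (l - 1 / 2 * ‖v‖ ^ 2) 0) ^ a) (√l)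
    have h1 : ∀ v : R3, (max (l - 1 / 2 * ‖√l • v‖ ^ 2) 0) ^ a
        = l ^ a * (max (1 - 1 / 2 * ‖v‖ ^ 2) 0) ^ a := by
      intro v
      rw [norm_smul, Real.norm_of_nonneg (Real.sqrt_nonneg l), mul_pow, Real.sq_sqrt hl.le,
        show l - 1 / 2 * (l * ‖v‖ ^ 2) = l * (1 - 1 / 2 * ‖v‖ ^ 2) by ring,
        show max (l * (1 - 1 / 2 * ‖v‖ ^ 2)) 0 = l * max (1 - 1 / 2 * ‖v‖ ^ 2) 0 by
          rw [mul_max_of_nonneg _ _ hl.le, mul_zero],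
        Real.mul_rpow hl.le (le_max_right _ _)]
    have h3 : Module.finrank ℝ R3 = 3 := by simp
    have h4 : √l ^ 3 = l ^ (3 / 2 : ℝ) := by
      rw [Real.sqrt_eq_rpow, ← Real.rpow_natCast, ← Real.rpow_mul hl.le]; norm_num
    have h5 : 0 < l ^ (3 / 2 : ℝ) := Real.rpow_pos_of_pos hl _
    simp only [h1] at h
    rw [integral_const_mul, h3, h4, abs_of_pos (inv_pos.2 h5), smul_eq_mul] at h
    rw [max_eq_left hl.le, Real.rpow_add hl, mul_comm (l ^ a), mul_assoc, h]
    field_simp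

/-- The constant in the pressure law `∫ Q*(λ - v²/2) dv = C (λ₊)^{μ+5/2}`. -/
noncomputable def pressureConst (μ : ℝ) : ℝ := ∫ v : R3, polytropeConj μ (1 - 1 / 2 * ‖v‖ ^ 2)

lemma pressureConst_pos {μ : ℝ} (hμ : 0 < μ) : 0 < pressureConst μ := by
  have hc := continuous_polytropeConj hμ
  refine Continuous.integral_pos_of_hasCompactSupport_nonneg_nonzero (x := 0) (by fun_prop)
    (hasCompactSupport_velocity (fun s hs => polytropeConj_of_nonpos hμ hs) 1)
    (fun v => polytropeConj_nonneg hμ _) ?_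
  have : 0 < polytropeConj μ 1 := mul_pos (div_pos (polytropeCoeff_pos hμ) (by linarith))
    (Real.rpow_pos_of_pos (by simp) _)
  simpa using this.ne'

lemma integral_polytropeConj {μ : ℝ} (hμ : 0 < μ) (l : ℝ) :
    ∫ v : R3, polytropeConj μ (l - 1 / 2 * ‖v‖ ^ 2)
      = pressureConst μ * (max l 0) ^ (μ + 5 / 2) := by
  simp only [pressureConst, polytropeConj, integral_const_mul]
  rw [integral_velocity_rpow (by linarith) l, show μ + 1 + 3 / 2 = μ + 5 / 2 by ring]
  ring

/-- The density is the derivative of the pressure. Instead of differentiating under the integral,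
the integrated tangent inequality shows that pressure minus tangent has a minimum at l = 1, so the
slopes agree there; scaling gives the other l. -/
lemma integral_polytropeInv {μ : ℝ} (hμ : 0 < μ) (l : ℝ) :
    ∫ v : R3, polytropeInv μ (l - 1 / 2 * ‖v‖ ^ 2)
      = (μ + 5 / 2) * pressureConst μ * (max l 0) ^ (μ + 3 / 2) := by
  have hone : ∫ v : R3, polytropeInv μ (1 - 1 / 2 * ‖v‖ ^ 2)
      = (μ + 5 / 2) * pressureConst μ := by
    set I := ∫ v : R3, polytropeInv μ (1 - 1 / 2 * ‖v‖ ^ 2) with hI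
    have hconj := fun l => integrable_velocity (continuous_polytropeConj hμ)
      (fun s hs => polytropeConj_of_nonpos hμ hs) l
    have hinv := fun l => integrable_velocity (continuous_polytropeInv hμ)
      (fun s hs => polytropeInv_of_nonpos hμ hs) l
    have htan : ∀ x, pressureConst μ + I * (x - 1) ≤ pressureConst μ * (max x 0) ^ (μ + 5 / 2) := by
      intro x
      rw [← integral_polytropeConj hμ x, hI, pressureConst, ← integral_mul_const,
        ← integral_add (hconj 1) ((hinv 1).mul_const _)]
      refine integral_mono ((hconj 1).add ((hinv 1).mul_const _)) (hconj x) fun v => ?_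
      have := polytropeConj_tangent hμ (1 - 1 / 2 * ‖v‖ ^ 2) (x - 1 / 2 * ‖v‖ ^ 2)
      rwa [show x - 1 / 2 * ‖v‖ ^ 2 - (1 - 1 / 2 * ‖v‖ ^ 2) = x - 1 by ring] at this
    have hmin : IsLocalMin (fun x : ℝ => pressureConst μ * x ^ (μ + 5 / 2) - I * (x - 1)) 1 := by
      filter_upwards [Ioi_mem_nhds one_pos] with x hx
      have := htan x
      rw [max_eq_left (le_of_lt hx)] at this
      simp only [Real.one_rpow, sub_self, mul_zero, mul_one, sub_zero]
      linarith
    have hd : HasDerivAt (fun x : ℝ => pressureConst μ * x ^ (μ + 5 / 2) - I * (x - 1))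
        (pressureConst μ * ((μ + 5 / 2) * 1 ^ (μ + 5 / 2 - 1)) - I * 1) 1 :=
      ((Real.hasDerivAt_rpow_const (Or.inl one_ne_zero)).const_mul _).sub
        (((hasDerivAt_id (1 : ℝ)).sub_const 1).const_mul I)
    have := hmin.hasDerivAt_eq_zero hd
    rw [Real.one_rpow] at this
    linarith
  rw [← hone]
  simp only [polytropeInv, integral_const_mul]
  rw [integral_velocity_rpow hμ l]
  ring

/-! ### Radial densities of members of `F_M` -/

/-- `h` is a radial version of the spatial density of `f`. -/
structure IsRadialDensity (f : R3 × R3 → ℝ) (h : ℝ → ℝ) : Prop where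
  measurable : Measurable h
  nonneg : ∀ r, 0 ≤ h r
  eq_zero : ∀ r, r ≤ 0 → h r = 0
  density_eq : density f =ᵐ[volume] fun x => h ‖x‖
  integrable : Integrable fun x : R3 => h ‖x‖

lemma MeasureTheory.Integrable.integrable_density {f : R3 × R3 → ℝ} (hf : Integrable f) :
    Integrable (density f) :=
  Integrable.integral_prod_left (f := f) (by simpa [Measure.volume_eq_prod] using hf)

lemma MemF.density_invariant {Q : ℝ → ℝ} {M : ℝ} {f : R3 × R3 → ℝ} (hf : MemF Q M f)
    (A : R3 ≃ₗᵢ[ℝ] R3) (hA : LinearMap.det (A.toLinearEquiv : R3 →ₗ[ℝ] R3) = 1) :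
    ∀ᵐ x, density f (A x) = density f x := by
  have h := hf.symmetric A hA
  rw [Measure.volume_eq_prod] at h
  filter_upwards [Measure.ae_ae_of_ae_prod h] with x hx
  rw [density, density, ← A.measurePreserving.integral_comp A.toHomeomorph.measurableEmbedding
    (fun v => f (A x, v))]
  exact integral_congr_ae hx

lemma MemF.density_nonneg {Q : ℝ → ℝ} {M : ℝ} {f : R3 × R3 → ℝ} (hf : MemF Q M f) :
    ∀ᵐ x, 0 ≤ density f x := by
  have h := hf.nonneg
  rw [Measure.volume_eq_prod] at h
  filter_upwards [Measure.ae_ae_of_ae_prod h] with x hx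
  exact integral_nonneg_of_ae hx

lemma ae_norm_pos : ∀ᵐ x : R3, 0 < ‖x‖ := by
  filter_upwards [compl_mem_ae_iff.2 (measure_singleton (0 : R3))] with x hx
  exact norm_pos_iff.2 hx

lemma ae_prod_norm_pos : ∀ᵐ z : R3 × R3, 0 < ‖z.1‖ := by
  rw [Measure.volume_eq_prod]
  exact Measure.quasiMeasurePreserving_fst.ae ae_norm_pos

lemma MemF.exists_isRadialDensity {Q : ℝ → ℝ} {M : ℝ} {f : R3 × R3 → ℝ} (hf : MemF Q M f) :
    ∃ h, IsRadialDensity f h := by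
  obtain ⟨h, hm, hh⟩ := exists_radial_of_rotation_invariant hf.integrable.integrable_density
    hf.density_invariant
  have heq : density f =ᵐ[volume] fun x => (Ioi (0 : ℝ)).indicator (fun r => max (h r) 0) ‖x‖ := by
    filter_upwards [hh, hf.density_nonneg, ae_norm_pos] with x hx hx0 hxn
    rw [indicator_of_mem (show ‖x‖ ∈ Ioi 0 from hxn), ← hx, max_eq_left hx0]
  -- Making the radial version nonnegative and cutting it off at r ≤ 0 changes the spatial density
  -- only on a null set, and makes the shell density integrable on all of ℝ.
  refine ⟨(Ioi (0 : ℝ)).indicator fun r => max (h r) 0,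
    (hm.max measurable_const).indicator measurableSet_Ioi, fun r => ?_, fun r hr => ?_, heq,
    hf.integrable.integrable_density.congr heq⟩
  · exact indicator_nonneg (fun _ _ => le_max_right _ _) _
  · exact indicator_of_notMem (show r ∉ Ioi 0 from not_lt.2 hr) _

namespace IsRadialDensity

variable {f : R3 × R3 → ℝ} {h : ℝ → ℝ}

lemma potential_eq (hh : IsRadialDensity f h) (x : R3) :
    potential f x = -radialPotential h ‖x‖ := by
  rw [potential, radialPotential, ← integral_newton hh.measurable hh.nonneg]
  congr 1
  refine integral_congr_ae ?_
  filter_upwards [hh.density_eq] with y hy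
  rw [hy]

lemma integrable_shell (hh : IsRadialDensity f h) :
    Integrable fun s : ℝ => 4 * Real.pi * s ^ 2 * h s := by
  have h1 := integrable_radial_iff.1 hh.integrable
  rw [← integrableOn_univ]
  refine h1.of_forall_sdiff_eq_zero MeasurableSet.univ fun r hr => ?_
  rw [hh.eq_zero r (not_lt.1 hr.2), mul_zero]

lemma shell_nonneg (hh : IsRadialDensity f h) (s : ℝ) : 0 ≤ 4 * Real.pi * s ^ 2 * h s :=
  mul_nonneg (by positivity) (hh.nonneg s)

lemma continuous_radialMass (hh : IsRadialDensity f h) : Continuous (radialMass h) :=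
  intervalIntegral.continuous_primitive (fun _ _ => hh.integrable_shell.intervalIntegrable) 0

lemma monotone_radialMass (hh : IsRadialDensity f h) : Monotone (radialMass h) := by
  intro a b hab
  have := intervalIntegral.integral_interval_sub_left
    (hh.integrable_shell.intervalIntegrable (a := 0) (b := b))
    (hh.integrable_shell.intervalIntegrable (a := 0) (b := a))
  rw [← sub_nonneg, radialMass, radialMass, this]
  exact intervalIntegral.integral_nonneg hab fun s _ => hh.shell_nonneg s

lemma radialMass_nonneg (hh : IsRadialDensity f h) {r : ℝ} (hr : 0 ≤ r) : 0 ≤ radialMass h r := by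
  have := hh.monotone_radialMass hr
  rwa [show radialMass h 0 = 0 from intervalIntegral.integral_same] at this

lemma integral_eq {Q : ℝ → ℝ} {M : ℝ} (hf : MemF Q M f) (hh : IsRadialDensity f h) :
    ∫ s in Ioi (0 : ℝ), 4 * Real.pi * s ^ 2 * h s = M := by
  rw [← integral_radial, ← integral_congr_ae hh.density_eq, ← hf.mass, Measure.volume_eq_prod,
    integral_prod f (by simpa [Measure.volume_eq_prod] using hf.integrable)]
  rfl

lemma tendsto_radialMass {Q : ℝ → ℝ} {M : ℝ} (hf : MemF Q M f) (hh : IsRadialDensity f h) :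
    Tendsto (radialMass h) atTop (𝓝 M) := by
  rw [← hh.integral_eq hf]
  exact intervalIntegral_tendsto_integral_Ioi 0 hh.integrable_shell.integrableOn tendsto_id

lemma radialMass_le {Q : ℝ → ℝ} {M : ℝ} (hf : MemF Q M f) (hh : IsRadialDensity f h) (r : ℝ) :
    radialMass h r ≤ M :=
  hh.monotone_radialMass.ge_of_tendsto (hh.tendsto_radialMass hf) r

end IsRadialDensity

/-! ### Young's inequality integrated over shells -/

/-- The energy density in phase space. -/
noncomputable def energyDensity (μ : ℝ) (f : R3 × R3 → ℝ) (z : R3 × R3) : ℝ :=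
  polytrope μ (f z) + 1 / 2 * (‖z.2‖ ^ 2 * f z)

lemma MemF.integrable_energyDensity {μ M : ℝ} {f : R3 × R3 → ℝ} (hf : MemF (polytrope μ) M f) :
    Integrable (energyDensity μ f) :=
  hf.casimir_finite.add (hf.kinetic_finite.const_mul _)

lemma MemF.functionalJ_eq {μ M : ℝ} {f : R3 × R3 → ℝ} (hf : MemF (polytrope μ) M f) :
    functionalJ (polytrope μ) f = ∫ z, energyDensity μ f z := by
  rw [functionalJ, ← integral_const_mul]
  exact (integral_add hf.casimir_finite (hf.kinetic_finite.const_mul _)).symm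

lemma MemF.energyDensity_nonneg {μ M : ℝ} {f : R3 × R3 → ℝ} (hf : MemF (polytrope μ) M f) :
    ∀ᵐ z, 0 ≤ energyDensity μ f z := by
  filter_upwards [hf.nonneg] with z hz
  exact add_nonneg (Real.rpow_nonneg hz _)
    (mul_nonneg (by norm_num) (mul_nonneg (sq_nonneg _) hz))

/-- The nonnegative deficit in Young's inequality with multiplier `l - v²/2`. -/
noncomputable def youngDeficit (μ : ℝ) (f : R3 × R3 → ℝ) (l : ℝ → ℝ) (z : R3 × R3) : ℝ :=
  energyDensity μ f z - l ‖z.1‖ * f z + polytropeConj μ (l ‖z.1‖ - 1 / 2 * ‖z.2‖ ^ 2)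

lemma youngDeficit_nonneg {μ : ℝ} (hμ : 0 < μ) {f : R3 × R3 → ℝ} (l : ℝ → ℝ) {z : R3 × R3}
    (hz : 0 ≤ f z) : 0 ≤ youngDeficit μ f l z := by
  have := polytrope_young hμ hz (l ‖z.1‖ - 1 / 2 * ‖z.2‖ ^ 2)
  rw [youngDeficit, energyDensity]
  linarith

lemma eq_of_youngDeficit_eq_zero {μ : ℝ} (hμ : 0 < μ) {f : R3 × R3 → ℝ} {l : ℝ → ℝ} {z : R3 × R3}
    (hz : 0 ≤ f z) (h : youngDeficit μ f l z = 0) :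
    f z = polytropeInv μ (l ‖z.1‖ - 1 / 2 * ‖z.2‖ ^ 2) := by
  by_contra hne
  have := polytrope_young_lt hμ hz hne
  rw [youngDeficit, energyDensity] at h
  linarith

lemma youngDeficit_eq_zero {μ : ℝ} (hμ : 0 < μ) {f : R3 × R3 → ℝ} {l : ℝ → ℝ} {z : R3 × R3}
    (h : f z = polytropeInv μ (l ‖z.1‖ - 1 / 2 * ‖z.2‖ ^ 2)) : youngDeficit μ f l z = 0 := by
  rw [youngDeficit, energyDensity, h, polytrope_polytropeInv hμ]
  ring

/-- The set of phase space points with radius in `]a,b]`. -/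
def phaseShell (a b : ℝ) : Set (R3 × R3) := (fun z => ‖z.1‖) ⁻¹' Ioc a b

lemma measurableSet_phaseShell (a b : ℝ) : MeasurableSet (phaseShell a b) :=
  (by fun_prop : Measurable fun z : R3 × R3 => ‖z.1‖) measurableSet_Ioc

lemma phaseShell_eq_prod (a b : ℝ) :
    phaseShell a b = ((fun x : R3 => ‖x‖) ⁻¹' Ioc a b) ×ˢ (univ : Set R3) := by
  ext z; simp [phaseShell]

/-- The multiplier used later carries a factor 1/r, so bounds are available only on shells away from
0. There the conjugate is dominated by its value for the constant K, a product of integrable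
functions. -/
lemma integrableOn_conj_shell {μ : ℝ} (hμ : 0 < μ) {l : ℝ → ℝ} (hl : Measurable l) {a b K : ℝ}
    (hK : ∀ r ∈ Ioc a b, |l r| ≤ K) :
    IntegrableOn (fun z : R3 × R3 => polytropeConj μ (l ‖z.1‖ - 1 / 2 * ‖z.2‖ ^ 2))
      (phaseShell a b) := by
  have hc := (continuous_polytropeConj hμ).measurable
  have hS : MeasurableSet ((fun x : R3 => ‖x‖) ⁻¹' Ioc a b) := measurable_norm measurableSet_Ioc
  have h1 : Integrable fun z : R3 × R3 => (((fun x : R3 => ‖x‖) ⁻¹' Ioc a b).indicator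
      (fun _ => (1 : ℝ)) z.1) * polytropeConj μ (K - 1 / 2 * ‖z.2‖ ^ 2) := by
    rw [Measure.volume_eq_prod]
    refine Integrable.mul_prod ?_ (integrable_velocity (continuous_polytropeConj hμ)
      (fun s hs => polytropeConj_of_nonpos hμ hs) K)
    rw [integrable_indicator_iff hS]
    refine integrableOn_const ?_
    refine ((measure_mono (t := Metric.closedBall 0 b) fun x hx => ?_).trans_lt
      measure_closedBall_lt_top).ne
    rw [mem_closedBall_zero_iff]
    exact hx.2
  refine h1.integrableOn.mono' (Measurable.aestronglyMeasurable (by fun_prop)) ?_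
  refine (ae_restrict_iff' (measurableSet_phaseShell a b)).2 (Eventually.of_forall fun z hz => ?_)
  rw [indicator_of_mem (show z.1 ∈ (fun x : R3 => ‖x‖) ⁻¹' Ioc a b from hz), one_mul,
    Real.norm_of_nonneg (polytropeConj_nonneg hμ _), polytropeConj, polytropeConj]
  have h2 := (le_abs_self _).trans (hK _ hz)
  have := (polytropeCoeff_pos hμ).le
  gcongr

lemma integral_conj_shell {μ : ℝ} (hμ : 0 < μ) {l : ℝ → ℝ} (hl : Measurable l) {a b K : ℝ}
    (ha : 0 ≤ a) (hab : a ≤ b) (hK : ∀ r ∈ Ioc a b, |l r| ≤ K) :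
    ∫ z in phaseShell a b, polytropeConj μ (l ‖z.1‖ - 1 / 2 * ‖z.2‖ ^ 2)
      = ∫ r in a..b, 4 * Real.pi * r ^ 2 * (pressureConst μ * (max (l r) 0) ^ (μ + 5 / 2)) := by
  have h1 := integrableOn_conj_shell hμ hl hK
  rw [phaseShell_eq_prod, Measure.volume_eq_prod] at *
  rw [setIntegral_prod _ h1, ← setIntegral_radial_Ioc ha hab
    (fun r => pressureConst μ * (max (l r) 0) ^ (μ + 5 / 2))]
  simp only [Measure.restrict_univ, integral_polytropeConj hμ]

lemma integrableOn_mul_shell {l : ℝ → ℝ} (hl : Measurable l) {f : R3 × R3 → ℝ}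
    (hf : Integrable f) {a b K : ℝ} (hK : ∀ r ∈ Ioc a b, |l r| ≤ K) :
    IntegrableOn (fun z : R3 × R3 => l ‖z.1‖ * f z) (phaseShell a b) := by
  refine hf.integrableOn.bdd_mul (c := K) (Measurable.aestronglyMeasurable (by fun_prop)) ?_
  exact (ae_restrict_iff' (measurableSet_phaseShell a b)).2
    (Eventually.of_forall fun z hz => hK _ hz)

lemma integral_mul_shell {l : ℝ → ℝ} (hl : Measurable l) {f : R3 × R3 → ℝ} (hf : Integrable f)
    {h : ℝ → ℝ} (hh : IsRadialDensity f h) {a b K : ℝ} (ha : 0 ≤ a) (hab : a ≤ b)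
    (hK : ∀ r ∈ Ioc a b, |l r| ≤ K) :
    ∫ z in phaseShell a b, l ‖z.1‖ * f z
      = ∫ r in a..b, l r * (4 * Real.pi * r ^ 2 * h r) := by
  have h1 := integrableOn_mul_shell hl hf hK
  rw [phaseShell_eq_prod, Measure.volume_eq_prod] at *
  rw [setIntegral_prod _ h1]
  have h2 : ∫ x in (fun x : R3 => ‖x‖) ⁻¹' Ioc a b, ∫ v in univ, l ‖x‖ * f (x, v)
      = ∫ x in (fun x : R3 => ‖x‖) ⁻¹' Ioc a b, l ‖x‖ * h ‖x‖ := by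
    refine integral_congr_ae (ae_restrict_of_ae ?_)
    filter_upwards [hh.density_eq] with x hx
    rw [Measure.restrict_univ, integral_const_mul, ← hx]
    rfl
  rw [h2, setIntegral_radial_Ioc ha hab (fun r => l r * h r)]
  congr 1; ext r; ring

lemma integrableOn_youngDeficit {μ M : ℝ} (hμ : 0 < μ) {l : ℝ → ℝ} (hl : Measurable l)
    {f : R3 × R3 → ℝ} (hf : MemF (polytrope μ) M f) {a b K : ℝ}
    (hK : ∀ r ∈ Ioc a b, |l r| ≤ K) : IntegrableOn (youngDeficit μ f l) (phaseShell a b) :=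
  (hf.integrable_energyDensity.integrableOn.sub (integrableOn_mul_shell hl hf.integrable hK)).add
    (integrableOn_conj_shell hμ hl hK)

/-- Fubini in the velocity turns f into its radial density and the conjugate into the pressure law,
which reduces the phase space problem to one dimension. -/
lemma integral_youngDeficit {μ M : ℝ} (hμ : 0 < μ) {l : ℝ → ℝ} (hl : Measurable l)
    {f : R3 × R3 → ℝ} (hf : MemF (polytrope μ) M f) {h : ℝ → ℝ} (hh : IsRadialDensity f h)
    {a b K : ℝ} (ha : 0 ≤ a) (hab : a ≤ b) (hK : ∀ r ∈ Ioc a b, |l r| ≤ K) :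
    ∫ z in phaseShell a b, youngDeficit μ f l z
      = (∫ z in phaseShell a b, energyDensity μ f z)
        - (∫ r in a..b, l r * (4 * Real.pi * r ^ 2 * h r))
        + ∫ r in a..b, 4 * Real.pi * r ^ 2 * (pressureConst μ * (max (l r) 0) ^ (μ + 5 / 2)) := by
  have h1 := hf.integrable_energyDensity.integrableOn (s := phaseShell a b)
  have h2 := integrableOn_mul_shell hl hf.integrable hK
  rw [← integral_conj_shell hμ hl ha hab hK, ← integral_mul_shell hl hf.integrable hh ha hab hK,
    ← integral_sub h1 h2]
  exact integral_add (h1.sub h2) (integrableOn_conj_shell hμ hl hK)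

/-! ### The calibration -/

lemma AbsolutelyContinuousOnInterval.comp_lipschitz {f G : ℝ → ℝ} {a b K : ℝ} {s : Set ℝ}
    (hf : AbsolutelyContinuousOnInterval f a b) (hs : MapsTo f (uIcc a b) s) (hK : 0 ≤ K)
    (hG : ∀ x ∈ s, ∀ y ∈ s, |G x - G y| ≤ K * |x - y|) :
    AbsolutelyContinuousOnInterval (fun x => G (f x)) a b := by
  rw [absolutelyContinuousOnInterval_iff] at hf ⊢
  intro ε hε
  -- The denominator K + 1 also covers K = 0.
  obtain ⟨δ, hδ, H⟩ := hf (ε / (K + 1)) (by positivity)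
  refine ⟨δ, hδ, fun E hE hEδ => ?_⟩
  have h1 := H E hE hEδ
  calc ∑ i ∈ Finset.range E.1, dist (G (f (E.2 i).1)) (G (f (E.2 i).2))
      ≤ ∑ i ∈ Finset.range E.1, K * dist (f (E.2 i).1) (f (E.2 i).2) :=
        Finset.sum_le_sum fun i hi => hG _ (hs (hE.1 i hi).1) _ (hs (hE.1 i hi).2)
    _ = K * ∑ i ∈ Finset.range E.1, dist (f (E.2 i).1) (f (E.2 i).2) :=
        (Finset.mul_sum _ _ _).symm
    _ ≤ K * (ε / (K + 1)) := by gcongr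
    _ < (K + 1) * (ε / (K + 1)) := by gcongr; linarith
    _ = ε := by field_simp

lemma primitive_lipschitz_Icc {A : ℝ → ℝ} (hA : Continuous A) (M : ℝ) :
    ∃ K, 0 ≤ K ∧ ∀ x ∈ Icc 0 M, ∀ y ∈ Icc 0 M,
      |(∫ t in (0 : ℝ)..x, A t) - ∫ t in (0 : ℝ)..y, A t| ≤ K * |x - y| := by
  obtain ⟨K, hK⟩ := isCompact_Icc.exists_bound_of_continuousOn (s := Icc 0 M) hA.continuousOn
  refine ⟨max K 0, le_max_right _ _, fun x hx y hy => ?_⟩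
  rw [intervalIntegral.integral_interval_sub_left (hA.intervalIntegrable _ _)
    (hA.intervalIntegrable _ _), ← Real.norm_eq_abs, ← Real.norm_eq_abs]
  refine intervalIntegral.norm_integral_le_of_norm_le_const fun t ht => ?_
  exact (hK t ((convex_Icc 0 M).ordConnected.uIcc_subset hy hx (uIoc_subset_uIcc ht))).trans
    (le_max_left _ _)

/-- The fundamental theorem of calculus along the mass function of a radial density. -/
lemma integral_calibration {f : R3 × R3 → ℝ} {h : ℝ → ℝ} (hh : IsRadialDensity f h)
    {A B : ℝ → ℝ} (hA : Continuous A) (hB : Continuous B) {a b : ℝ} (ha : 0 < a) (hab : a ≤ b) :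
    (∫ r in a..b, (A (radialMass h r) + B (radialMass h r) / r) * (4 * Real.pi * r ^ 2 * h r)
        - (∫ t in (0 : ℝ)..radialMass h r, B t) / r ^ 2)
      = ((∫ t in (0 : ℝ)..radialMass h b, A t) + (∫ t in (0 : ℝ)..radialMass h b, B t) / b)
        - ((∫ t in (0 : ℝ)..radialMass h a, A t)
          + (∫ t in (0 : ℝ)..radialMass h a, B t) / a) := by
  set m := radialMass h with hm
  set F : ℝ → ℝ := fun x => ∫ t in (0 : ℝ)..x, A t with hF
  set G : ℝ → ℝ := fun x => ∫ t in (0 : ℝ)..x, B t with hG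
  have hb : 0 < b := ha.trans_le hab
  -- The mass is only absolutely continuous, as h is only integrable. The primitives of A and B are
  -- Lipschitz on [0, m(b)], so the composites stay absolutely continuous and an almost everywhere
  -- derivative suffices.
  have hmac : AbsolutelyContinuousOnInterval m a b :=
    ((hh.integrable_shell.intervalIntegrable (a := 0)
      (b := b)).absolutelyContinuousOnInterval_intervalIntegral (c := 0) (by simp)).mono (by
        rw [uIcc_of_le hab, uIcc_of_le hb.le]
        exact Icc_subset_Icc_left ha.le)
  have hmaps : MapsTo m (uIcc a b) (Icc 0 (m b)) := fun x hx => by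
    rw [uIcc_of_le hab] at hx
    exact ⟨hh.radialMass_nonneg (ha.le.trans hx.1), hh.monotone_radialMass hx.2⟩
  obtain ⟨KA, hKA0, hKA⟩ := primitive_lipschitz_Icc hA (m b)
  obtain ⟨KB, hKB0, hKB⟩ := primitive_lipschitz_Icc hB (m b)
  have hFac := hmac.comp_lipschitz hmaps hKA0 hKA
  have hGac := hmac.comp_lipschitz hmaps hKB0 hKB
  have hinv : AbsolutelyContinuousOnInterval (fun r : ℝ => r⁻¹) a b := by
    refine ContDiffOn.absolutelyContinuousOnInterval (contDiffOn_id.inv fun x hx => ?_)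
    rw [uIcc_of_le hab] at hx
    exact (ha.trans_le hx.1).ne'
  have hac := hFac.add (hGac.mul hinv)
  have key := hac.integral_deriv_eq_sub
  have hder : ∀ᵐ r, r ∈ uIoc a b → deriv ((fun x => F (m x)) + (fun x => G (m x)) * fun r => r⁻¹) r
      = (A (m r) + B (m r) / r) * (4 * Real.pi * r ^ 2 * h r) - G (m r) / r ^ 2 := by
    filter_upwards [LocallyIntegrable.ae_hasDerivAt_integral
      hh.integrable_shell.locallyIntegrable] with r hr hrab
    rw [uIoc_of_le hab] at hrab
    have hr0 : r ≠ 0 := (ha.trans hrab.1).ne'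
    have hmr : HasDerivAt m (4 * Real.pi * r ^ 2 * h r) r := hr 0
    have hF' : HasDerivAt F (A (m r)) (m r) := intervalIntegral.integral_hasDerivAt_right
      (hA.intervalIntegrable _ _) (hA.stronglyMeasurableAtFilter _ _) hA.continuousAt
    have hG' : HasDerivAt G (B (m r)) (m r) := intervalIntegral.integral_hasDerivAt_right
      (hB.intervalIntegrable _ _) (hB.stronglyMeasurableAtFilter _ _) hB.continuousAt
    have h1 := (hF'.comp r hmr).add ((hG'.comp r hmr).mul (hasDerivAt_inv hr0))
    refine h1.deriv.trans ?_
    simp only [Function.comp]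
    field_simp
    ring
  rw [intervalIntegral.integral_congr_ae hder] at key
  rw [key]
  simp only [Pi.add_apply, Pi.mul_apply, div_eq_mul_inv]

/-! ### The mass coordinate and the Hamilton-Jacobi inequality -/

/-- `σ` inverts the mass function of the profile `φ` on `[0,R]`. -/
structure IsMassInverse (p c M R : ℝ) (φ σ : ℝ → ℝ) : Prop where
  continuous : Continuous σ
  mem : ∀ m ∈ Icc 0 M, σ m ∈ Icc 0 R
  right : ∀ m ∈ Icc 0 M, emdenMass p c φ (σ m) = m
  left : ∀ s ∈ Icc 0 R, σ (emdenMass p c φ s) = s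

namespace IsStellarProfile

variable {p c M R : ℝ} {φ : ℝ → ℝ}

lemma strictAntiOn (hS : IsStellarProfile p c M R φ) (hp : 0 ≤ p) (hc : 0 < c) :
    StrictAntiOn φ (Ici 0) :=
  strictAntiOn_of_emden hp hc hS.continuous hS.center_pos hS.hasDerivAt

lemma pos (hS : IsStellarProfile p c M R φ) (hp : 0 ≤ p) (hc : 0 < c) {r : ℝ} (hr : 0 ≤ r)
    (hrR : r < R) : 0 < φ r := by
  rw [← hS.radius]
  exact hS.strictAntiOn hp hc hr (hr.trans hrR.le : (0 : ℝ) ≤ R) hrR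

lemma nonneg (hS : IsStellarProfile p c M R φ) (hp : 0 ≤ p) (hc : 0 < c) {r : ℝ}
    (hr : r ∈ Icc 0 R) : 0 ≤ φ r := by
  rcases hr.2.eq_or_lt with rfl | h
  · exact hS.radius.ge
  · exact (hS.pos hp hc hr.1 h).le

lemma nonpos (hS : IsStellarProfile p c M R φ) (hp : 0 ≤ p) (hc : 0 < c) {r : ℝ}
    (hr : R ≤ r) : φ r ≤ 0 := by
  rw [← hS.radius]
  exact (hS.strictAntiOn hp hc).antitoneOn hS.radius_pos.le (hS.radius_pos.le.trans hr) hr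

lemma continuous_emdenMass (hS : IsStellarProfile p c M R φ) (hp : 0 ≤ p) :
    Continuous (emdenMass p c φ) := by
  have : Continuous fun s => s ^ 2 * (c * (max (φ s) 0) ^ p) := by
    have := (continuous_max_rpow hp).comp hS.continuous
    simp only [Function.comp_def] at this
    fun_prop
  exact intervalIntegral.continuous_primitive (fun _ _ => this.intervalIntegrable _ _) 0

lemma hasDerivAt_emdenMass (hS : IsStellarProfile p c M R φ) (hp : 0 ≤ p) {r : ℝ} (hr : 0 < r) :
    HasDerivAt (emdenMass p c φ) (r ^ 2 * (c * (max (φ r) 0) ^ p)) r :=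
  _root_.hasDerivAt_emdenMass hp hS.continuous.continuousOn hr

lemma strictMonoOn_emdenMass (hS : IsStellarProfile p c M R φ) (hp : 0 ≤ p) (hc : 0 < c) :
    StrictMonoOn (emdenMass p c φ) (Icc 0 R) := by
  refine strictMonoOn_of_deriv_pos (convex_Icc 0 R) (hS.continuous_emdenMass hp).continuousOn
    fun r hr => ?_
  rw [interior_Icc] at hr
  have hr0 : 0 < r := hr.1
  rw [(hS.hasDerivAt_emdenMass hp hr.1).deriv]
  have := Real.rpow_pos_of_pos
    (lt_max_of_lt_left (hS.pos hp hc hr.1.le hr.2) : 0 < max (φ r) 0) p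
  positivity

lemma emdenMass_mem (hS : IsStellarProfile p c M R φ) (hp : 0 ≤ p) (hc : 0 < c) {r : ℝ}
    (hr : r ∈ Icc 0 R) : emdenMass p c φ r ∈ Icc 0 M := by
  have h0 : emdenMass p c φ 0 = 0 := intervalIntegral.integral_same
  have hmono := (hS.strictMonoOn_emdenMass hp hc).monotoneOn
  refine ⟨?_, ?_⟩
  · rw [← h0]; exact hmono ⟨le_rfl, hS.radius_pos.le⟩ hr hr.1
  · rw [← hS.mass]; exact hmono hr ⟨hS.radius_pos.le, le_rfl⟩ hr.2

lemma emdenMass_of_ge (hS : IsStellarProfile p c M R φ) (hp : 0 < p) (hc : 0 < c) {r : ℝ}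
    (hr : R ≤ r) : emdenMass p c φ r = M := by
  have hi := fun x y (hx : (0 : ℝ) ≤ x) (hy : (0 : ℝ) ≤ y) =>
    intervalIntegrable_emdenIntegrand (c := c) hp.le hS.continuous.continuousOn hx hy
  have hr0 := hS.radius_pos.le
  rw [← hS.mass, emdenMass, emdenMass, ← intervalIntegral.integral_add_adjacent_intervals
    (hi 0 R le_rfl hr0) (hi R r hr0 (hr0.trans hr)), add_eq_left]
  refine intervalIntegral.integral_zero_ae (Eventually.of_forall fun s hs => ?_)
  rw [uIoc_of_le hr] at hs
  rw [max_eq_right (hS.nonpos hp.le hc hs.1.le), Real.zero_rpow hp.ne']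
  ring

/-- The mass function on [0,R] is continued with slope one to an increasing bijection of ℝ. Its
inverse is then continuous everywhere, so the calibration slopes need no domain restrictions. -/
lemma exists_isMassInverse (hS : IsStellarProfile p c M R φ) (hp : 0 ≤ p) (hc : 0 < c) :
    ∃ σ, IsMassInverse p c M R φ σ := by
  have hR := hS.radius_pos
  set m := emdenMass p c φ with hm
  let cl : ℝ → ℝ := fun s => max 0 (min s R)
  have hclc : Continuous cl := continuous_const.max (continuous_id.min continuous_const)
  have hclm : ∀ s, cl s ∈ Icc 0 R := fun s =>
    ⟨le_max_left _ _, max_le hR.le (min_le_right _ _)⟩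
  have hcl : ∀ s ∈ Icc 0 R, cl s = s := fun s hs => by
    simp only [cl]; rw [min_eq_left hs.2, max_eq_right hs.1]
  have hcl1 : ∀ s t, s ≤ t → cl s ≤ cl t ∧ s - cl s ≤ t - cl t := by
    intro s t hst
    simp only [cl]
    refine ⟨by gcongr, ?_⟩
    rcases max_cases 0 (min s R) with h1 | h1 <;> rcases max_cases 0 (min t R) with h2 | h2 <;>
      rcases min_cases s R with h3 | h3 <;> rcases min_cases t R with h4 | h4 <;> linarith
  let g : ℝ → ℝ := fun s => m (cl s) + (s - cl s)
  have hgc : Continuous g :=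
    ((hS.continuous_emdenMass hp).comp hclc).add (continuous_id.sub hclc)
  have hmono := hS.strictMonoOn_emdenMass hp hc
  have hg : StrictMono g := by
    intro s t hst
    obtain ⟨h1, h2⟩ := hcl1 s t hst.le
    rcases h1.eq_or_lt with h | h
    · simp only [g, h]; linarith
    · have := hmono (hclm s) (hclm t) h
      simp only [g]; linarith
  have hbd : ∀ s, s - R ≤ g s ∧ g s ≤ M + s := fun s => by
    have h1 := hS.emdenMass_mem hp hc (hclm s)
    have h2 := hclm s
    simp only [g]
    constructor <;> linarith [h1.1, h1.2, h2.1, h2.2]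
  have hsurj : Function.Surjective g := by
    refine hgc.surjective ?_ ?_
    · exact tendsto_atTop_mono (fun s => (hbd s).1)
        (tendsto_atTop_add_const_right atTop (-R) tendsto_id)
    · exact tendsto_atBot_mono (fun s => (hbd s).2)
        (tendsto_atBot_add_const_left atBot M tendsto_id)
  let e := hg.orderIsoOfSurjective g hsurj
  have he : ∀ s, e s = g s := fun s => rfl
  have hleft : ∀ s ∈ Icc 0 R, e.symm (m s) = s := fun s hs => by
    rw [OrderIso.symm_apply_eq, he]
    simp only [g, hcl s hs]; ring
  have hex : ∀ x ∈ Icc 0 M, ∃ s ∈ Icc 0 R, m s = x := fun x hx => by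
    have h := intermediate_value_Icc hR.le (hS.continuous_emdenMass hp).continuousOn
    rw [hS.mass, show emdenMass p c φ 0 = 0 from intervalIntegral.integral_same] at h
    exact h hx
  refine ⟨e.symm, e.symm.continuous, fun x hx => ?_, fun x hx => ?_, hleft⟩
  · obtain ⟨s, hs, rfl⟩ := hex x hx
    rwa [hleft s hs]
  · obtain ⟨s, hs, rfl⟩ := hex x hx
    rw [hleft s hs]

end IsStellarProfile

/-- The slope `-(3-p)/(p+1) φ(σ(m))` of the calibration. -/
noncomputable def calibA (p : ℝ) (φ σ : ℝ → ℝ) (m : ℝ) : ℝ := -((3 - p) / (p + 1)) * φ (σ m)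

/-- The slope `4/(p+1) σ(m) φ(σ(m))` of the calibration. -/
noncomputable def calibB (p : ℝ) (φ σ : ℝ → ℝ) (m : ℝ) : ℝ := 4 / (p + 1) * (σ m * φ (σ m))

/-- The multiplier of the calibration at radius `r` and enclosed mass `m`. -/
noncomputable def calibMultiplier (p : ℝ) (φ σ : ℝ → ℝ) (m r : ℝ) : ℝ :=
  calibA p φ σ m + calibB p φ σ m / r

/-- `N(m) = 4 π C σ⁴ φ(σ)^{p+1}` with `σ = σ(m)`. -/
noncomputable def calibN (p C : ℝ) (φ σ : ℝ → ℝ) (m : ℝ) : ℝ :=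
  4 * Real.pi * C * (σ m ^ 4 * φ (σ m) ^ (p + 1))

/-- The gap in the Hamilton-Jacobi inequality. -/
noncomputable def calibDeficit (p C : ℝ) (φ σ : ℝ → ℝ) (m r : ℝ) : ℝ :=
  calibN p C φ σ m / r ^ 2
    - 4 * Real.pi * r ^ 2 * (C * (max (calibMultiplier p φ σ m r) 0) ^ (p + 1))

namespace IsStellarProfile

variable {p c C M R : ℝ} {φ σ : ℝ → ℝ}

lemma continuous_calibA (hS : IsStellarProfile p c M R φ) (hσ : IsMassInverse p c M R φ σ) :
    Continuous (calibA p φ σ) := by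
  have h1 := hS.continuous
  have h2 := hσ.continuous
  unfold calibA; fun_prop

lemma continuous_calibB (hS : IsStellarProfile p c M R φ) (hσ : IsMassInverse p c M R φ σ) :
    Continuous (calibB p φ σ) := by
  have h1 := hS.continuous
  have h2 := hσ.continuous
  unfold calibB; fun_prop

lemma mass_pos (hS : IsStellarProfile p c M R φ) (hp : 0 ≤ p) (hc : 0 < c) : 0 < M := by
  rw [← hS.mass]
  exact emdenMass_pos hp hc hS.continuous.continuousOn hS.center_pos hS.radius_pos

/-- Both sides vanish at s = 0 and have the derivative 16πC s³ φ^{p+1}: in d/ds of the right side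
the terms containing m cancel, because φ' = -m/s² and c = 4π(p+1)C. -/
lemma integral_calibB_comp (hS : IsStellarProfile p c M R φ) (hσ : IsMassInverse p c M R φ σ)
    (hp : 0 ≤ p) (hc : 0 < c) (hC : c = 4 * Real.pi * ((p + 1) * C)) {s : ℝ}
    (hs : s ∈ Icc 0 R) :
    ∫ t in (0 : ℝ)..emdenMass p c φ s, calibB p φ σ t
      = 4 * Real.pi * C * (s ^ 4 * φ s ^ (p + 1)) + emdenMass p c φ s ^ 2 / 2 := by
  set m := emdenMass p c φ with hm
  have hB := hS.continuous_calibB hσ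
  have hmc := hS.continuous_emdenMass hp
  have hm0 : m 0 = 0 := intervalIntegral.integral_same
  rcases hs.1.eq_or_lt with rfl | hs0
  · rw [hm0]; simp
  set d : ℝ → ℝ := fun s => (∫ t in (0 : ℝ)..m s, calibB p φ σ t)
    - (4 * Real.pi * C * (s ^ 4 * φ s ^ (p + 1)) + m s ^ 2 / 2) with hd
  have hcont : ContinuousOn d (Icc 0 s) := by
    refine Continuous.continuousOn (Continuous.sub ?_ ?_)
    · exact (intervalIntegral.continuous_primitive (fun _ _ => hB.intervalIntegrable _ _) 0).comp hmc
    · have := hS.continuous.rpow_const (p := p + 1) fun _ => Or.inr (by linarith)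
      fun_prop
  have hder : ∀ x ∈ Ioo 0 s, HasDerivAt d 0 x := by
    intro x hx
    have hxR : x < R := hx.2.trans_le hs.2
    have hφx := hS.pos hp hc hx.1.le hxR
    have h1 : HasDerivAt (fun y => ∫ t in (0 : ℝ)..y, calibB p φ σ t) (calibB p φ σ (m x)) (m x) :=
      intervalIntegral.integral_hasDerivAt_right (hB.intervalIntegrable _ _)
        (hB.stronglyMeasurableAtFilter _ _) hB.continuousAt
    have h2 := hS.hasDerivAt_emdenMass hp hx.1
    have h3 := (hS.hasDerivAt x hx.1).rpow_const (p := p + 1) (Or.inl hφx.ne')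
    have h4 := (h1.comp x h2).sub (((((hasDerivAt_pow 4 x).mul h3).const_mul
      (4 * Real.pi * C))).add ((h2.pow 2).div_const 2))
    refine h4.congr_deriv ?_
    have e1 : φ x ^ (p + 1) = φ x ^ p * φ x := by rw [Real.rpow_add hφx, Real.rpow_one]
    have hp1 : p + 1 ≠ 0 := by linarith
    have hx0 := hx.1.ne'
    rw [calibB, hσ.left x ⟨hx.1.le, hxR.le⟩, max_eq_left hφx.le, add_sub_cancel_right, e1, ← hm]
    generalize φ x ^ p = P
    generalize m x = y
    rw [hC]
    simp only [Nat.cast_ofNat, Nat.reduceSub, pow_one]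
    field_simp
    ring
  obtain ⟨x, hx, hx'⟩ := exists_hasDerivAt_eq_slope d (fun _ => 0) hs0 hcont hder
  have hd0 : d 0 = 0 := by simp [hd, hm0]
  rw [eq_comm, div_eq_zero_iff, hd0, sub_zero] at hx'
  rcases hx' with h | h
  · exact sub_eq_zero.1 h
  · linarith

lemma integral_calibB (hS : IsStellarProfile p c M R φ) (hσ : IsMassInverse p c M R φ σ)
    (hp : 0 ≤ p) (hc : 0 < c) (hC : c = 4 * Real.pi * ((p + 1) * C)) {m : ℝ}
    (hm : m ∈ Icc 0 M) :
    ∫ t in (0 : ℝ)..m, calibB p φ σ t = calibN p C φ σ m + m ^ 2 / 2 := by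
  have := hS.integral_calibB_comp hσ hp hc hC (hσ.mem m hm)
  rwa [hσ.right m hm] at this

/-- The coefficient in A is 1 - 4/(p+1), so up to the factor φ(σ) the multiplier is the tangent at x
= 1 of x^{4/(p+1)}, evaluated at x = σ/r. -/
lemma calibMultiplier_eq (hp : 0 ≤ p) {m r : ℝ} :
    calibMultiplier p φ σ m r = φ (σ m) * (1 + 4 / (p + 1) * (σ m / r - 1)) := by
  have hp1 : p + 1 ≠ 0 := by linarith
  rw [calibMultiplier, calibA, calibB]
  field_simp
  ring

lemma rpow_four_div (hp : 0 ≤ p) {x : ℝ} (hx : 0 ≤ x) : (x ^ (4 / (p + 1))) ^ (p + 1) = x ^ 4 := by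
  have hp1 : p + 1 ≠ 0 := by linarith
  rw [← Real.rpow_mul hx, div_mul_cancel₀ _ hp1]
  exact_mod_cast Real.rpow_natCast x 4

lemma calibDeficit_eq (hS : IsStellarProfile p c M R φ) (hσ : IsMassInverse p c M R φ σ)
    (hp : 0 ≤ p) (hc : 0 < c) {m r : ℝ} (hm : m ∈ Icc 0 M) (hr : 0 < r) :
    calibDeficit p C φ σ m r = 4 * Real.pi * C * r ^ 2 *
      ((φ (σ m) * (σ m / r) ^ (4 / (p + 1))) ^ (p + 1)
        - (max (calibMultiplier p φ σ m r) 0) ^ (p + 1)) := by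
  have hs := hσ.mem m hm
  have hφ := hS.nonneg hp hc hs
  have hx : 0 ≤ σ m / r := div_nonneg hs.1 hr.le
  rw [Real.mul_rpow hφ (Real.rpow_nonneg hx _), rpow_four_div hp hx, calibDeficit, calibN]
  field_simp

/-- Bernoulli's inequality for the exponent 4/(p+1), which is at least 1 because p < 3. This is the
convexity behind the whole calibration. -/
lemma calibMultiplier_le (hS : IsStellarProfile p c M R φ) (hσ : IsMassInverse p c M R φ σ)
    (hp : 0 ≤ p) (hp3 : p < 3) (hc : 0 < c) {m r : ℝ} (hm : m ∈ Icc 0 M) (hr : 0 < r) :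
    max (calibMultiplier p φ σ m r) 0 ≤ φ (σ m) * (σ m / r) ^ (4 / (p + 1)) := by
  have hs := hσ.mem m hm
  have hφ := hS.nonneg hp hc hs
  have hx : 0 ≤ σ m / r := div_nonneg hs.1 hr.le
  refine max_le ?_ (mul_nonneg hφ (Real.rpow_nonneg hx _))
  rw [calibMultiplier_eq hp]
  have := one_add_mul_self_le_rpow_one_add (s := σ m / r - 1) (by linarith) (p := 4 / (p + 1))
    (by rw [le_div_iff₀ (by linarith)]; linarith)
  rw [add_sub_cancel] at this
  gcongr

lemma calibDeficit_nonneg (hS : IsStellarProfile p c M R φ) (hσ : IsMassInverse p c M R φ σ)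
    (hp : 0 ≤ p) (hp3 : p < 3) (hc : 0 < c) (hC : 0 < C) {m r : ℝ} (hm : m ∈ Icc 0 M)
    (hr : 0 < r) : 0 ≤ calibDeficit p C φ σ m r := by
  rw [hS.calibDeficit_eq hσ hp hc hm hr]
  have := Real.rpow_le_rpow (le_max_right _ _) (hS.calibMultiplier_le hσ hp hp3 hc hm hr)
    (by linarith : 0 ≤ p + 1)
  have := sub_nonneg.2 this
  positivity

lemma calibDeficit_eq_zero (hS : IsStellarProfile p c M R φ) (hσ : IsMassInverse p c M R φ σ)
    (hp : 0 ≤ p) (hc : 0 < c) {m r : ℝ} (hm : m ∈ Icc 0 M) (hr : 0 < r)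
    (h : φ (σ m) = 0 ∨ σ m = r) : calibDeficit p C φ σ m r = 0 := by
  rw [hS.calibDeficit_eq hσ hp hc hm hr, calibMultiplier_eq hp]
  rcases h with h | h
  · simp [h]
  · have hφ := hS.nonneg hp hc (hσ.mem m hm)
    rw [h] at hφ ⊢
    rw [div_self hr.ne', Real.one_rpow, sub_self, mul_zero, add_zero, mul_one, max_eq_left hφ,
      sub_self, mul_zero]

/-- For 0 < m < M both σ(m) and φ(σ(m)) are positive, so the strict Bernoulli inequality applies
unless σ(m)/r = 1. -/
lemma inv_eq_of_calibDeficit_eq_zero (hS : IsStellarProfile p c M R φ)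
    (hσ : IsMassInverse p c M R φ σ) (hp : 0 ≤ p) (hp3 : p < 3) (hc : 0 < c) (hC : 0 < C)
    {m r : ℝ} (hm : m ∈ Ioo 0 M) (hr : 0 < r) (h : calibDeficit p C φ σ m r = 0) : σ m = r := by
  have hm' : m ∈ Icc 0 M := Ioo_subset_Icc_self hm
  have hs := hσ.mem m hm'
  have h0 : emdenMass p c φ 0 = 0 := intervalIntegral.integral_same
  have hs0 : 0 < σ m := by
    refine lt_of_le_of_ne hs.1 fun he => hm.1.ne ?_
    rw [← hσ.right m hm', ← he, h0]
  have hsR : σ m < R := by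
    refine lt_of_le_of_ne hs.2 fun he => hm.2.ne ?_
    rw [← hσ.right m hm', he, hS.mass]
  have hφ := hS.pos hp hc hs0.le hsR
  have hx : 0 < σ m / r := div_pos hs0 hr
  by_contra hne
  have hx1 : σ m / r - 1 ≠ 0 := fun he => hne ((div_eq_one_iff_eq hr.ne').1 (by linarith))
  have hlt := one_add_mul_self_lt_rpow_one_add (s := σ m / r - 1) (by linarith) hx1
    (p := 4 / (p + 1)) (by rw [lt_div_iff₀ (by linarith)]; linarith)
  rw [add_sub_cancel] at hlt
  have hmax : max (calibMultiplier p φ σ m r) 0 < φ (σ m) * (σ m / r) ^ (4 / (p + 1)) := by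
    refine max_lt ?_ (mul_pos hφ (Real.rpow_pos_of_pos hx _))
    rw [calibMultiplier_eq hp]
    gcongr
  have := Real.rpow_lt_rpow (le_max_right _ _) hmax (by linarith : 0 < p + 1)
  rw [hS.calibDeficit_eq hσ hp hc hm' hr] at h
  have h2 := sub_pos.2 this
  have : 0 < 4 * Real.pi * C * r ^ 2 := by positivity
  exact (mul_pos this h2).ne' h

end IsStellarProfile

/-! ### The energy identity -/

/-- Radial mass functions of elements of `F_M` are `O(r^{3/(p+1)})`. -/
lemma IsRadialDensity.exists_radialMass_le {μ M p : ℝ} (hμ : 0 < μ) (hp : p = μ + 3 / 2)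
    {f : R3 × R3 → ℝ} (hf : MemF (polytrope μ) M f) {h : ℝ → ℝ} (hh : IsRadialDensity f h) :
    ∃ K, 0 ≤ K ∧ ∀ r, 0 < r → radialMass h r ≤ K * r ^ (3 / (p + 1)) := by
  have hC := pressureConst_pos hμ
  have hJ : 0 ≤ ∫ z, energyDensity μ f z := integral_nonneg_of_ae hf.energyDensity_nonneg
  refine ⟨(∫ z, energyDensity μ f z) + 4 * Real.pi * pressureConst μ / 3, by positivity,
    fun r hr => ?_⟩
  -- Young's inequality on the ball with a constant multiplier L; this choice makes L^{p+1} r³ = 1,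
  -- so the conjugate term does not depend on r.
  set L := r ^ (-(3 / (p + 1))) with hL
  have hL0 : 0 < L := Real.rpow_pos_of_pos hr _
  have hp1 : p + 1 ≠ 0 := by linarith
  have hK : ∀ x ∈ Ioc 0 r, |(fun _ : ℝ => L) x| ≤ L := fun x _ => (abs_of_pos hL0).le
  have key := integral_youngDeficit hμ (l := fun _ => L) measurable_const hf hh le_rfl hr.le hK
  have h0 : 0 ≤ ∫ z in phaseShell 0 r, youngDeficit μ f (fun _ => L) z :=
    integral_nonneg_of_ae (ae_restrict_of_ae (by
      filter_upwards [hf.nonneg] with z hz using youngDeficit_nonneg hμ _ hz))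
  have h1 : ∫ z in phaseShell 0 r, energyDensity μ f z ≤ ∫ z, energyDensity μ f z :=
    setIntegral_le_integral hf.integrable_energyDensity hf.energyDensity_nonneg
  have h2 : ∫ x in (0 : ℝ)..r, L * (4 * Real.pi * x ^ 2 * h x) = L * radialMass h r := by
    rw [intervalIntegral.integral_const_mul, radialMass]
  have h3 : ∫ x in (0 : ℝ)..r, 4 * Real.pi * x ^ 2 * (pressureConst μ * (max L 0) ^ (μ + 5 / 2))
      = 4 * Real.pi * pressureConst μ / 3 := by
    have e1 : (max L 0) ^ (μ + 5 / 2) * r ^ 3 = 1 := by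
      rw [max_eq_left hL0.le, hL, ← Real.rpow_mul hr.le, ← Real.rpow_natCast, ← Real.rpow_add hr,
        show μ + 5 / 2 = p + 1 by rw [hp]; ring]
      push_cast
      rw [show -(3 / (p + 1)) * (p + 1) + 3 = 0 by field_simp; ring, Real.rpow_zero]
    rw [intervalIntegral.integral_mul_const, intervalIntegral.integral_const_mul, integral_pow]
    norm_num
    linear_combination (4 * Real.pi * pressureConst μ / 3) * e1
  rw [h2, h3] at key
  have h4 : L * radialMass h r ≤ (∫ z, energyDensity μ f z) + 4 * Real.pi * pressureConst μ / 3 := by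
    linarith
  have h5 : L * r ^ (3 / (p + 1)) = 1 := by
    rw [hL, ← Real.rpow_add hr, neg_add_cancel, Real.rpow_zero]
  have h6 : 0 < r ^ (3 / (p + 1)) := Real.rpow_pos_of_pos hr _
  calc radialMass h r = L * radialMass h r * r ^ (3 / (p + 1)) := by
        linear_combination (-radialMass h r) * h5
    _ ≤ _ := by gcongr

/-- Finiteness of the gravitational energy: near 0 the growth bound gives r^{6/(p+1)-2}, with
exponent above -1, and at infinity m ≤ M gives r⁻². -/
lemma IsRadialDensity.integrableOn_radialMass_sq {μ M p : ℝ} (hμ : 0 < μ) (hp : p = μ + 3 / 2)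
    (hp3 : p < 3) {f : R3 × R3 → ℝ} (hf : MemF (polytrope μ) M f) {h : ℝ → ℝ}
    (hh : IsRadialDensity f h) :
    IntegrableOn (fun r => radialMass h r ^ 2 / r ^ 2) (Ioi 0) := by
  obtain ⟨K, hK0, hK⟩ := hh.exists_radialMass_le hμ hp hf
  have hp0 : 0 < p + 1 := by linarith
  have hcont : ContinuousOn (fun r => radialMass h r ^ 2 / r ^ 2) (Ioi 0) :=
    (hh.continuous_radialMass.pow 2).continuousOn.div (by fun_prop)
      fun r hr => pow_ne_zero 2 (ne_of_gt hr)
  rw [← Ioc_union_Ioi_eq_Ioi (zero_le_one' ℝ)]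
  refine IntegrableOn.union ?_ ?_
  · have h1 : IntegrableOn (fun r : ℝ => K ^ 2 * r ^ (6 / (p + 1) - 2)) (Ioc 0 1) := by
      rw [← intervalIntegrable_iff_integrableOn_Ioc_of_le zero_le_one]
      refine (intervalIntegral.intervalIntegrable_rpow' ?_).const_mul _
      have : 1 < 6 / (p + 1) := by rw [lt_div_iff₀ hp0]; linarith
      linarith
    refine h1.mono' ((hcont.mono fun x hx => hx.1).aestronglyMeasurable measurableSet_Ioc) ?_
    refine (ae_restrict_iff' measurableSet_Ioc).2 (Eventually.of_forall fun r hr => ?_)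
    have hr0 : 0 < r := hr.1
    have hm0 := hh.radialMass_nonneg hr0.le
    rw [Real.norm_of_nonneg (by positivity), div_le_iff₀ (by positivity)]
    have e : r ^ (6 / (p + 1) - 2) * r ^ 2 = (r ^ (3 / (p + 1))) ^ 2 := by
      rw [← Real.rpow_natCast, ← Real.rpow_natCast, ← Real.rpow_add hr0, ← Real.rpow_mul hr0.le]
      congr 1
      push_cast
      ring
    rw [mul_assoc, e, ← mul_pow]
    exact pow_le_pow_left₀ hm0 (hK r hr0) 2
  · have h1 : IntegrableOn (fun r : ℝ => M ^ 2 * r ^ (-2 : ℝ)) (Ioi 1) :=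
      (integrableOn_Ioi_rpow_of_lt (by norm_num) one_pos).const_mul _
    refine h1.mono' ((hcont.mono (Ioi_subset_Ioi zero_le_one)).aestronglyMeasurable
      measurableSet_Ioi) ?_
    refine (ae_restrict_iff' measurableSet_Ioi).2 (Eventually.of_forall fun r hr => ?_)
    have hr0 : 0 < r := Ioi_subset_Ioi zero_le_one hr
    have hm0 := hh.radialMass_nonneg hr0.le
    have hmM := hh.radialMass_le hf r
    rw [Real.norm_of_nonneg (by positivity), Real.rpow_neg hr0.le, ← div_eq_mul_inv, Real.rpow_two]
    exact div_le_div_of_nonneg_right (pow_le_pow_left₀ hm0 hmM 2) (by positivity)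

lemma MemF.functionalD_eq {μ M : ℝ} {f : R3 × R3 → ℝ} (hf : MemF (polytrope μ) M f) {h : ℝ → ℝ}
    (hh : IsRadialDensity f h) :
    functionalD (polytrope μ) f
      = (∫ z, energyDensity μ f z) - 1 / 2 * ∫ r in Ioi (0 : ℝ), radialMass h r ^ 2 / r ^ 2 := by
  rw [functionalD, hf.functionalJ_eq,
    integral_norm_gradient_sq hh.measurable hh.nonneg hh.integrable hh.potential_eq]

section Calibrated

variable {μ p c C M R : ℝ} {φ σ : ℝ → ℝ} {f : R3 × R3 → ℝ} {h : ℝ → ℝ}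

lemma IsStellarProfile.continuousOn_multiplier (hS : IsStellarProfile p c M R φ)
    (hσ : IsMassInverse p c M R φ σ) (hh : IsRadialDensity f h) :
    ContinuousOn (fun r => calibMultiplier p φ σ (radialMass h r) r) (Ioi 0) := by
  have h1 := (hS.continuous_calibA hσ).comp hh.continuous_radialMass
  have h2 := (hS.continuous_calibB hσ).comp hh.continuous_radialMass
  exact h1.continuousOn.add (h2.continuousOn.div continuousOn_id fun r hr => ne_of_gt hr)

lemma IsStellarProfile.measurable_multiplier (hS : IsStellarProfile p c M R φ)
    (hσ : IsMassInverse p c M R φ σ) (hh : IsRadialDensity f h) :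
    Measurable (fun r => calibMultiplier p φ σ (radialMass h r) r) :=
  ((hS.continuous_calibA hσ).comp hh.continuous_radialMass).measurable.add
    (((hS.continuous_calibB hσ).comp hh.continuous_radialMass).measurable.div measurable_id)

lemma IsStellarProfile.continuous_calibN (hS : IsStellarProfile p c M R φ)
    (hσ : IsMassInverse p c M R φ σ) (hp : 0 ≤ p) : Continuous (calibN p C φ σ) := by
  have h1 := (hS.continuous.comp hσ.continuous).rpow_const (p := p + 1)
    fun _ => Or.inr (by linarith)
  have h2 := hσ.continuous
  simp only [Function.comp_def] at h1
  unfold calibN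
  fun_prop

lemma IsStellarProfile.continuousOn_deficit (hS : IsStellarProfile p c M R φ)
    (hσ : IsMassInverse p c M R φ σ) (hp : 0 ≤ p) (hh : IsRadialDensity f h) :
    ContinuousOn (fun r => calibDeficit p C φ σ (radialMass h r) r) (Ioi 0) := by
  have h1 := (hS.continuous_calibN (C := C) hσ hp).comp hh.continuous_radialMass
  have h2 := (continuous_max_rpow (p := p + 1) (by linarith)).comp_continuousOn
    (hS.continuousOn_multiplier hσ hh)
  refine (h1.continuousOn.div (by fun_prop) fun r hr => pow_ne_zero 2 (ne_of_gt hr)).sub ?_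
  exact (Continuous.continuousOn (by fun_prop)).mul (continuousOn_const.mul h2)

lemma IsRadialDensity.radialMass_mem (hf : MemF (polytrope μ) M f) (hh : IsRadialDensity f h)
    {r : ℝ} (hr : 0 ≤ r) : radialMass h r ∈ Icc 0 M :=
  ⟨hh.radialMass_nonneg hr, hh.radialMass_le hf r⟩

/-- The boundary term of the calibration. -/
noncomputable def calibBoundary (p : ℝ) (φ σ : ℝ → ℝ) (m r : ℝ) : ℝ :=
  (∫ t in (0 : ℝ)..m, calibA p φ σ t) + (∫ t in (0 : ℝ)..m, calibB p φ σ t) / r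

/-- An exact identity. The integrated Young deficit and the derivative of the calibration along the
mass curve share the term l m'; eliminating it and using ∫₀^m B = N + m²/2 leaves the energy, the
two deficits and the boundary terms. -/
lemma IsStellarProfile.shell_identity (hS : IsStellarProfile p c M R φ)
    (hσ : IsMassInverse p c M R φ σ) (hμ : 0 < μ) (hp : p = μ + 3 / 2) (hc : 0 < c)
    (hC : c = 4 * Real.pi * ((p + 1) * pressureConst μ)) (hf : MemF (polytrope μ) M f)
    (hh : IsRadialDensity f h) {a b : ℝ} (ha : 0 < a) (hab : a ≤ b) :
    (∫ z in phaseShell a b, energyDensity μ f z)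
        - 1 / 2 * ∫ r in a..b, radialMass h r ^ 2 / r ^ 2
      = (∫ z in phaseShell a b,
          youngDeficit μ f (fun r => calibMultiplier p φ σ (radialMass h r) r) z)
        + (∫ r in a..b, calibDeficit p (pressureConst μ) φ σ (radialMass h r) r)
        + (calibBoundary p φ σ (radialMass h b) b - calibBoundary p φ σ (radialMass h a) a) := by
  have hp0 : 0 ≤ p := by linarith
  set l : ℝ → ℝ := fun r => calibMultiplier p φ σ (radialMass h r) r with hl
  have hIcc : uIcc a b ⊆ Ioi 0 := by
    rw [uIcc_of_le hab]; exact fun x hx => ha.trans_le hx.1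
  have hlc : ContinuousOn l (Ioi 0) := hS.continuousOn_multiplier hσ hh
  obtain ⟨K, hK⟩ := isCompact_uIcc.exists_bound_of_continuousOn (hlc.mono hIcc)
  have hK' : ∀ r ∈ Ioc a b, |l r| ≤ K := fun r hr => hK r (by
    rw [uIcc_of_le hab]; exact Ioc_subset_Icc_self hr)
  have e1 := integral_youngDeficit hμ (hS.measurable_multiplier hσ hh) hf hh ha.le hab hK'
  have e2 := integral_calibration hh (hS.continuous_calibA hσ) (hS.continuous_calibB hσ) ha hab
  have i1 : IntervalIntegrable (fun r => l r * (4 * Real.pi * r ^ 2 * h r)) volume a b :=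
    hh.integrable_shell.intervalIntegrable.continuousOn_mul (hlc.mono hIcc)
  have cm2 : ContinuousOn (fun r => radialMass h r ^ 2 / r ^ 2) (Ioi 0) :=
    (hh.continuous_radialMass.pow 2).continuousOn.div (by fun_prop)
      fun r hr => pow_ne_zero 2 (ne_of_gt hr)
  have cN : ContinuousOn (fun r => calibN p (pressureConst μ) φ σ (radialMass h r) / r ^ 2)
      (Ioi 0) :=
    ((hS.continuous_calibN hσ hp0).comp hh.continuous_radialMass).continuousOn.div (by fun_prop)
      fun r hr => pow_ne_zero 2 (ne_of_gt hr)
  have cP : ContinuousOn (fun r => 4 * Real.pi * r ^ 2 * (pressureConst μ * (max (l r) 0) ^ (p + 1)))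
      (Ioi 0) :=
    (Continuous.continuousOn (by fun_prop)).mul (continuousOn_const.mul
      ((continuous_max_rpow (p := p + 1) (by linarith)).comp_continuousOn hlc))
  have i2 := (cm2.mono hIcc).intervalIntegrable (μ := volume)
  have i3 := (cN.mono hIcc).intervalIntegrable (μ := volume)
  have i4 := (cP.mono hIcc).intervalIntegrable (μ := volume)
  have e3 : ∫ r in a..b, (l r * (4 * Real.pi * r ^ 2 * h r)
        - (∫ t in (0 : ℝ)..radialMass h r, calibB p φ σ t) / r ^ 2)
      = (∫ r in a..b, l r * (4 * Real.pi * r ^ 2 * h r))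
        - ((∫ r in a..b, calibN p (pressureConst μ) φ σ (radialMass h r) / r ^ 2)
          + 1 / 2 * ∫ r in a..b, radialMass h r ^ 2 / r ^ 2) := by
    rw [← intervalIntegral.integral_const_mul, ← intervalIntegral.integral_add i3 (i2.const_mul _),
      ← intervalIntegral.integral_sub i1 (i3.add (i2.const_mul _))]
    refine intervalIntegral.integral_congr fun r hr => ?_
    have hr0 : 0 < r := hIcc hr
    rw [hS.integral_calibB hσ hp0 hc hC (hh.radialMass_mem hf hr0.le)]
    ring
  have e4 : ∫ r in a..b, calibDeficit p (pressureConst μ) φ σ (radialMass h r) r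
      = (∫ r in a..b, calibN p (pressureConst μ) φ σ (radialMass h r) / r ^ 2)
        - ∫ r in a..b, 4 * Real.pi * r ^ 2 * (pressureConst μ * (max (l r) 0) ^ (p + 1)) :=
    intervalIntegral.integral_sub i3 i4
  have e5 : ∫ r in a..b, (l r * (4 * Real.pi * r ^ 2 * h r)
        - (∫ t in (0 : ℝ)..radialMass h r, calibB p φ σ t) / r ^ 2)
      = calibBoundary p φ σ (radialMass h b) b - calibBoundary p φ σ (radialMass h a) a := e2
  rw [show μ + 5 / 2 = p + 1 by rw [hp]; ring] at e1
  rw [← e5, e3, e4, e1]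
  ring

end Calibrated

/-! ### Exhaustion by shells and vanishing of the inner boundary term -/

section Limits

variable {μ p c C M R : ℝ} {φ σ : ℝ → ℝ} {f : R3 × R3 → ℝ} {h : ℝ → ℝ}

lemma aecover_Ioc_of_tendsto_zero {a b : ℕ → ℝ} (ha : Tendsto a atTop (𝓝 0))
    (hb : Tendsto b atTop atTop) :
    AECover (volume.restrict (Ioi (0 : ℝ))) atTop fun k => Ioc (a k) (b k) := by
  refine ⟨(ae_restrict_iff' measurableSet_Ioi).2 (Eventually.of_forall fun x hx => ?_),
    fun _ => measurableSet_Ioc⟩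
  filter_upwards [ha.eventually_lt_const (mem_Ioi.1 hx), hb.eventually_ge_atTop x] with k h1 h2
    using ⟨h1, h2⟩

lemma aecover_phaseShell {a b : ℕ → ℝ} (ha : Tendsto a atTop (𝓝 0)) (hb : Tendsto b atTop atTop) :
    AECover (volume : Measure (R3 × R3)) atTop fun k => phaseShell (a k) (b k) := by
  refine ⟨?_, fun _ => measurableSet_phaseShell _ _⟩
  filter_upwards [ae_prod_norm_pos] with z hz
  filter_upwards [ha.eventually_lt_const hz, hb.eventually_ge_atTop ‖z.1‖] with k h1 h2
    using ⟨h1, h2⟩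

lemma tendsto_integral_Ioc_Ioi {g : ℝ → ℝ} (hg : IntegrableOn g (Ioi 0)) {a b : ℕ → ℝ}
    (ha : Tendsto a atTop (𝓝 0)) (hb : Tendsto b atTop atTop) (ha0 : ∀ k, 0 < a k)
    (hab : ∀ k, a k ≤ b k) :
    Tendsto (fun k => ∫ r in (a k)..(b k), g r) atTop (𝓝 (∫ r in Ioi 0, g r)) := by
  refine ((aecover_Ioc_of_tendsto_zero ha hb).integral_tendsto_of_countably_generated hg).congr
    fun k => ?_
  rw [intervalIntegral.integral_of_le (hab k), Measure.restrict_restrict measurableSet_Ioc,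
    inter_eq_left.2]
  exact fun x hx => (ha0 k).trans hx.1

lemma continuous_primitive_comp {A : ℝ → ℝ} (hA : Continuous A) :
    Continuous fun x => ∫ t in (0 : ℝ)..x, A t :=
  intervalIntegral.continuous_primitive (fun _ _ => hA.intervalIntegrable _ _) 0

lemma IsStellarProfile.tendsto_calibBoundary_atTop (hS : IsStellarProfile p c M R φ)
    (hσ : IsMassInverse p c M R φ σ) (hf : MemF (polytrope μ) M f) (hh : IsRadialDensity f h) :
    Tendsto (fun r => calibBoundary p φ σ (radialMass h r) r) atTop
      (𝓝 (∫ t in (0 : ℝ)..M, calibA p φ σ t)) := by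
  have hm := hh.tendsto_radialMass hf
  have h1 := (continuous_primitive_comp (hS.continuous_calibA hσ)).continuousAt.tendsto.comp hm
  have h2 := (continuous_primitive_comp (hS.continuous_calibB hσ)).continuousAt.tendsto.comp hm
  simpa [calibBoundary, Function.comp_def] using h1.add (h2.div_atTop tendsto_id)

lemma IsStellarProfile.exists_inv_cube_le (hS : IsStellarProfile p c M R φ)
    (hσ : IsMassInverse p c M R φ σ) (hp : 0 ≤ p) (hc : 0 < c) :
    ∃ K, 0 ≤ K ∧ ∀ m ∈ Icc 0 M, σ m ^ 3 ≤ K * m := by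
  have hR := hS.radius_pos
  have hφ := hS.pos hp hc (half_pos hR).le (half_lt_self hR)
  have hanti := hS.strictAntiOn hp hc
  set κ := c * (max (φ (R / 2)) 0) ^ p with hκ
  have hκ0 : 0 < κ := mul_pos hc (Real.rpow_pos_of_pos (lt_max_of_lt_left hφ) _)
  refine ⟨24 / κ, by positivity, fun m hm => ?_⟩
  have hs := hσ.mem m hm
  -- Halving σ keeps the radius below R/2, where φ is bounded away from zero; this costs the factor
  -- 8 in 24 = 3·8.
  have h1 := le_emdenMass hp hc hS.continuous hanti (r := σ m / 2) (s := R / 2) (by linarith [hs.1])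
    (by linarith [hs.2])
  have h2 : emdenMass p c φ (σ m / 2) ≤ m := by
    conv_rhs => rw [← hσ.right m hm]
    exact (hS.strictMonoOn_emdenMass hp hc).monotoneOn ⟨by linarith [hs.1], by linarith [hs.1, hs.2]⟩
      hs (by linarith [hs.1])
  rw [div_mul_eq_mul_div, le_div_iff₀ hκ0]
  linarith

/-- In (N(m) + m²/2)/r, the first term is controlled by σ⁴ ≲ m^{4/3} ≲ r^{4/(p+1)} and the second by
m² ≲ r^{6/(p+1)}. Both are o(r); the first requires p < 3. -/
lemma IsStellarProfile.tendsto_calibBoundary_zero (hS : IsStellarProfile p c M R φ)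
    (hσ : IsMassInverse p c M R φ σ) (hμ : 0 < μ) (hp : p = μ + 3 / 2) (hp3 : p < 3) (hc : 0 < c)
    (hC : c = 4 * Real.pi * ((p + 1) * pressureConst μ)) (hf : MemF (polytrope μ) M f)
    (hh : IsRadialDensity f h) :
    Tendsto (fun r => calibBoundary p φ σ (radialMass h r) r) (𝓝[>] 0) (𝓝 0) := by
  have hp0 : 0 ≤ p := by linarith
  have hp1 : 0 < p + 1 := by linarith
  have hm0 : radialMass h 0 = 0 := intervalIntegral.integral_same
  have h1 : Tendsto (fun r => ∫ t in (0 : ℝ)..radialMass h r, calibA p φ σ t) (𝓝[>] 0) (𝓝 0) := by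
    have := ((continuous_primitive_comp (hS.continuous_calibA hσ)).comp
      hh.continuous_radialMass).tendsto 0
    simp only [Function.comp_def, hm0, intervalIntegral.integral_same] at this
    exact this.mono_left nhdsWithin_le_nhds
  have h2 : Tendsto (fun r => (∫ t in (0 : ℝ)..radialMass h r, calibB p φ σ t) / r)
      (𝓝[>] 0) (𝓝 0) := by
    obtain ⟨K, hK0, hK⟩ := hh.exists_radialMass_le hμ hp hf
    obtain ⟨L, hL0, hL⟩ := hS.exists_inv_cube_le hσ hp0 hc
    have hCpos := pressureConst_pos hμ
    set P := 4 * Real.pi * pressureConst μ * φ 0 ^ (p + 1) * (L * K) ^ (4 / 3 : ℝ) with hP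
    have hpow : ∀ q : ℝ, 0 < q → Tendsto (fun r : ℝ => r ^ q) (𝓝[>] 0) (𝓝 0) := fun q hq => by
      have := (Real.continuous_rpow_const hq.le).tendsto 0
      rw [Real.zero_rpow hq.ne'] at this
      exact this.mono_left nhdsWithin_le_nhds
    have hq1 : 0 < 4 / (p + 1) - 1 := by
      rw [sub_pos, lt_div_iff₀ hp1]; linarith
    have hq2 : 0 < 6 / (p + 1) - 1 := by
      rw [sub_pos, lt_div_iff₀ hp1]; linarith
    have hlim : Tendsto (fun r : ℝ => P * r ^ (4 / (p + 1) - 1) + K ^ 2 / 2 * r ^ (6 / (p + 1) - 1))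
        (𝓝[>] 0) (𝓝 0) := by
      simpa using ((hpow _ hq1).const_mul P).add ((hpow _ hq2).const_mul (K ^ 2 / 2))
    refine squeeze_zero' (t₀ := 𝓝[>] 0) ?_ ?_ hlim
    · filter_upwards [self_mem_nhdsWithin] with r (hr : 0 < r)
      have hm := hh.radialMass_mem hf hr.le
      rw [hS.integral_calibB hσ hp0 hc hC hm]
      have hs := hσ.mem _ hm
      have hφ := Real.rpow_nonneg (hS.nonneg hp0 hc hs) (p + 1)
      rw [calibN]
      positivity
    · filter_upwards [self_mem_nhdsWithin] with r (hr : 0 < r)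
      have hm := hh.radialMass_mem hf hr.le
      have hs := hσ.mem _ hm
      have hφ := hS.nonneg hp0 hc hs
      have hmK := hK r hr
      rw [hS.integral_calibB hσ hp0 hc hC hm, Real.rpow_sub_one hr.ne', Real.rpow_sub_one hr.ne',
        ← mul_div_assoc, ← mul_div_assoc, ← add_div]
      refine div_le_div_of_nonneg_right (add_le_add ?_ ?_) hr.le
      · have e1 : σ (radialMass h r) ^ 4 ≤ (L * K) ^ (4 / 3 : ℝ) * r ^ (4 / (p + 1)) := by
          have e2 : σ (radialMass h r) ^ 3 ≤ L * K * r ^ (3 / (p + 1)) :=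
            (hL _ hm).trans (by rw [mul_assoc]; gcongr)
          calc σ (radialMass h r) ^ 4 = (σ (radialMass h r) ^ 3) ^ (4 / 3 : ℝ) := by
                rw [← Real.rpow_natCast, ← Real.rpow_natCast, ← Real.rpow_mul hs.1]; norm_num
            _ ≤ (L * K * r ^ (3 / (p + 1))) ^ (4 / 3 : ℝ) :=
                Real.rpow_le_rpow (pow_nonneg hs.1 3) e2 (by norm_num)
            _ = _ := by
                rw [Real.mul_rpow (by positivity) (by positivity), ← Real.rpow_mul hr.le]
                congr 2
                field_simp
        have e3 : φ (σ (radialMass h r)) ^ (p + 1) ≤ φ 0 ^ (p + 1) :=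
          Real.rpow_le_rpow hφ ((hS.strictAntiOn hp0 hc).antitoneOn self_mem_Ici hs.1 hs.1) hp1.le
        have e4 := hS.center_pos
        calc calibN p (pressureConst μ) φ σ (radialMass h r)
            ≤ 4 * Real.pi * pressureConst μ
              * ((L * K) ^ (4 / 3 : ℝ) * r ^ (4 / (p + 1)) * φ 0 ^ (p + 1)) := by
              rw [calibN]; gcongr
          _ = _ := by rw [hP]; ring
      · have e1 : r ^ (6 / (p + 1)) = (r ^ (3 / (p + 1))) ^ 2 := by
          rw [← Real.rpow_natCast, ← Real.rpow_mul hr.le]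
          congr 1
          push_cast
          ring
        rw [e1]
        calc radialMass h r ^ 2 / 2 ≤ (K * r ^ (3 / (p + 1))) ^ 2 / 2 := by
              have := hm.1
              gcongr
          _ = _ := by ring
  simpa [calibBoundary] using h1.add h2

lemma tendsto_inv_add_one : Tendsto (fun k : ℕ => ((k : ℝ) + 1)⁻¹) atTop (𝓝[>] 0) := by
  refine tendsto_nhdsWithin_iff.2 ⟨?_, Eventually.of_forall fun k => ?_⟩
  · simpa using tendsto_one_div_add_atTop_nhds_zero_nat (𝕜 := ℝ)
  · exact mem_Ioi.2 (by positivity)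

lemma tendsto_add_one : Tendsto (fun k : ℕ => (k : ℝ) + 1) atTop atTop :=
  tendsto_atTop_add_const_right _ _ tendsto_natCast_atTop_atTop

/-- The energy excess over the calibrated value is the limit of the accumulated deficits. -/
lemma IsStellarProfile.tendsto_deficit (hS : IsStellarProfile p c M R φ)
    (hσ : IsMassInverse p c M R φ σ) (hμ : 0 < μ) (hp : p = μ + 3 / 2) (hp3 : p < 3) (hc : 0 < c)
    (hC : c = 4 * Real.pi * ((p + 1) * pressureConst μ)) (hf : MemF (polytrope μ) M f)
    (hh : IsRadialDensity f h) :
    Tendsto (fun k : ℕ =>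
      (∫ z in phaseShell ((k : ℝ) + 1)⁻¹ (k + 1),
          youngDeficit μ f (fun r => calibMultiplier p φ σ (radialMass h r) r) z)
        + ∫ r in ((k : ℝ) + 1)⁻¹..(k + 1),
            calibDeficit p (pressureConst μ) φ σ (radialMass h r) r) atTop
      (𝓝 (functionalD (polytrope μ) f - ∫ t in (0 : ℝ)..M, calibA p φ σ t)) := by
  have ha := tendsto_inv_add_one
  have ha' := ha.mono_right nhdsWithin_le_nhds
  have hb := tendsto_add_one
  have ha0 : ∀ k : ℕ, 0 < ((k : ℝ) + 1)⁻¹ := fun k => by positivity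
  have hab : ∀ k : ℕ, ((k : ℝ) + 1)⁻¹ ≤ k + 1 := fun k => by
    have : (1 : ℝ) ≤ k + 1 := by linarith [k.cast_nonneg (α := ℝ)]
    exact (inv_le_one_of_one_le₀ this).trans this
  have h1 := (aecover_phaseShell ha' hb).integral_tendsto_of_countably_generated
    hf.integrable_energyDensity
  have h2 := tendsto_integral_Ioc_Ioi (hh.integrableOn_radialMass_sq hμ hp hp3 hf) ha' hb ha0 hab
  have h3 := (hS.tendsto_calibBoundary_atTop hσ hf hh).comp hb
  have h4 := (hS.tendsto_calibBoundary_zero hσ hμ hp hp3 hc hC hf hh).comp ha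
  have h5 := (h1.sub (h2.const_mul (1 / 2))).sub (h3.sub h4)
  rw [sub_zero, ← hf.functionalD_eq hh] at h5
  refine h5.congr fun k => ?_
  have := hS.shell_identity hσ hμ hp hc hC hf hh (ha0 k) (hab k)
  simp only [Function.comp]
  linarith

end Limits

/-! ### The equality case -/

/-- The isotropic phase space density with multiplier `φ`. -/
noncomputable def stellarDensity (μ : ℝ) (φ : ℝ → ℝ) (z : R3 × R3) : ℝ :=
  polytropeInv μ (φ ‖z.1‖ - 1 / 2 * ‖z.2‖ ^ 2)

section Equality

variable {μ p c C M R : ℝ} {φ σ : ℝ → ℝ} {f : R3 × R3 → ℝ} {h : ℝ → ℝ}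

lemma IsStellarProfile.exists_multiplier_bound (hS : IsStellarProfile p c M R φ)
    (hσ : IsMassInverse p c M R φ σ) (hh : IsRadialDensity f h) {a b : ℝ} (ha : 0 < a) :
    ∃ K, ∀ r ∈ Ioc a b, |calibMultiplier p φ σ (radialMass h r) r| ≤ K := by
  obtain ⟨K, hK⟩ := (isCompact_Icc (a := a) (b := b)).exists_bound_of_continuousOn
    ((hS.continuousOn_multiplier hσ hh).mono fun x hx => ha.trans_le hx.1)
  exact ⟨K, fun r hr => hK r (Ioc_subset_Icc_self hr)⟩

lemma MemF.youngDeficit_nonneg (hμ : 0 < μ) (hf : MemF (polytrope μ) M f) (l : ℝ → ℝ)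
    (s : Set (R3 × R3)) : 0 ≤ᵐ[volume.restrict s] youngDeficit μ f l :=
  ae_restrict_of_ae (by filter_upwards [hf.nonneg] with z hz using _root_.youngDeficit_nonneg hμ l hz)

lemma inv_add_one_le (k : ℕ) : ((k : ℝ) + 1)⁻¹ ≤ k + 1 := by
  have : (1 : ℝ) ≤ k + 1 := by linarith [k.cast_nonneg (α := ℝ)]
  exact (inv_le_one_of_one_le₀ this).trans this

lemma IsStellarProfile.integral_deficit_nonneg (hS : IsStellarProfile p c M R φ)
    (hσ : IsMassInverse p c M R φ σ) (hp : 0 ≤ p) (hp3 : p < 3) (hc : 0 < c) (hC : 0 < C)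
    (hf : MemF (polytrope μ) M f) (hh : IsRadialDensity f h) {a b : ℝ} (ha : 0 < a)
    (hab : a ≤ b) : 0 ≤ ∫ r in a..b, calibDeficit p C φ σ (radialMass h r) r :=
  intervalIntegral.integral_nonneg hab fun _ hr =>
    hS.calibDeficit_nonneg hσ hp hp3 hc hC (hh.radialMass_mem hf (ha.le.trans hr.1))
      (ha.trans_le hr.1)

/-- The lower bound for the energy. -/
lemma IsStellarProfile.le_functionalD (hS : IsStellarProfile p c M R φ)
    (hσ : IsMassInverse p c M R φ σ) (hμ : 0 < μ) (hp : p = μ + 3 / 2) (hp3 : p < 3) (hc : 0 < c)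
    (hC : c = 4 * Real.pi * ((p + 1) * pressureConst μ)) (hf : MemF (polytrope μ) M f) :
    ∫ t in (0 : ℝ)..M, calibA p φ σ t ≤ functionalD (polytrope μ) f := by
  obtain ⟨h, hh⟩ := hf.exists_isRadialDensity
  rw [← sub_nonneg]
  refine ge_of_tendsto' (hS.tendsto_deficit hσ hμ hp hp3 hc hC hf hh) fun k => ?_
  exact add_nonneg (integral_nonneg_of_ae (hf.youngDeficit_nonneg hμ _ _))
    (hS.integral_deficit_nonneg hσ (by linarith) hp3 hc (pressureConst_pos hμ) hf hh
      (by positivity) (inv_add_one_le k))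

/-- The accumulated deficits are nonnegative and increase with the shells, while their limit is at
most zero; so each one vanishes. Continuity upgrades the radial statement from almost every r to
every r. -/
lemma IsStellarProfile.deficit_eq_zero (hS : IsStellarProfile p c M R φ)
    (hσ : IsMassInverse p c M R φ σ) (hμ : 0 < μ) (hp : p = μ + 3 / 2) (hp3 : p < 3) (hc : 0 < c)
    (hC : c = 4 * Real.pi * ((p + 1) * pressureConst μ)) (hf : MemF (polytrope μ) M f)
    (hh : IsRadialDensity f h)
    (hle : functionalD (polytrope μ) f ≤ ∫ t in (0 : ℝ)..M, calibA p φ σ t) :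
    (∀ᵐ z, youngDeficit μ f (fun r => calibMultiplier p φ σ (radialMass h r) r) z = 0) ∧
      ∀ r, 0 < r → calibDeficit p (pressureConst μ) φ σ (radialMass h r) r = 0 := by
  have hp0 : 0 ≤ p := by linarith
  have hCp := pressureConst_pos hμ
  have hlim := hS.tendsto_deficit hσ hμ hp hp3 hc hC hf hh
  set Y := youngDeficit μ f (fun r => calibMultiplier p φ σ (radialMass h r) r) with hY
  set Δ := fun r => calibDeficit p (pressureConst μ) φ σ (radialMass h r) r with hΔ
  have ha0 : ∀ k : ℕ, 0 < ((k : ℝ) + 1)⁻¹ := fun k => by positivity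
  have hint : ∀ k : ℕ, IntegrableOn Y (phaseShell ((k : ℝ) + 1)⁻¹ (k + 1)) := fun k => by
    obtain ⟨K, hK⟩ := hS.exists_multiplier_bound hσ hh (b := (k : ℝ) + 1) (ha0 k)
    exact integrableOn_youngDeficit hμ (hS.measurable_multiplier hσ hh) hf hK
  have hcont : ∀ k : ℕ, ContinuousOn Δ (Icc ((k : ℝ) + 1)⁻¹ (k + 1)) := fun k =>
    (hS.continuousOn_deficit hσ hp0 hh).mono fun x hx => (ha0 k).trans_le hx.1
  have hΔ0 : ∀ r, 0 < r → 0 ≤ Δ r := fun r hr =>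
    hS.calibDeficit_nonneg hσ hp0 hp3 hc hCp (hh.radialMass_mem hf hr.le) hr
  have hY0 : ∀ k : ℕ, 0 ≤ ∫ z in phaseShell ((k : ℝ) + 1)⁻¹ (k + 1), Y z := fun k =>
    integral_nonneg_of_ae (hf.youngDeficit_nonneg hμ _ _)
  have hI0 : ∀ k : ℕ, 0 ≤ ∫ r in ((k : ℝ) + 1)⁻¹..(k + 1), Δ r := fun k =>
    hS.integral_deficit_nonneg hσ hp0 hp3 hc hCp hf hh (ha0 k) (inv_add_one_le k)
  have hmono : ∀ k j : ℕ, k ≤ j →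
      (∫ z in phaseShell ((k : ℝ) + 1)⁻¹ (k + 1), Y z) + ∫ r in ((k : ℝ) + 1)⁻¹..(k + 1), Δ r
      ≤ (∫ z in phaseShell ((j : ℝ) + 1)⁻¹ (j + 1), Y z)
        + ∫ r in ((j : ℝ) + 1)⁻¹..(j + 1), Δ r := by
    intro k j hkj
    have hkj' : (k : ℝ) ≤ j := by exact_mod_cast hkj
    have h1 : ((j : ℝ) + 1)⁻¹ ≤ ((k : ℝ) + 1)⁻¹ := by gcongr
    have h2 : Ioc ((k : ℝ) + 1)⁻¹ (k + 1) ⊆ Ioc ((j : ℝ) + 1)⁻¹ (j + 1) :=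
      Ioc_subset_Ioc h1 (by linarith)
    refine add_le_add ?_ ?_
    · exact setIntegral_mono_set (hint j) (hf.youngDeficit_nonneg hμ _ _)
        (preimage_mono h2).eventuallyLE
    · refine intervalIntegral.integral_mono_interval h1 (inv_add_one_le k) (by linarith)
        ((ae_restrict_iff' measurableSet_Ioc).2 (Eventually.of_forall fun r hr =>
          hΔ0 r ((ha0 j).trans hr.1))) ?_
      refine ContinuousOn.intervalIntegrable ?_
      rw [uIcc_of_le (inv_add_one_le j)]
      exact hcont j
  have hzero : ∀ k : ℕ, (∫ z in phaseShell ((k : ℝ) + 1)⁻¹ (k + 1), Y z) = 0 ∧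
      ∫ r in ((k : ℝ) + 1)⁻¹..(k + 1), Δ r = 0 := by
    intro k
    have h1 := ge_of_tendsto hlim ((eventually_ge_atTop k).mono fun j hj => hmono k j hj)
    have h2 := hY0 k
    have h3 := hI0 k
    constructor <;> linarith
  refine ⟨?_, fun r hr => ?_⟩
  · have h1 : ∀ᵐ z, ∀ k : ℕ, z ∈ phaseShell ((k : ℝ) + 1)⁻¹ (k + 1) → Y z = 0 := by
      rw [ae_all_iff]
      intro k
      have := (setIntegral_eq_zero_iff_of_nonneg_ae (hf.youngDeficit_nonneg hμ _ _) (hint k)).1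
        (hzero k).1
      exact (ae_restrict_iff' (measurableSet_phaseShell _ _)).1 this
    filter_upwards [h1, (aecover_phaseShell (tendsto_inv_add_one.mono_right nhdsWithin_le_nhds)
      tendsto_add_one).ae_eventually_mem] with z hz hz'
    obtain ⟨k, hk⟩ := hz'.exists
    exact hz k hk
  · by_contra hne
    have hpos : 0 < Δ r := lt_of_le_of_ne (hΔ0 r hr) (Ne.symm hne)
    have h1 := (tendsto_inv_add_one.mono_right nhdsWithin_le_nhds).eventually_lt_const hr
    have h2 := tendsto_add_one.eventually_gt_atTop r
    obtain ⟨k, hk1, hk2⟩ := (h1.and h2).exists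
    have := intervalIntegral.integral_pos (hk1.trans hk2) (hcont k)
      (fun x hx => hΔ0 x ((ha0 k).trans hx.1)) ⟨r, ⟨hk1.le, hk2.le⟩, hpos⟩
    exact this.ne' (hzero k).2

/-- Vanishing deficit determines the mass function. -/
lemma IsStellarProfile.radialMass_eq_of_deficit (hS : IsStellarProfile p c M R φ)
    (hσ : IsMassInverse p c M R φ σ) (hp : 0 < p) (hp3 : p < 3) (hc : 0 < c) (hC : 0 < C)
    (hf : MemF (polytrope μ) M f) (hh : IsRadialDensity f h)
    (h0 : ∀ r, 0 < r → calibDeficit p C φ σ (radialMass h r) r = 0) {r : ℝ} (hr : 0 ≤ r) :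
    radialMass h r = emdenMass p c φ r := by
  have hR := hS.radius_pos
  have hm0 : radialMass h 0 = 0 := intervalIntegral.integral_same
  have he0 : emdenMass p c φ 0 = 0 := intervalIntegral.integral_same
  -- Each mass value of the profile at s in ]0,R[ is attained by the competitor at some t, by the
  -- intermediate value theorem. The equality case of Bernoulli then gives t = σ(m) = s.
  have hin : EqOn (radialMass h) (emdenMass p c φ) (Ioo 0 R) := by
    intro s hs
    have hsm := hS.strictMonoOn_emdenMass hp.le hc
    have h1 : 0 < emdenMass p c φ s := by
      rw [← he0]; exact hsm ⟨le_rfl, hR.le⟩ (Ioo_subset_Icc_self hs) hs.1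
    have h2 : emdenMass p c φ s < M := by
      rw [← hS.mass]; exact hsm (Ioo_subset_Icc_self hs) ⟨hR.le, le_rfl⟩ hs.2
    obtain ⟨b, hb1, hb2⟩ := (((hh.tendsto_radialMass hf).eventually_const_lt h2).and
      (eventually_ge_atTop 0)).exists
    obtain ⟨t, ht, hts⟩ := intermediate_value_Icc hb2 hh.continuous_radialMass.continuousOn
      (show emdenMass p c φ s ∈ Icc (radialMass h 0) (radialMass h b) from
        ⟨hm0.trans_le h1.le, hb1.le⟩)
    have ht0 : 0 < t := by
      refine lt_of_le_of_ne ht.1 fun he => h1.ne ?_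
      rw [← hts, ← he, hm0]
    have h3 := h0 t ht0
    rw [hts] at h3
    have h4 := hS.inv_eq_of_calibDeficit_eq_zero hσ hp.le hp3 hc hC ⟨h1, h2⟩ ht0 h3
    rw [hσ.left s (Ioo_subset_Icc_self hs)] at h4
    rwa [← h4] at hts
  have hcl : EqOn (radialMass h) (emdenMass p c φ) (Icc 0 R) := by
    rw [← closure_Ioo hR.ne]
    exact hin.closure hh.continuous_radialMass (hS.continuous_emdenMass hp.le)
  rcases le_total r R with h | h
  · exact hcl ⟨hr, h⟩
  · rw [hS.emdenMass_of_ge hp hc h]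
    refine le_antisymm (hh.radialMass_le hf r) ?_
    have := hh.monotone_radialMass h
    rwa [hcl ⟨hR.le, le_rfl⟩, hS.mass] at this

/-- Inside R the multiplier equals φ. Outside it is 0 while φ ≤ 0; they may differ, but the inverse
of Q' vanishes at both arguments. -/
lemma IsStellarProfile.polytropeInv_multiplier (hS : IsStellarProfile p c M R φ)
    (hσ : IsMassInverse p c M R φ σ) (hμ : 0 < μ) (hp : 0 < p) (hc : 0 < c) {r : ℝ} (hr : 0 < r)
    (w : ℝ) :
    polytropeInv μ (calibMultiplier p φ σ (emdenMass p c φ r) r - 1 / 2 * w ^ 2)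
      = polytropeInv μ (φ r - 1 / 2 * w ^ 2) := by
  rw [calibMultiplier_eq hp.le]
  rcases le_total r R with h | h
  · rw [hσ.left r ⟨hr.le, h⟩, div_self hr.ne', sub_self, mul_zero, add_zero, mul_one]
  · have h1 := hS.nonpos hp.le hc h
    have h2 := sq_nonneg w
    rw [hS.emdenMass_of_ge hp hc h, ← hS.mass, hσ.left R ⟨hS.radius_pos.le, le_rfl⟩, hS.radius,
      zero_mul, polytropeInv_of_nonpos hμ (by linarith), polytropeInv_of_nonpos hμ (by linarith)]

lemma IsStellarProfile.calibDeficit_emdenMass (hS : IsStellarProfile p c M R φ)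
    (hσ : IsMassInverse p c M R φ σ) (hp : 0 < p) (hc : 0 < c) {r : ℝ} (hr : 0 < r) :
    calibDeficit p C φ σ (emdenMass p c φ r) r = 0 := by
  rcases le_total r R with h | h
  · exact hS.calibDeficit_eq_zero hσ hp.le hc (hS.emdenMass_mem hp.le hc ⟨hr.le, h⟩) hr
      (Or.inr (hσ.left r ⟨hr.le, h⟩))
  · rw [hS.emdenMass_of_ge hp hc h]
    refine hS.calibDeficit_eq_zero hσ hp.le hc ⟨(hS.mass_pos hp.le hc).le, le_rfl⟩ hr (Or.inl ?_)
    rw [← hS.mass, hσ.left R ⟨hS.radius_pos.le, le_rfl⟩, hS.radius]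

/-- Energies attaining the lower bound belong to the stellar density. -/
lemma IsStellarProfile.ae_eq_stellarDensity (hS : IsStellarProfile p c M R φ)
    (hσ : IsMassInverse p c M R φ σ) (hμ : 0 < μ) (hp : p = μ + 3 / 2) (hp3 : p < 3) (hc : 0 < c)
    (hC : c = 4 * Real.pi * ((p + 1) * pressureConst μ)) (hf : MemF (polytrope μ) M f)
    (hle : functionalD (polytrope μ) f ≤ ∫ t in (0 : ℝ)..M, calibA p φ σ t) :
    f =ᵐ[volume] stellarDensity μ φ := by
  have hp0 : 0 < p := by linarith
  obtain ⟨h, hh⟩ := hf.exists_isRadialDensity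
  obtain ⟨h1, h2⟩ := hS.deficit_eq_zero hσ hμ hp hp3 hc hC hf hh hle
  filter_upwards [h1, hf.nonneg, ae_prod_norm_pos] with z hz hz0 hzn
  rw [eq_of_youngDeficit_eq_zero hμ hz0 hz,
    hS.radialMass_eq_of_deficit hσ hp0 hp3 hc (pressureConst_pos hμ) hf hh h2 hzn.le,
    hS.polytropeInv_multiplier hσ hμ hp0 hc hzn]
  rfl

/-- The stellar density attains the lower bound. -/
lemma IsStellarProfile.functionalD_stellarDensity (hS : IsStellarProfile p c M R φ)
    (hσ : IsMassInverse p c M R φ σ) (hμ : 0 < μ) (hp : p = μ + 3 / 2) (hp3 : p < 3) (hc : 0 < c)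
    (hC : c = 4 * Real.pi * ((p + 1) * pressureConst μ))
    (hf : MemF (polytrope μ) M (stellarDensity μ φ)) (hh : IsRadialDensity (stellarDensity μ φ) h)
    (hm : ∀ r, 0 < r → radialMass h r = emdenMass p c φ r) :
    functionalD (polytrope μ) (stellarDensity μ φ) = ∫ t in (0 : ℝ)..M, calibA p φ σ t := by
  have hp0 : 0 < p := by linarith
  rw [← sub_eq_zero]
  refine tendsto_nhds_unique (hS.tendsto_deficit hσ hμ hp hp3 hc hC hf hh)
    (tendsto_const_nhds.congr fun k => ?_)
  have ha0 : 0 < ((k : ℝ) + 1)⁻¹ := by positivity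
  rw [setIntegral_congr_fun (g := fun _ => 0) (measurableSet_phaseShell _ _) fun z hz => ?_,
    intervalIntegral.integral_congr (g := fun _ => 0) fun r hr => ?_]
  · simp
  · rw [uIcc_of_le (inv_add_one_le k)] at hr
    have hr0 := ha0.trans_le hr.1
    simp only
    rw [hm r hr0, hS.calibDeficit_emdenMass hσ hp0 hc hr0]
  · have hz0 : 0 < ‖z.1‖ := ha0.trans hz.1
    refine youngDeficit_eq_zero hμ ?_
    rw [hm _ hz0, hS.polytropeInv_multiplier hσ hμ hp0 hc hz0]
    rfl

end Equality

/-! ### The stellar density as a member of `F_M` -/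

/-- The radial version of the spatial density of `stellarDensity μ φ`. -/
noncomputable def stellarShell (μ : ℝ) (φ : ℝ → ℝ) : ℝ → ℝ :=
  (Ioi (0 : ℝ)).indicator fun r => (μ + 5 / 2) * pressureConst μ * (max (φ r) 0) ^ (μ + 3 / 2)

lemma density_ae_congr {f g : R3 × R3 → ℝ} (h : f =ᵐ[volume] g) :
    density f =ᵐ[volume] density g := by
  rw [Measure.volume_eq_prod] at h
  filter_upwards [Measure.ae_ae_of_ae_prod h] with x hx
  exact integral_congr_ae hx

/-- Equality holds at every point, since the potential sees the spatial density only under an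
integral. This carries pointwise statements over to all minimizers. -/
lemma potential_ae_congr {f g : R3 × R3 → ℝ} (h : f =ᵐ[volume] g) : potential f = potential g := by
  ext x
  rw [potential, potential]
  congr 1
  refine integral_congr_ae ?_
  filter_upwards [density_ae_congr h] with y hy
  rw [hy]

lemma cutoffEnergy_ae_congr {Q : ℝ → ℝ} {M : ℝ} {f g : R3 × R3 → ℝ} (h : f =ᵐ[volume] g) :
    cutoffEnergy Q M f = cutoffEnergy Q M g := by
  rw [cutoffEnergy, cutoffEnergy]
  congr 1
  refine integral_congr_ae ?_
  filter_upwards [h] with z hz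
  rw [hz, potential_ae_congr h]

lemma profile_ae_congr {Q : ℝ → ℝ} {M : ℝ} {f g : R3 × R3 → ℝ} (h : f =ᵐ[volume] g) :
    profile Q M f = profile Q M g := by
  ext r
  rw [profile, profile, cutoffEnergy_ae_congr h, potential_ae_congr h]

namespace IsStellarProfile

variable {μ p c M R : ℝ} {φ σ : ℝ → ℝ}

lemma continuous_stellarDensity (hS : IsStellarProfile p c M R φ) (hμ : 0 < μ) :
    Continuous (stellarDensity μ φ) := by
  have h1 := continuous_polytropeInv hμ
  have h2 := hS.continuous
  unfold stellarDensity
  fun_prop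

lemma hasCompactSupport_stellarDensity (hS : IsStellarProfile p c M R φ) (hμ : 0 < μ) (hp : 0 ≤ p)
    (hc : 0 < c) : HasCompactSupport (stellarDensity μ φ) := by
  refine HasCompactSupport.intro (isCompact_closedBall (0 : R3 × R3) (max R (2 * φ 0 + 1)))
    fun z hz => polytropeInv_of_nonpos hμ ?_
  rw [mem_closedBall_zero_iff, Prod.norm_def, not_le] at hz
  have h0 := hS.center_pos
  rcases lt_max_iff.1 hz with h | h
  · have := hS.nonpos hp hc (le_of_lt (lt_of_le_of_lt (le_max_left _ _) h))
    have := sq_nonneg ‖z.2‖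
    linarith
  · have h1 := lt_of_le_of_lt (le_max_right _ _) h
    have h2 : φ ‖z.1‖ ≤ φ 0 :=
      (hS.strictAntiOn hp hc).antitoneOn self_mem_Ici (norm_nonneg _) (norm_nonneg _)
    nlinarith

lemma integrable_stellarDensity (hS : IsStellarProfile p c M R φ) (hμ : 0 < μ) (hp : 0 ≤ p)
    (hc : 0 < c) : Integrable (stellarDensity μ φ) :=
  (hS.continuous_stellarDensity hμ).integrable_of_hasCompactSupport
    (hS.hasCompactSupport_stellarDensity hμ hp hc)

lemma isRadialDensity (hS : IsStellarProfile p c M R φ) (hμ : 0 < μ) (hp : 0 ≤ p) (hc : 0 < c) :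
    IsRadialDensity (stellarDensity μ φ) (stellarShell μ φ) := by
  have hC := pressureConst_pos hμ
  have heq : density (stellarDensity μ φ) =ᵐ[volume] fun x => stellarShell μ φ ‖x‖ := by
    filter_upwards [ae_norm_pos] with x hx
    rw [stellarShell, indicator_of_mem (mem_Ioi.2 hx), ← integral_polytropeInv hμ]
    rfl
  refine ⟨?_, fun r => ?_, fun r hr => ?_, heq,
    (hS.integrable_stellarDensity hμ hp hc).integrable_density.congr heq⟩
  · refine Measurable.indicator ?_ measurableSet_Ioi
    have := (continuous_max_rpow (p := μ + 3 / 2) (by linarith)).comp hS.continuous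
    exact (continuous_const.mul this).measurable
  · refine indicator_nonneg (fun r _ => ?_) _
    have := Real.rpow_nonneg (le_max_right (φ r) 0) (μ + 3 / 2)
    positivity
  · exact indicator_of_notMem (fun h => not_lt.2 hr h) _

lemma shell_eq (hp : p = μ + 3 / 2) (hC : c = 4 * Real.pi * ((p + 1) * pressureConst μ)) {r : ℝ}
    (hr : 0 < r) : 4 * Real.pi * r ^ 2 * stellarShell μ φ r = r ^ 2 * (c * (max (φ r) 0) ^ p) := by
  rw [stellarShell, indicator_of_mem (mem_Ioi.2 hr), hC, hp]
  ring

lemma stellarShell_of_ge (hS : IsStellarProfile p c M R φ) (hμ : 0 < μ) (hp : 0 ≤ p) (hc : 0 < c)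
    {r : ℝ} (hr : R ≤ r) : stellarShell μ φ r = 0 := by
  rw [stellarShell, indicator_of_mem (mem_Ioi.2 (hS.radius_pos.trans_le hr)),
    max_eq_right (hS.nonpos hp hc hr), Real.zero_rpow (by linarith), mul_zero]

lemma radialMass_stellarShell (hp : p = μ + 3 / 2)
    (hC : c = 4 * Real.pi * ((p + 1) * pressureConst μ)) {r : ℝ} (hr : 0 ≤ r) :
    radialMass (stellarShell μ φ) r = emdenMass p c φ r := by
  refine intervalIntegral.integral_congr_ae (Eventually.of_forall fun s hs => ?_)
  rw [uIoc_of_le hr] at hs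
  exact shell_eq hp hC hs.1

lemma integral_stellarShell (hS : IsStellarProfile p c M R φ) (hμ : 0 < μ) (hp : p = μ + 3 / 2)
    (hc : 0 < c) (hC : c = 4 * Real.pi * ((p + 1) * pressureConst μ)) :
    ∫ x : R3, stellarShell μ φ ‖x‖ = M := by
  have hp0 : 0 < p := by linarith
  rw [integral_radial]
  have h1 := intervalIntegral_tendsto_integral_Ioi (0 : ℝ)
    (hS.isRadialDensity hμ hp0.le hc).integrable_shell.integrableOn tendsto_id
  refine tendsto_nhds_unique h1 (tendsto_const_nhds.congr' ?_)
  filter_upwards [eventually_ge_atTop R] with r hr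
  rw [← hS.emdenMass_of_ge hp0 hc hr, ← radialMass_stellarShell hp hC (hS.radius_pos.le.trans hr)]
  rfl

lemma memF_stellarDensity (hS : IsStellarProfile p c M R φ) (hμ : 0 < μ) (hp : p = μ + 3 / 2)
    (hc : 0 < c) (hC : c = 4 * Real.pi * ((p + 1) * pressureConst μ)) :
    MemF (polytrope μ) M (stellarDensity μ φ) := by
  have hp0 : 0 ≤ p := by linarith
  have hcont := hS.continuous_stellarDensity hμ
  have hsupp := hS.hasCompactSupport_stellarDensity hμ hp0 hc
  have hint := hS.integrable_stellarDensity hμ hp0 hc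
  have hq : 0 < 1 + 1 / μ := by positivity
  refine ⟨hint, Eventually.of_forall fun z => polytropeInv_nonneg hμ _, ?_, ?_, ?_, ?_⟩
  · rw [← hS.integral_stellarShell hμ hp hc hC,
      ← integral_congr_ae (hS.isRadialDensity hμ hp0 hc).density_eq, Measure.volume_eq_prod,
      integral_prod _ (by simpa [Measure.volume_eq_prod] using hint)]
    rfl
  · exact (hcont.rpow_const fun _ => Or.inr hq.le).integrable_of_hasCompactSupport
      (hsupp.comp_left (g := polytrope μ) (Real.zero_rpow hq.ne'))
  · exact ((by fun_prop : Continuous fun z : R3 × R3 => ‖z.2‖ ^ 2).mul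
      hcont).integrable_of_hasCompactSupport hsupp.mul_left
  · intro A _
    refine Eventually.of_forall fun z => ?_
    simp only [stellarDensity, A.norm_map]

lemma isMinimizer_stellarDensity (hS : IsStellarProfile p c M R φ) (hμ : 0 < μ)
    (hp : p = μ + 3 / 2) (hp3 : p < 3) (hc : 0 < c)
    (hC : c = 4 * Real.pi * ((p + 1) * pressureConst μ)) :
    IsMinimizer (polytrope μ) M (stellarDensity μ φ) := by
  have hp0 : 0 ≤ p := by linarith
  obtain ⟨σ, hσ⟩ := hS.exists_isMassInverse hp0 hc
  have hf := hS.memF_stellarDensity hμ hp hc hC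
  refine ⟨hf, fun g hg => ?_⟩
  rw [hS.functionalD_stellarDensity hσ hμ hp hp3 hc hC hf (hS.isRadialDensity hμ hp0 hc)
    fun r hr => radialMass_stellarShell hp hC hr.le]
  exact hS.le_functionalD hσ hμ hp hp3 hc hC hg

lemma ae_eq_of_isMinimizer (hS : IsStellarProfile p c M R φ) (hμ : 0 < μ)
    (hp : p = μ + 3 / 2) (hp3 : p < 3) (hc : 0 < c)
    (hC : c = 4 * Real.pi * ((p + 1) * pressureConst μ)) {f : R3 × R3 → ℝ}
    (hf : IsMinimizer (polytrope μ) M f) : f =ᵐ[volume] stellarDensity μ φ := by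
  have hp0 : 0 ≤ p := by linarith
  obtain ⟨σ, hσ⟩ := hS.exists_isMassInverse hp0 hc
  have hf0 := hS.memF_stellarDensity hμ hp hc hC
  refine hS.ae_eq_stellarDensity hσ hμ hp hp3 hc hC hf.1 ?_
  rw [← hS.functionalD_stellarDensity hσ hμ hp hp3 hc hC hf0 (hS.isRadialDensity hμ hp0 hc)
    fun r hr => radialMass_stellarShell hp hC hr.le]
  exact hf.2 _ hf0

/-! ### The potential of the stellar density -/

lemma radialPotential_of_ge (hS : IsStellarProfile p c M R φ) (hμ : 0 < μ) (hp : p = μ + 3 / 2)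
    (hc : 0 < c) (hC : c = 4 * Real.pi * ((p + 1) * pressureConst μ)) {r : ℝ} (hr : R ≤ r) :
    radialPotential (stellarShell μ φ) r = M / r := by
  rw [← hS.integral_stellarShell hμ hp hc hC, radialPotential, ← integral_div]
  congr 1
  ext y
  rcases le_total r ‖y‖ with h | h
  · rw [hS.stellarShell_of_ge hμ (by linarith) hc (hr.trans h), zero_div, zero_div]
  · rw [max_eq_left h]

/-- Both functions have derivative -m/r², so they differ by a constant, which is read off at r = R.
-/
lemma radialPotential_of_pos (hS : IsStellarProfile p c M R φ) (hμ : 0 < μ) (hp : p = μ + 3 / 2)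
    (hc : 0 < c) (hC : c = 4 * Real.pi * ((p + 1) * pressureConst μ)) {r : ℝ} (hr : 0 < r) :
    radialPotential (stellarShell μ φ) r = φ r + M / R := by
  have hp0 : 0 ≤ p := by linarith
  have hh := hS.isRadialDensity hμ hp0 hc
  have hder : ∀ x ∈ Ioi (0 : ℝ),
      HasDerivAt (fun x => radialPotential (stellarShell μ φ) x - φ x) 0 x := by
    intro x hx
    have h1 := hasDerivAt_radialPotential hh.measurable hh.nonneg hh.integrable (mem_Ioi.1 hx)
    rw [radialMass_stellarShell hp hC (mem_Ioi.1 hx).le] at h1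
    exact (h1.sub (hS.hasDerivAt x hx)).congr_deriv (sub_self _)
  have := isOpen_Ioi.is_const_of_deriv_eq_zero isPreconnected_Ioi
    (fun x hx => (hder x hx).differentiableAt.differentiableWithinAt)
    (fun x hx => (hder x hx).deriv) hr hS.radius_pos
  simp only [hS.radius, hS.radialPotential_of_ge hμ hp hc hC le_rfl, sub_zero] at this
  linarith

lemma integrable_stellarShell_div (hS : IsStellarProfile p c M R φ) (hμ : 0 < μ)
    (hp : p = μ + 3 / 2) (hc : 0 < c) (hC : c = 4 * Real.pi * ((p + 1) * pressureConst μ)) :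
    Integrable fun y : R3 => stellarShell μ φ ‖y‖ / ‖y‖ := by
  have hp0 : 0 ≤ p := by linarith
  refine (integrable_radial_iff (h := fun r => stellarShell μ φ r / r)).2 ?_
  have h1 : IntegrableOn (fun r => r * (c * (max (φ r) 0) ^ p)) (Ioc 0 R) := by
    have := (continuous_max_rpow hp0).comp hS.continuous
    simp only [Function.comp_def] at this
    exact (by fun_prop : Continuous fun r => r * (c * (max (φ r) 0) ^ p)).integrableOn_Ioc
  have h2 : IntegrableOn (fun r => 4 * Real.pi * r ^ 2 * (stellarShell μ φ r / r)) (Ioc 0 R) := by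
    refine h1.congr_fun (fun r hr => ?_) measurableSet_Ioc
    have := shell_eq (φ := φ) hp hC hr.1
    have hr0 := hr.1.ne'
    simp only
    rw [← mul_div_assoc, this]
    field_simp
  refine h2.of_forall_sdiff_eq_zero measurableSet_Ioi fun r hr => ?_
  have : R ≤ r := le_of_not_ge fun h => hr.2 ⟨hr.1, h⟩
  rw [hS.stellarShell_of_ge hμ hp0 hc this, zero_div, mul_zero]

lemma radialPotential_eq (hS : IsStellarProfile p c M R φ) (hμ : 0 < μ) (hp : p = μ + 3 / 2)
    (hc : 0 < c) (hC : c = 4 * Real.pi * ((p + 1) * pressureConst μ)) {r : ℝ} (hr : 0 ≤ r) :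
    radialPotential (stellarShell μ φ) r = φ r + M / R := by
  rcases hr.eq_or_lt with rfl | hr0
  · have hh := hS.isRadialDensity hμ (by linarith) hc
    -- The central value follows by dominated convergence, with the integrand at r = 0 as majorant.
    have h1 : Tendsto (radialPotential (stellarShell μ φ)) (𝓝[>] 0)
        (𝓝 (radialPotential (stellarShell μ φ) 0)) := by
      refine tendsto_integral_filter_of_dominated_convergence _
        (Eventually.of_forall fun r => ?_) (Eventually.of_forall fun r => ?_)
        (hS.integrable_stellarShell_div hμ hp hc hC) ?_
      · have := hh.measurable
        exact (Measurable.div (by fun_prop) (by fun_prop)).aestronglyMeasurable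
      · filter_upwards [ae_norm_pos] with y hy
        rw [Real.norm_of_nonneg (div_nonneg (hh.nonneg _) (hy.le.trans (le_max_right _ _)))]
        exact div_le_div_of_nonneg_left (hh.nonneg _) hy (le_max_right _ _)
      · filter_upwards [ae_norm_pos] with y hy
        refine tendsto_const_nhds.div ?_ (lt_max_of_lt_right hy).ne'
        exact ((continuous_id.max continuous_const).tendsto 0).mono_left nhdsWithin_le_nhds
    have h2 : Tendsto (radialPotential (stellarShell μ φ)) (𝓝[>] 0) (𝓝 (φ 0 + M / R)) := by
      refine (((hS.continuous.tendsto 0).mono_left nhdsWithin_le_nhds).add_const (M / R)).congr' ?_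
      filter_upwards [self_mem_nhdsWithin] with r hr
      exact (hS.radialPotential_of_pos hμ hp hc hC hr).symm
    exact tendsto_nhds_unique h1 h2
  · exact hS.radialPotential_of_pos hμ hp hc hC hr0

lemma potential_stellarDensity (hS : IsStellarProfile p c M R φ) (hμ : 0 < μ) (hp : p = μ + 3 / 2)
    (hc : 0 < c) (hC : c = 4 * Real.pi * ((p + 1) * pressureConst μ)) (x : R3) :
    potential (stellarDensity μ φ) x = -(M / R) - φ ‖x‖ := by
  rw [(hS.isRadialDensity hμ (by linarith) hc).potential_eq,
    hS.radialPotential_eq hμ hp hc hC (norm_nonneg x)]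
  ring

lemma potential_stellarDensity_of_ge (hS : IsStellarProfile p c M R φ) (hμ : 0 < μ)
    (hp : p = μ + 3 / 2) (hc : 0 < c) (hC : c = 4 * Real.pi * ((p + 1) * pressureConst μ)) {x : R3}
    (hx : R ≤ ‖x‖) : potential (stellarDensity μ φ) x = -M / ‖x‖ := by
  rw [(hS.isRadialDensity hμ (by linarith) hc).potential_eq,
    hS.radialPotential_of_ge hμ hp hc hC hx, neg_div]

/-- Where the density is positive, Q'(f) = φ - v²/2 cancels against v²/2 + U = v²/2 - M/R - φ, so
the integrand is -(M/R) f. -/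
lemma cutoffEnergy_stellarDensity (hS : IsStellarProfile p c M R φ) (hμ : 0 < μ)
    (hp : p = μ + 3 / 2) (hc : 0 < c) (hC : c = 4 * Real.pi * ((p + 1) * pressureConst μ)) :
    cutoffEnergy (polytrope μ) M (stellarDensity μ φ) = -(M / R) := by
  have hM := hS.mass_pos (by linarith) hc
  have h1 : ∀ z, (deriv (polytrope μ) (stellarDensity μ φ z) + (1 / 2 * ‖z.2‖ ^ 2
      + potential (stellarDensity μ φ) z.1)) * stellarDensity μ φ z
      = -(M / R) * stellarDensity μ φ z := by
    intro z
    rcases le_or_gt (φ ‖z.1‖ - 1 / 2 * ‖z.2‖ ^ 2) 0 with h | h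
    · rw [show stellarDensity μ φ z = 0 from polytropeInv_of_nonpos hμ h, mul_zero, mul_zero]
    · rw [hS.potential_stellarDensity hμ hp hc hC, show deriv (polytrope μ) (stellarDensity μ φ z)
        = φ ‖z.1‖ - 1 / 2 * ‖z.2‖ ^ 2 from deriv_polytrope hμ h]
      ring
  simp only [cutoffEnergy, h1]
  rw [integral_const_mul, (hS.memF_stellarDensity hμ hp hc hC).mass]
  field_simp

/-- The absolute value comes from reading the potential along a full axis; φ itself need not be
even. -/
lemma profile_stellarDensity (hS : IsStellarProfile p c M R φ) (hμ : 0 < μ)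
    (hp : p = μ + 3 / 2) (hc : 0 < c) (hC : c = 4 * Real.pi * ((p + 1) * pressureConst μ)) :
    profile (polytrope μ) M (stellarDensity μ φ) = fun r => φ |r| := by
  ext r
  rw [profile, hS.cutoffEnergy_stellarDensity hμ hp hc hC, hS.potential_stellarDensity hμ hp hc hC,
    norm_smul, PiLp.norm_single, norm_one, mul_one, Real.norm_eq_abs]
  ring

lemma isESolution_abs (hS : IsStellarProfile p c M R φ) (hp : 0 ≤ p) :
    IsESolution p c fun r => φ |r| := by
  refine isESolution_of_hasDerivAt hp (hS.continuous.comp continuous_abs).continuousOn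
    (by simpa using hS.center_pos) fun r hr => ?_
  have h1 : emdenMass p c (fun r => φ |r|) r = emdenMass p c φ r := by
    refine intervalIntegral.integral_congr fun s hs => ?_
    rw [uIcc_of_le hr.le] at hs
    simp only [abs_of_nonneg hs.1]
  rw [h1]
  refine (hS.hasDerivAt r hr).congr_of_eventuallyEq ?_
  filter_upwards [Ioi_mem_nhds hr] with s hs
  rw [abs_of_pos hs]

end IsStellarProfile

/-! ### Conclusion -/

/-- The scaling relation concerns r > 0 only; letting r → 0 gives φ(0) = γ^{2/(p-1)} φ(0) with φ(0)
> 0. -/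
lemma ScaledBy.eq_one {p c γ : ℝ} {φ : ℝ → ℝ} (hp : 1 < p) (hφ : IsESolution p c φ) (hγ : 0 < γ)
    (h : ScaledBy p γ φ φ) : γ = 1 := by
  have h0 : Tendsto φ (𝓝[>] 0) (𝓝 (φ 0)) :=
    (hφ.continuousOn 0 self_mem_Ici).mono Ioi_subset_Ici_self
  have h1 : Tendsto (fun r => γ * r) (𝓝[>] 0) (𝓝[>] 0) := by
    refine tendsto_nhdsWithin_iff.2 ⟨?_, ?_⟩
    · have : Tendsto (fun r : ℝ => γ * r) (𝓝 0) (𝓝 (γ * 0)) := (continuous_const_mul γ).tendsto 0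
      rw [mul_zero] at this
      exact this.mono_left nhdsWithin_le_nhds
    · filter_upwards [self_mem_nhdsWithin] with r hr using mul_pos hγ hr
  have h2 : Tendsto φ (𝓝[>] 0) (𝓝 (γ ^ (2 / (p - 1)) * φ 0)) := by
    refine ((h0.comp h1).const_mul _).congr' ?_
    filter_upwards [self_mem_nhdsWithin] with r hr using (h r hr).symm
  have h3 := tendsto_nhds_unique h0 h2
  have h4 : γ ^ (2 / (p - 1)) = 1 := by
    have := hφ.center_pos.ne'
    field_simp at h3
    linarith
  have h5 : 2 / (p - 1) ≠ 0 := (div_pos two_pos (by linarith)).ne'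
  exact Real.rpow_left_injOn h5 hγ.le (zero_le_one (α := ℝ)) (by simpa using h4)

theorem mainTheorem8 (μ : ℝ) (hμ_pos : 0 < μ) (hμ_lt : μ < 3 / 2) :
    -- E-solutions become solutions of one autonomous planar system, all on the same orbit,
    -- and any two of them differ by a scaling
    (∀ c : ℝ, 0 < c →
      (∀ φ : ℝ → ℝ, IsESolution (μ + 3 / 2) c φ → ∀ t : ℝ, 0 < φ (Real.exp t) →
        HasDerivAt (phaseCurve (μ + 3 / 2) φ)
          (phaseField (μ + 3 / 2) c (phaseCurve (μ + 3 / 2) φ t)) t) ∧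
      (∀ φ₁ φ₂ : ℝ → ℝ, IsESolution (μ + 3 / 2) c φ₁ → IsESolution (μ + 3 / 2) c φ₂ →
        phaseOrbit (μ + 3 / 2) φ₁ = phaseOrbit (μ + 3 / 2) φ₂ ∧
        ∃ γ : ℝ, 0 < γ ∧ ScaledBy (μ + 3 / 2) γ φ₁ φ₂)) ∧
    ∃ c : ℝ, 0 < c ∧ ∀ M : ℝ, 0 < M →
      -- there is a minimizer
      (∃ f, IsMinimizer (polytrope μ) M f) ∧
      -- every minimizer yields an E-solution and satisfies the exterior condition
      (∃ R₀ : ℝ, 0 < R₀ ∧ ∀ f, IsMinimizer (polytrope μ) M f →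
        (∀ x : R3, cutoffEnergy (polytrope μ) M f - potential f x
          = profile (polytrope μ) M f ‖x‖) ∧
        IsESolution (μ + 3 / 2) c (profile (polytrope μ) M f) ∧
        (∀ x : R3, R₀ ≤ ‖x‖ → potential f x = -M / ‖x‖)) ∧
      -- any two minimizers coincide
      (∀ f₁ f₂, IsMinimizer (polytrope μ) M f₁ → IsMinimizer (polytrope μ) M f₂ →
        phaseOrbit (μ + 3 / 2) (profile (polytrope μ) M f₁)
          = phaseOrbit (μ + 3 / 2) (profile (polytrope μ) M f₂) ∧
        (∃ γ : ℝ, 0 < γ ∧ ScaledBy (μ + 3 / 2) γ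
          (profile (polytrope μ) M f₁) (profile (polytrope μ) M f₂)) ∧
        (∀ γ : ℝ, 0 < γ → ScaledBy (μ + 3 / 2) γ
          (profile (polytrope μ) M f₁) (profile (polytrope μ) M f₂) → γ = 1) ∧
        cutoffEnergy (polytrope μ) M f₁ = cutoffEnergy (polytrope μ) M f₂ ∧
        potential f₁ = potential f₂ ∧
        f₁ =ᵐ[volume] f₂) := by
  have hp : 1 < μ + 3 / 2 := by linarith
  have hp0 : 0 ≤ μ + 3 / 2 := by linarith
  have hp3 : μ + 3 / 2 < 3 := by linarith
  -- The polytrope with multiplier φ has spatial density (p+1) C (φ₊)^p with C = `pressureConst μ`;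
  -- the factor 4π of Poisson's equation gives the constant c.
  refine ⟨fun c hc => ⟨fun φ hφ t ht => hφ.hasDerivAt_phaseCurve hp0 hc ht, fun φ₁ φ₂ h₁ h₂ => ?_⟩,
    4 * Real.pi * ((μ + 3 / 2 + 1) * pressureConst μ), ?_, fun M hM => ?_⟩
  · obtain ⟨γ, hγ, h⟩ := h₁.exists_scaledBy hp hc h₂
    exact ⟨h.phaseOrbit_eq hp hγ, γ, hγ, h⟩
  · have := pressureConst_pos hμ_pos
    positivity
  have hc : 0 < 4 * Real.pi * ((μ + 3 / 2 + 1) * pressureConst μ) := by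
    have := pressureConst_pos hμ_pos
    positivity
  obtain ⟨R, φ, hS⟩ := exists_isStellarProfile hp hp3 hc hM
  have hae : ∀ f, IsMinimizer (polytrope μ) M f → f =ᵐ[volume] stellarDensity μ φ :=
    fun f hf => hS.ae_eq_of_isMinimizer hμ_pos rfl hp3 hc rfl hf
  have hprof := hS.profile_stellarDensity hμ_pos rfl hc rfl
  have hE := hS.isESolution_abs hp0
  refine ⟨⟨_, hS.isMinimizer_stellarDensity hμ_pos rfl hp3 hc rfl⟩,
    ⟨R, hS.radius_pos, fun f hf => ⟨fun x => ?_, ?_, fun x hx => ?_⟩⟩, fun f₁ f₂ hf₁ hf₂ => ?_⟩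
  · rw [cutoffEnergy_ae_congr (hae f hf), potential_ae_congr (hae f hf), profile_ae_congr (hae f hf),
      hprof, hS.cutoffEnergy_stellarDensity hμ_pos rfl hc rfl,
      hS.potential_stellarDensity hμ_pos rfl hc rfl]
    simp only [abs_norm]
    ring
  · rwa [profile_ae_congr (hae f hf), hprof]
  · rw [potential_ae_congr (hae f hf)]
    exact hS.potential_stellarDensity_of_ge hμ_pos rfl hc rfl hx
  · have h12 : f₁ =ᵐ[volume] f₂ := (hae f₁ hf₁).trans (hae f₂ hf₂).symm
    -- Both profiles are now the same function, so γ = 1 serves as witness and self-scaling excludes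
    -- every other value.
    have h2 := hprof ▸ profile_ae_congr (Q := polytrope μ) (M := M) (hae f₂ hf₂)
    rw [profile_ae_congr h12, h2]
    exact ⟨rfl, ⟨1, one_pos, fun r _ => by simp⟩, fun γ hγ h => h.eq_one hp hE hγ,
      cutoffEnergy_ae_congr h12, potential_ae_congr h12, h12⟩
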